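/- Let $\mathbb F_q$ be a finite field with $q$ elements, $A=\mathbb F_q[\theta]$, $K=\mathbb F_q(\theta)$, and let $\mathbb C_\infty$ be the completion of an algebraic closure of $K_\infty=\mathbb F_q((1/\theta))$. Let $s\ge q$ be an integer with $s\equiv 1\pmod{q-1}$, put $m=\frac{s-1}{q-1}$, and let $t_1,\dots,t_s$ be indeterminates; for $a=\sum_i a_i\theta^i\in A$ write $a(t)=\sum_i a_it^i$. Let $\mathbb T_s$ be the Tate algebra of power series in $t_1,\dots,t_s$ over $\mathbb C_\infty$ with coefficients tending to $0$, with the Gauss norm, and $\mathbb T=\mathbb T_1$ (in the variable $t$). Fix $\varpi\in\mathbb C_\infty$ with $\varpi^{q-1}=-\theta$ and put $$\omega(t)=\varpi\prod_{i\ge 0}\Bigl(1-\frac{t}{\theta^{q^i}}\Bigr)^{-1}\in\mathbb T .$$ Let $\exp_C=\sum_{j\ge0}D_j^{-1}\tau^j$ be the Carlitz exponential on $\mathbb T$, where $D_0=1$, $D_j=(\theta^{q^j}-\theta)D_{j-1}^q$, and $\tau$ raises coefficients to the power $q$ and fixes $t$. Let $\widetilde\pi\in\mathbb C_\infty$ be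 its fundamental period, that is, the unique element with $\ker(\exp_C:\mathbb T\to\mathbb T)=\widetilde\pi A[t]$ and $\exp_C\bigl(\frac{\widetilde\pi}{\theta-t}\bigr)=\omega(t)$. For $d\ge1$ let $$F_d(1;s)=\sum_{i=0}^{d-1}\ \sum_{\substack{a\in A\text{ monic}\\ \deg a=i}}\frac{a(t_1)\cdots a(t_s)}{a}\in K[t_1,\dots,t_s].$$ Put $b_n(y)=\prod_{j=0}^{n-1}(y-\theta^{q^j})$, $l_n=\prod_{j=1}^{n}(\theta-\theta^{q^j})$, and, for $d\ge m$, $\Pi_{s,d}=b_{d-m}(t_1)\cdots b_{d-m}(t_s)/l_{d-1}$. Then the following hold. 1. There is a unique rational fraction $\mathbb H_s\in K(Y,t_1,\dots,t_s)$ such that, for all $d\ge m$, it has no pole at $Y=\theta^{q^{d-m}}$ and $F_d(1;s)=\Pi_{s,d}\,\mathbb H_s|_{Y=\theta^{q^{d-m}}}$; moreover $\mathbb H_s\in A[t_1,\dots,t_s][Y]$. 2. The limit $\zeta_A(1;s)=\lim_{d\to\infty}F_d(1;s)$ exists in $\mathbb T_s$, and there is a unique polynomial $\lambda_{1,s}\in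 A[t_1,\dots,t_s]$ such that, in $\mathbb T_s$, $$\zeta_A(1;s)=\frac{\widetilde\pi\,\lambda_{1,s}}{\omega(t_1)\cdots\omega(t_s)}.$$ 3. The leading coefficient of $\mathbb H_s$, as a polynomial in $Y$ with coefficients in $A[t_1,\dots,t_s]$, is $-\lambda_{1,s}$. -/

import Mathlib

open Filter Topology
open scoped NNReal WithZero Polynomial

noncomputable section

namespace CarlitzTate

/-! ### The fields `K = 𝔽_q(θ)`, `K_∞`, and `ℂ_∞`

`F` is a finite field with `q = Fintype.card F` elements, `A = F[X]` and `K = RatFunc F`; the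
variable `X` plays the role of `θ`. -/

section Fields

open Classical in
/-- `K_∞`, the completion of `K = F(θ)` at the infinite place. -/
abbrev KInfty (F : Type*) [Field F] : Type _ := RatFunc.CompletionAtInfty F

open Classical in
/-- The canonical embedding `K → K_∞`. -/
def ratToKInfty (F : Type*) [Field F] : RatFunc F →+* KInfty F := algebraMap (RatFunc F) (RatFunc.CompletionAtInfty F)

open Classical in
theorem valued_ratToKInfty (F : Type*) [Field F] (x : RatFunc F) :
    Valued.v (ratToKInfty F x) = RatFunc.inftyValuation F x := by
  let _ := RatFunc.inftyValued F
  exact Valued.extensionValuation_apply_coe x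

variable (F : Type*) [Field F] [Fintype F]

theorem one_lt_card : (1 : ℝ≥0) < (Fintype.card F : ℝ≥0) := by
  exact_mod_cast Fintype.one_lt_card

open Classical MonoidWithZeroHom.ValueGroup₀ in
/-- The valuation of `K_∞` has rank one; the absolute value is normalised by `|θ| = q`. -/
instance : Valuation.RankOne (Valued.v : Valuation (KInfty F) ℤᵐ⁰) where
  hom' := (WithZeroMulInt.toNNReal (one_lt_card F).ne_zero).comp embedding
  strictMono' := (WithZeroMulInt.toNNReal_strictMono (one_lt_card F)).comp embedding_strictMono
  exists_val_nontrivial := by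
    refine ⟨ratToKInfty F RatFunc.X, ?_⟩
    rw [valued_ratToKInfty, RatFunc.inftyValuation.X]
    simp

open Classical in
instance : NontriviallyNormedField (KInfty F) :=
  Valued.toNontriviallyNormedField (KInfty F) ℤᵐ⁰

open Classical in
instance : CompleteSpace (KInfty F) := by
  let _ : UniformSpace (RatFunc F) := (RatFunc.inftyValued F).toUniformSpace
  exact inferInstanceAs (CompleteSpace (UniformSpace.Completion (RatFunc F)))

/-- `K_∞^{ac}`, an algebraic closure of `K_∞`. -/
abbrev KInftyAc : Type _ := AlgebraicClosure (KInfty F)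

/-- The absolute value of `K_∞^{ac}` is the unique extension of the one of `K_∞`. -/
instance : NormedField (KInftyAc F) := spectralNorm.normedField (KInfty F) (KInftyAc F)

instance : NormedAlgebra (KInfty F) (KInftyAc F) :=
  spectralNorm.normedAlgebra (KInfty F) (KInftyAc F)

/-- `ℂ_∞`, the completion of `K_∞^{ac}`. -/
abbrev CInfty : Type _ := UniformSpace.Completion (KInftyAc F)

instance : IsUltrametricDist (CInfty F) := IsUltrametricDist.of_normedAlgebra (KInfty F)

/-- The canonical embedding `K → ℂ_∞`. -/
def ratToC : RatFunc F →+* CInfty F :=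
  ((algebraMap (KInftyAc F) (CInfty F)).comp (algebraMap (KInfty F) (KInftyAc F))).comp
    (ratToKInfty F)

/-- The element `θ` of `ℂ_∞`. -/
def thetaC : CInfty F := ratToC F RatFunc.X

/-- The `q`-power Frobenius endomorphism of `ℂ_∞`. -/
def frobC : CInfty F →+* CInfty F :=
  let _ : Algebra F (CInfty F) := ((ratToC F).comp RatFunc.C).toAlgebra
  (FiniteField.frobeniusAlgHom F (CInfty F)).toRingHom

theorem frobC_apply (x : CInfty F) : frobC F x = x ^ Fintype.card F := rfl

end Fields

/-! ### The Tate algebra `𝕋_s` -/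

section Tate

variable (F : Type*) [Field F] [Fintype F] (s : ℕ)

/-- The Tate algebra `𝕋_s`: formal power series in `t_1, …, t_s` over `ℂ_∞` whose coefficients
tend to zero. -/
abbrev Tate : Type _ :=
  ↥(MvPowerSeries.IsRestricted.subring (R := CInfty F) (σ := Fin s) (fun _ => (1 : ℝ)))

variable {F s}

/-- The Gauss norm on `𝕋_s`. -/
def tateNorm (f : Tate F s) : ℝ :=
  MvPowerSeries.gaussNorm (fun c : CInfty F => ‖c‖) (fun _ => (1 : ℝ)) f.1

theorem hasGaussNorm (f : Tate F s) :
    MvPowerSeries.HasGaussNorm (fun c : CInfty F => ‖c‖) (fun _ => (1 : ℝ)) f.1 := by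
  have h : Tendsto _ cofinite (𝓝 (0 : ℝ)) := f.2
  exact h.bddAbove_range_of_cofinite

theorem tateNorm_neg (f : Tate F s) : tateNorm (-f) = tateNorm f :=
  MvPowerSeries.gaussNorm_neg _ _ (fun x => norm_neg x) f.1

theorem tateNorm_add_le (f g : Tate F s) : tateNorm (f + g) ≤ max (tateNorm f) (tateNorm g) :=
  MvPowerSeries.gaussNorm_add_le_max _ _ f.1 g.1 (fun _ => zero_le_one) (fun a => norm_nonneg a)
    (IsUltrametricDist.norm_add_le_max) (hasGaussNorm f) (hasGaussNorm g)

theorem tateNorm_nonneg (f : Tate F s) : 0 ≤ tateNorm f :=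
  MvPowerSeries.gaussNorm_nonneg _ _ _ (fun a => norm_nonneg a)

theorem tateNorm_mul_le (f g : Tate F s) : tateNorm (f * g) ≤ tateNorm f * tateNorm g :=
  MvPowerSeries.gaussNorm_mul_le _ _ f.1 g.1 (fun _ => zero_le_one) (fun a => norm_nonneg a)
    (fun a b => norm_mul_le a b) (IsUltrametricDist.norm_add_le_max) norm_zero
    (hasGaussNorm f) (hasGaussNorm g)

theorem tateNorm_eq_zero {f : Tate F s} (h : tateNorm f = 0) : f = 0 :=
  Subtype.ext <| (MvPowerSeries.gaussNorm_eq_zero_iff _ _ f.1 norm_zero (fun a => norm_nonneg a)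
    (fun _ hx => norm_eq_zero.1 hx) (fun _ => zero_lt_one) (hasGaussNorm f)).1 h

/-- `𝕋_s` is a normed ring for the Gauss norm. -/
instance : NormedCommRing (Tate F s) where
  __ := (inferInstance : CommRing (Tate F s))
  norm := tateNorm
  dist f g := tateNorm (-f + g)
  dist_self f := by
    rw [neg_add_cancel]
    exact MvPowerSeries.gaussNorm_zero (σ := Fin s) (fun c : CInfty F => ‖c‖)
      (fun _ => (1 : ℝ)) norm_zero
  dist_comm f g := by rw [← tateNorm_neg]; congr 1; ring
  dist_triangle f g h := by
    have h1 : -f + h = (-f + g) + (-g + h) := by ring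
    rw [h1]
    exact (tateNorm_add_le _ _).trans
      (max_le_add_of_nonneg (tateNorm_nonneg _) (tateNorm_nonneg _))
  eq_of_dist_eq_zero {f g} h := by
    have := tateNorm_eq_zero h
    exact (neg_add_eq_zero.1 this)
  dist_eq f g := rfl
  norm_mul_le := tateNorm_mul_le

variable (F s) in
/-- Constants: the inclusion `ℂ_∞ → 𝕋_s`. -/
def const : CInfty F →+* Tate F s :=
  MvPowerSeries.C.codRestrict _ (MvPowerSeries.isRestricted_C _)

variable (F) in
/-- The variable `t_i` as an element of `𝕋_s`. -/
def tvar (i : Fin s) : Tate F s :=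
  ⟨MvPowerSeries.X i, MvPowerSeries.isRestricted_monomial _ _ _⟩

variable (F s) in
/-- The inclusion `K[t_1, …, t_s] → 𝕋_s`. -/
def polyToTate : MvPolynomial (Fin s) (RatFunc F) →+* Tate F s :=
  MvPolynomial.eval₂Hom ((const F s).comp (ratToC F)) (tvar F)

variable (F s) in
/-- The inclusion `A[t_1, …, t_s] → K[t_1, …, t_s]`. -/
def intToPoly : MvPolynomial (Fin s) F[X] →+* MvPolynomial (Fin s) (RatFunc F) :=
  MvPolynomial.map (algebraMap F[X] (RatFunc F))

/-- The `F[t_1, …, t_s]`-linear Frobenius `τ` of `𝕋_s`: raise every coefficient to the power `q`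
and fix the variables. -/
def tau (f : Tate F s) : Tate F s :=
  ⟨MvPowerSeries.map (frobC F) f.1, by
    have h : Tendsto _ cofinite (𝓝 (0 : ℝ)) := f.2
    have h2 := h.pow (Fintype.card F)
    rw [zero_pow Fintype.card_ne_zero] at h2
    refine h2.congr fun n => ?_
    simp [frobC_apply, Finsupp.prod]⟩

end Tate

/-! ### The Carlitz exponential, the Anderson–Thakur function, the fundamental period -/

section Period

variable {F : Type*} [Field F] [Fintype F] {s : ℕ}

variable (F) in
/-- `D_0 = 1` and `D_n = (θ^{q^n} - θ) D_{n-1}^q`. -/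
def carlitzD : ℕ → F[X]
  | 0 => 1
  | n + 1 => (Polynomial.X ^ Fintype.card F ^ (n + 1) - Polynomial.X) *
      carlitzD n ^ Fintype.card F

/-- The Carlitz exponential `exp_C(f) = ∑_{j ≥ 0} τ^j(f) / D_j` on `𝕋_s`. -/
def carlitzExp (f : Tate F s) : Tate F s :=
  ∑' j : ℕ, const F s (ratToC F (algebraMap F[X] (RatFunc F) (carlitzD F j)))⁻¹ * tau^[j] f

/-- The Anderson–Thakur function `ω(t_i) = ϖ ∏_{j ≥ 0} (1 - t_i / θ^{q^j})⁻¹` in `𝕋_s`, where `ϖ`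
is the chosen `(q - 1)`-th root of `-θ`. -/
def omega (ϖ : CInfty F) (i : Fin s) : Tate F s :=
  const F s ϖ *
    ∏' j : ℕ, Ring.inverse (1 - const F s ((thetaC F) ^ Fintype.card F ^ j)⁻¹ * tvar F i)

/-- `x` is the fundamental period of the Carlitz exponential: it generates the kernel of
`exp_C : 𝕋 → 𝕋` over `A[t]`, and among all such generators it is the one with
`exp_C (x / (θ - t)) = ω(t)`. -/
def IsFundamentalPeriod (ϖ x : CInfty F) : Prop :=
  (∀ f : Tate F 1, carlitzExp f = 0 ↔
    ∃ a : MvPolynomial (Fin 1) F[X], f = const F 1 x * polyToTate F 1 (intToPoly F 1 a)) ∧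
  carlitzExp (const F 1 x * Ring.inverse (const F 1 (thetaC F) - tvar F 0)) = omega ϖ 0

end Period

/-! ### Twisted power sums and the interpolating fraction -/

section Sums

variable (F : Type*) [Field F] [Fintype F] (s : ℕ)

open Classical in
/-- `A^+(d)`, the set of monic polynomials of degree `d`. -/
def monics (d : ℕ) : Finset F[X] :=
  Finset.univ.image fun c : Fin d → F =>
    Polynomial.X ^ d + ∑ i : Fin d, Polynomial.C (c i) * Polynomial.X ^ (i : ℕ)

theorem mem_monics {d : ℕ} {a : F[X]} : a ∈ monics F d ↔ a.Monic ∧ a.natDegree = d := by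
  classical
  simp only [monics, Finset.mem_image, Finset.mem_univ, true_and]
  constructor
  · rintro ⟨c, rfl⟩
    have h : (∑ i : Fin d, Polynomial.C (c i) * Polynomial.X ^ (i : ℕ)).degree <
        (d : WithBot ℕ) := by
      refine (Polynomial.degree_sum_le _ _).trans_lt
        ((Finset.sup_lt_iff (WithBot.bot_lt_coe d)).2 fun i _ => ?_)
      exact (Polynomial.degree_C_mul_X_pow_le _ _).trans_lt (Nat.cast_lt.2 i.2)
    refine ⟨Polynomial.monic_X_pow_add h, Polynomial.natDegree_eq_of_degree_eq_some ?_⟩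
    rw [Polynomial.degree_add_eq_left_of_degree_lt (by rwa [Polynomial.degree_X_pow]),
      Polynomial.degree_X_pow]
  · rintro ⟨ha, rfl⟩
    refine ⟨fun i => a.coeff i, ?_⟩
    rw [Fin.sum_univ_eq_sum_range
      (fun i => Polynomial.C (a.coeff i) * Polynomial.X ^ i) a.natDegree]
    exact ha.as_sum.symm

/-- `S_d(n; s) = ∑_{a ∈ A^+(d)} a(t_1) ⋯ a(t_s) / a^n`. -/
def powerSum (n : ℤ) (d : ℕ) : MvPolynomial (Fin s) (RatFunc F) :=
  ∑ a ∈ monics F d,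
    MvPolynomial.C ((algebraMap F[X] (RatFunc F) a ^ n)⁻¹) *
      ∏ i : Fin s, Polynomial.aeval (MvPolynomial.X i : MvPolynomial (Fin s) (RatFunc F)) a

/-- `F_d(n; s) = ∑_{i < d} S_i(n; s)`. -/
def harmonicSum (n : ℤ) (d : ℕ) : MvPolynomial (Fin s) (RatFunc F) :=
  ∑ i ∈ Finset.range d, powerSum F s n i

/-- `z = ζ_A(n; s)`: the sums `F_d(n; s)` converge to `z` in `𝕋_s`. -/
def IsZetaValue (n : ℤ) (z : Tate F s) : Prop :=
  Tendsto (fun d => polyToTate F s (harmonicSum F s n d)) atTop (𝓝 z)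

/-- The field `K(t_1, …, t_s)`. -/
abbrev RatT : Type _ := FractionRing (MvPolynomial (Fin s) (RatFunc F))

/-- The inclusion `K → K(t_1, …, t_s)`. -/
def ratToRatT : RatFunc F →+* RatT F s :=
  (algebraMap (MvPolynomial (Fin s) (RatFunc F)) (RatT F s)).comp MvPolynomial.C

/-- `θ` as an element of `K(t_1, …, t_s)`. -/
def theta : RatT F s := ratToRatT F s RatFunc.X

variable {F s} in
/-- `b_n(y) = (y - θ)(y - θ^q) ⋯ (y - θ^{q^{n-1}})` for `y ∈ K(t_1, …, t_s)`. -/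
def bval (n : ℕ) (y : RatT F s) : RatT F s :=
  ∏ j ∈ Finset.range n, (y - theta F s ^ Fintype.card F ^ j)

/-- `l_n = (θ - θ^q) ⋯ (θ - θ^{q^n})`. -/
def lval (n : ℕ) : RatT F s :=
  ∏ j ∈ Finset.range n, (theta F s - theta F s ^ Fintype.card F ^ (j + 1))

/-- `m = ⌊(s - 1) / (q - 1)⌋` (for `s ≥ 1`). -/
def mval : ℕ := (s - 1) / (Fintype.card F - 1)

/-- `Π_{s,d} = b_{d-m}(t_1) ⋯ b_{d-m}(t_s) / l_{d-1}`, for `d ≥ max(1, m)`. -/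
def PiVal (d : ℕ) : RatT F s :=
  (∏ i : Fin s, bval (d - mval F s)
    (algebraMap (MvPolynomial (Fin s) (RatFunc F)) (RatT F s) (MvPolynomial.X i))) /
      lval F s (d - 1)

variable {F s} in
/-- `R = ℍ_s`: the rational fraction `R ∈ K(t_1, …, t_s)(Y)` has no pole at `Y = θ^{q^{d-m}}` and
satisfies `F_d(1; s) = Π_{s,d} ⬝ R|_{Y = θ^{q^{d-m}}}`, for all `d ≥ max(1, m)`. -/
def IsHFraction (R : RatFunc (RatT F s)) : Prop :=
  ∀ d : ℕ, 1 ≤ d → mval F s ≤ d →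
    R.denom.eval (theta F s ^ Fintype.card F ^ (d - mval F s)) ≠ 0 ∧
    algebraMap (MvPolynomial (Fin s) (RatFunc F)) (RatT F s) (harmonicSum F s 1 d) =
      PiVal F s d *
        R.eval (RingHom.id (RatT F s)) (theta F s ^ Fintype.card F ^ (d - mval F s))

/-- The inclusion `A[t_1, …, t_s][Y] → K(t_1, …, t_s)(Y)`. -/
def polyYToFraction : (MvPolynomial (Fin s) F[X])[X] →+* RatFunc (RatT F s) :=
  (algebraMap (RatT F s)[X] (RatFunc (RatT F s))).comp
    (Polynomial.mapRingHom
      ((algebraMap (MvPolynomial (Fin s) (RatFunc F)) (RatT F s)).comp (intToPoly F s)))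

end Sums

end CarlitzTate

end

/-! The harmonic sum is computed exactly. Since s ≡ 1 mod q-1, the function a ↦ ∏ a(t_i)/a is
invariant under F^*, so F_d is minus the sum over all nonzero a of degree < d
(`sum_monics_lt_eq_neg_sum`). Newton interpolation at θ, θ^q, … gives a(t) = ∑_j E_j(a) b_j(t), with
E_j the normalised Carlitz polynomials. A sum over F^d of a polynomial function of degree < d(q-1)
is zero.

Take d = n + m. This vanishing removes the terms j < n from every a(t_i) (`sum_prod_div_congr`).
What remains is b_n(t_i) times a polynomial in w = E_n(a) whose coefficients depend on n only
through Y = θ^{q^n} (`eval_annPoly`). The product over i may be reduced modulo the polynomial M_m,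
which vanishes at these w. In the sum of w^j/a only j = 1 then survives (`sum_eval_div`),
contributing 1/l_n up to sign. Thus F_d/Π_{s,d} is the value at Y = θ^{q^n} of one fraction P/Q,
with Q monic in Y and free of the t_i (`harmonic_eq_linearCoeff`).

Integrality: l_{d-1} clears all denominators of F_d, and the b_n(t_i) are monic in t_i, so Q divides
P at every Y = θ^{q^n}. A comparison of degrees in θ turns this into Q ∣ P
(`map_C_dvd_of_forall_eval_dvd`). Uniqueness holds because the points θ^{q^n} are infinitely many
(`isHFraction_iff`).

Analysis: the partial fraction expansion of ω is, term by term, the series exp_C(π/(θ - t)) for an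
explicit product π (`carlitzExp_period`), and a descent on norms shows that π generates the kernel
(`carlitzExp_eq_zero_iff`).

Limit: pulling the powers of θ out of F_{n+m} = Π ℍ leaves a scalar times a factor converging to a
nonzero element of 𝕋_s. All F_d with d ≥ 1 have norm 1, which forces deg_Y ℍ = (q^m - s)/(q - 1)
(`natDegree_eq_of_norm_eq_one`). For that degree the scalar does not depend on n (`scaleC_eq`), so
the sums converge, and the limit is read off as -π · (leading coefficient of ℍ) / ∏ ω(t_i). -/

namespace CarlitzTate

section Algebra

variable {F L : Type*} [Field F] [Field L] [Algebra F L]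

/-! ### Functions of bounded degree on `F ^ d` -/

/-- `g : F ^ d → L` is given by a polynomial of total degree at most `N`. -/
def HasDeg {d : ℕ} (N : ℕ) (g : (Fin d → F) → L) : Prop :=
  ∃ p : MvPolynomial (Fin d) L, p.totalDegree ≤ N ∧
    ∀ c, g c = MvPolynomial.eval (fun i => algebraMap F L (c i)) p

namespace HasDeg

variable {d M N : ℕ} {f g : (Fin d → F) → L}

theorem mono (h : HasDeg M g) (hMN : M ≤ N) : HasDeg N g := by
  obtain ⟨p, hp, hg⟩ := h
  exact ⟨p, hp.trans hMN, hg⟩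

theorem congr (h : HasDeg N f) (hfg : ∀ c, g c = f c) : HasDeg N g := by
  rwa [show g = f from funext hfg]

theorem const (N : ℕ) (x : L) : HasDeg N (fun _ : Fin d → F => x) :=
  ⟨MvPolynomial.C x, by simp, by simp⟩

theorem add (hf : HasDeg N f) (hg : HasDeg N g) : HasDeg N (fun c => f c + g c) := by
  obtain ⟨p, hp, hf⟩ := hf
  obtain ⟨r, hr, hg⟩ := hg
  exact ⟨p + r, (MvPolynomial.totalDegree_add _ _).trans (max_le hp hr), fun c => by
    simp [hf, hg]⟩

theorem mul (hf : HasDeg M f) (hg : HasDeg N g) : HasDeg (M + N) (fun c => f c * g c) := by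
  obtain ⟨p, hp, hf⟩ := hf
  obtain ⟨r, hr, hg⟩ := hg
  exact ⟨p * r, (MvPolynomial.totalDegree_mul _ _).trans (add_le_add hp hr), fun c => by
    simp [hf, hg]⟩

theorem const_mul (x : L) (hg : HasDeg N g) : HasDeg N (fun c => x * g c) := by
  simpa using (HasDeg.const 0 x).mul hg

theorem sub (hf : HasDeg N f) (hg : HasDeg N g) : HasDeg N (fun c => f c - g c) := by
  simpa [sub_eq_add_neg] using hf.add (hg.const_mul (-1))

theorem pow (hf : HasDeg N f) (k : ℕ) : HasDeg (k * N) (fun c => f c ^ k) := by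
  induction k with
  | zero => simpa using HasDeg.const 0 1
  | succ k ih => simpa [pow_succ, Nat.succ_mul] using ih.mul hf

theorem sum {ι : Type*} (t : Finset ι) {f : ι → (Fin d → F) → L} (h : ∀ i ∈ t, HasDeg N (f i)) :
    HasDeg N (fun c => ∑ i ∈ t, f i c) := by
  classical
  induction t using Finset.induction_on with
  | empty => simpa using HasDeg.const N 0
  | insert i t hi ih =>
    simpa [Finset.sum_insert hi] using
      (h i (Finset.mem_insert_self _ _)).add (ih fun j hj => h j (Finset.mem_insert_of_mem hj))

theorem prod {ι : Type*} (t : Finset ι) {f : ι → (Fin d → F) → L} (h : ∀ i ∈ t, HasDeg N (f i)) :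
    HasDeg (t.card * N) (fun c => ∏ i ∈ t, f i c) := by
  classical
  induction t using Finset.induction_on with
  | empty => simpa using HasDeg.const 0 1
  | insert i t hi ih =>
    have := (h i (Finset.mem_insert_self _ _)).mul
      (ih fun j hj => h j (Finset.mem_insert_of_mem hj))
    simpa [Finset.prod_insert hi, Finset.card_insert_of_notMem hi, Nat.succ_mul, add_comm]
      using this

theorem linear (φ : (Fin d → F) →ₗ[F] L) : HasDeg 1 φ := by
  refine ⟨∑ i, MvPolynomial.C (φ (Pi.single i 1)) * MvPolynomial.X i, ?_, fun c => ?_⟩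
  · refine MvPolynomial.totalDegree_finsetSum_le fun i _ => ?_
    exact (MvPolynomial.totalDegree_mul _ _).trans (by simp)
  · conv_lhs => rw [← Finset.univ_sum_single c, map_sum]
    simp only [map_sum, map_mul, MvPolynomial.eval_C, MvPolynomial.eval_X]
    refine Finset.sum_congr rfl fun i _ => ?_
    have : Pi.single i (c i) = c i • (Pi.single i (1 : F) : Fin d → F) := by
      rw [← Pi.single_smul, smul_eq_mul, mul_one]
    rw [this, map_smul, Algebra.smul_def, mul_comm]

/-- The Chevalley–Warning argument: a monomial of degree below d(q-1) has an exponent below q-1, and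
its sum over that coordinate is 0. The vanishing statements for sums of quotients by A reduce to
this by a degree count. -/
theorem sum_eq_zero [Fintype F] (h : HasDeg N g) (hN : N < d * (Fintype.card F - 1)) : ∑ c, g c = 0 := by
  obtain ⟨p, hp, hg⟩ := h
  simp only [hg, MvPolynomial.eval_eq']
  rw [Finset.sum_comm]
  refine Finset.sum_eq_zero fun μ hμ => ?_
  rw [← Finset.mul_sum]
  have h1 := MvPolynomial.sum_eval_eq_zero (MvPolynomial.monomial μ (1 : F)) (by
    rw [MvPolynomial.totalDegree_monomial _ one_ne_zero, Fintype.card_fin, mul_comm]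
    exact ((MvPolynomial.le_totalDegree hμ).trans hp).trans_lt hN)
  have h2 := congrArg (algebraMap F L) h1
  simp only [MvPolynomial.eval_monomial, one_mul, map_sum, map_zero,
    Finsupp.prod_fintype _ _ (fun _ => pow_zero _), map_prod, map_pow] at h2
  rw [h2, mul_zero]

end HasDeg

/-- If `φ` is `F`-linear, then `φ ^ N` with `N < q ^ m` has degree at most `m (q - 1)`, and
strictly less unless `N = q ^ m - 1`. -/
theorem hasDeg_pow_of_linear [Fintype F] {d : ℕ} (m : ℕ) : ∀ (N : ℕ) (φ : (Fin d → F) →ₗ[F] L),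
    N < Fintype.card F ^ m →
    HasDeg (m * (Fintype.card F - 1)) (fun c => φ c ^ N) ∧
    (N + 1 < Fintype.card F ^ m → HasDeg (m * (Fintype.card F - 1) - 1) (fun c => φ c ^ N)) := by
  have hq : 1 < Fintype.card F := Fintype.one_lt_card
  induction m with
  | zero =>
    intro N φ hN
    obtain rfl : N = 0 := by simpa using hN
    exact ⟨by simpa using HasDeg.const 0 1, by simp⟩
  | succ m ih =>
    intro N φ hN
    set q := Fintype.card F with hqdef
    -- The q-power map of L is F-linear, so φ^q is again a linear form. Hence φ^N has degree at most
    -- the sum of the base-q digits of N; the induction splits off the last digit.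
    let ψ : (Fin d → F) →ₗ[F] L := (FiniteField.frobeniusAlgHom F L).toLinearMap ∘ₗ φ
    have hψ : ∀ c, ψ c = φ c ^ q := fun c => rfl
    have hsplit : ∀ c, φ c ^ N = ψ c ^ (N / q) * φ c ^ (N % q) := fun c => by
      rw [hψ, ← pow_mul, ← pow_add, Nat.div_add_mod]
    have hdiv : N / q < q ^ m := by
      rw [Nat.div_lt_iff_lt_mul (by omega)]; simpa [pow_succ] using hN
    have hmod : N % q < q := Nat.mod_lt _ (by omega)
    obtain ⟨h1, h2⟩ := ih (N / q) ψ hdiv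
    have h3 : HasDeg (N % q) (fun c => φ c ^ (N % q)) := by
      simpa using (HasDeg.linear φ).pow (N % q)
    simp only [hsplit]
    refine ⟨(h1.mul h3).mono (by rw [Nat.succ_mul]; omega), fun hlt => ?_⟩
    -- If the last digit is maximal, the higher digits are not all maximal and the gain comes from
    -- them; otherwise the last digit itself saves one.
    by_cases hc : N % q = q - 1
    · have hdm := Nat.div_add_mod N q
      have : N / q + 1 < q ^ m := by
        have : q * (N / q + 1) < q * q ^ m := by
          rw [pow_succ'] at hlt
          rw [mul_add]; omega
        exact lt_of_mul_lt_mul_left this (by omega)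
      -- Ensures that the truncated subtraction m(q-1) - 1 is a genuine drop.
      have hm : 0 < m * (q - 1) := by
        rcases Nat.eq_zero_or_pos m with rfl | hm
        · simp at this
        · exact Nat.mul_pos hm (by omega)
      exact ((h2 this).mul h3).mono (by rw [Nat.succ_mul]; omega)
    · exact (h1.mul h3).mono (by rw [Nat.succ_mul]; omega)

/-! ### Polynomials with given coefficients -/

/-- The polynomial `∑ i, c i * X ^ i`. -/
noncomputable def coeffPoly {F : Type*} [Field F] {d : ℕ} : (Fin d → F) →ₗ[F] F[X] where
  toFun c := ∑ i, Polynomial.C (c i) * Polynomial.X ^ (i : ℕ)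
  map_add' c c' := by simp [add_mul, Finset.sum_add_distrib]
  map_smul' x c := by
    simp [Polynomial.smul_eq_C_mul, Finset.mul_sum, mul_assoc]

theorem coeffPoly_apply {d : ℕ} (c : Fin d → F) :
    coeffPoly c = ∑ i, Polynomial.C (c i) * Polynomial.X ^ (i : ℕ) := rfl

theorem coeffPoly_snoc {d : ℕ} (c : Fin d → F) (x : F) :
    coeffPoly (Fin.snoc c x : Fin (d + 1) → F) = Polynomial.C x * Polynomial.X ^ d + coeffPoly c := by
  rw [coeffPoly_apply, Fin.sum_univ_castSucc]
  simp [coeffPoly_apply, add_comm]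

theorem coeff_coeffPoly {d : ℕ} (c : Fin d → F) (i : Fin d) : (coeffPoly c).coeff i = c i := by
  simp [coeffPoly_apply, Polynomial.coeff_X_pow, Fin.val_inj]

theorem aeval_coeffPoly {R : Type*} [CommRing R] [Algebra F R] {d : ℕ} (c : Fin d → F) (x : R) :
    Polynomial.aeval x (coeffPoly c) = ∑ i : Fin d, c i • x ^ (i : ℕ) := by
  simp [coeffPoly_apply, Algebra.smul_def]

theorem coeffPoly_injective {d : ℕ} : Function.Injective (coeffPoly : (Fin d → F) →ₗ[F] F[X]) :=
  fun c c' h => funext fun i => by rw [← coeff_coeffPoly c, h, coeff_coeffPoly]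

variable [Fintype F]

theorem sum_monics_eq {M : Type*} [AddCommMonoid M] (d : ℕ) (f : F[X] → M) :
    ∑ a ∈ monics F d, f a = ∑ c : Fin d → F, f (Polynomial.X ^ d + coeffPoly c) := by
  classical
  unfold monics
  rw [Finset.sum_image]
  · rfl
  · intro c _ c' _ h
    exact coeffPoly_injective (add_left_cancel h)

/-- For `f` invariant under scaling by nonzero constants with `f 0 = 0`, the sum over monic
polynomials of degree `< d` is the opposite of the sum over all polynomials of degree `< d`. -/
theorem sum_monics_lt_eq_neg_sum (f : F[X] → L) (hf0 : f 0 = 0)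
    (hf : ∀ (x : F) (a : F[X]), x ≠ 0 → f (Polynomial.C x * a) = f a) (d : ℕ) :
    ∑ i ∈ Finset.range d, ∑ a ∈ monics F i, f a = -∑ c : Fin d → F, f (coeffPoly c) := by
  classical
  induction d with
  | zero => simp [coeffPoly_apply, hf0]
  | succ d ih =>
    rw [Finset.sum_range_succ, ih, sum_monics_eq,
      ← (Fin.snocEquiv fun _ => F).sum_comp fun c => f (coeffPoly c)]
    rw [Fintype.sum_prod_type]
    have hsn : ∀ x : F × (Fin d → F), (Fin.snocEquiv fun _ => F) x = Fin.snoc x.2 x.1 :=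
      fun x => rfl
    simp only [hsn, coeffPoly_snoc]
    -- Split by the coefficient of X^d: the value 0 gives the polynomials of degree < d, and each of
    -- the q - 1 = -1 nonzero values gives the monic sum of degree d by scaling.
    rw [← Finset.add_sum_erase _ _ (Finset.mem_univ (0 : F))]
    have h1 : ∀ x ∈ Finset.univ.erase (0 : F),
        ∑ c : Fin d → F, f (Polynomial.C x * Polynomial.X ^ d + coeffPoly c) =
          ∑ c : Fin d → F, f (Polynomial.X ^ d + coeffPoly c) := by
      intro x hx
      have hx : x ≠ 0 := Finset.ne_of_mem_erase hx
      rw [← Equiv.sum_comp (MulAction.toPerm (Units.mk0 x hx) : Equiv.Perm (Fin d → F))]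
      refine Finset.sum_congr rfl fun c _ => ?_
      rw [← hf x (_ + coeffPoly c) hx, mul_add, MulAction.toPerm_apply]
      congr 2
      rw [Units.smul_mk0, map_smul, Polynomial.smul_eq_C_mul]
    rw [Finset.sum_congr rfl h1, Finset.sum_const, Finset.card_erase_of_mem (Finset.mem_univ _),
      Finset.card_univ, nsmul_eq_mul, Nat.cast_sub Fintype.card_pos]
    have : ((Fintype.card F : ℕ) : L) = 0 := by
      rw [← map_natCast (algebraMap F L), FiniteField.cast_card_eq_zero, map_zero]
    rw [this]
    simp [add_comm]

/-! ### Carlitz polynomials -/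

variable (F) in
/-- The normalised Carlitz polynomials `E_j`, as `F`-linear functions:
`E_0(z) = z` and `E_{j+1}(z) = (E_j(z)^q - E_j(z)) / (θ^{q^{j+1}} - θ)`. -/
noncomputable def carlitzE (θ : L) : ℕ → L →ₗ[F] L
  | 0 => LinearMap.id
  | j + 1 => (θ ^ Fintype.card F ^ (j + 1) - θ)⁻¹ •
      ((FiniteField.frobeniusAlgHom F L).toLinearMap ∘ₗ carlitzE θ j - carlitzE θ j)

@[simp]
theorem carlitzE_zero (θ z : L) : carlitzE F θ 0 z = z := rfl

theorem carlitzE_succ (θ z : L) (j : ℕ) :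
    carlitzE F θ (j + 1) z = (carlitzE F θ j z ^ Fintype.card F - carlitzE F θ j z) /
      (θ ^ Fintype.card F ^ (j + 1) - θ) := by
  rw [div_eq_inv_mul]; rfl

theorem add_pow_card {R : Type*} [CommRing R] [Algebra F R] (x y : R) :
    (x + y) ^ Fintype.card F = x ^ Fintype.card F + y ^ Fintype.card F :=
  map_add (FiniteField.frobeniusAlgHom F R) x y

variable {θ : L}

/-- Dual to the relation t b_j(t) = b_{j+1}(t) + θ^{q^j} b_j(t); the vanishing of E_j in low degree
and the Newton expansion both come from it. -/
theorem carlitzE_mul_theta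
    (hθ : ∀ j, θ ^ Fintype.card F ^ (j + 1) - θ ≠ 0) (j : ℕ) (z : L) :
    carlitzE F θ (j + 1) (θ * z) =
      θ ^ Fintype.card F ^ (j + 1) * carlitzE F θ (j + 1) z + carlitzE F θ j z := by
  induction j with
  | zero =>
    rw [carlitzE_succ, carlitzE_succ]
    have := hθ 0
    simp only [carlitzE_zero]
    field_simp
    simp only [zero_add, pow_one]
    ring
  | succ j ih =>
    rw [carlitzE_succ, ih, carlitzE_succ θ z (j + 1)]
    have h1 := hθ (j + 1)
    have h0 := hθ j
    rw [div_eq_iff h1, add_mul, mul_assoc, div_mul_cancel₀ _ h1, add_pow_card, mul_pow, ← pow_mul,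
      ← pow_succ]
    have h2 : carlitzE F θ (j + 1) z * (θ ^ Fintype.card F ^ (j + 1) - θ) =
      carlitzE F θ j z ^ Fintype.card F - carlitzE F θ j z := by
      rw [carlitzE_succ, div_mul_cancel₀ _ h0]
    linear_combination -h2

theorem carlitzE_theta_pow_eq_zero
    (hθ : ∀ j, θ ^ Fintype.card F ^ (j + 1) - θ ≠ 0) {n j : ℕ} (h : n < j) : carlitzE F θ j (θ ^ n) = 0 := by
  induction n generalizing j with
  | zero =>
    obtain ⟨j, rfl⟩ : ∃ k, j = k + 1 := ⟨j - 1, by omega⟩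
    clear h
    induction j with
    | zero => simp [carlitzE_succ]
    | succ j ih => rw [carlitzE_succ, ih, zero_pow Fintype.card_ne_zero]; simp
  | succ n ih =>
    obtain ⟨j, rfl⟩ : ∃ k, j = k + 1 := ⟨j - 1, by omega⟩
    rw [pow_succ', carlitzE_mul_theta hθ, ih (by omega), ih (by omega)]
    simp

theorem carlitzE_aeval_eq_zero
    (hθ : ∀ j, θ ^ Fintype.card F ^ (j + 1) - θ ≠ 0) {d j : ℕ} (h : d ≤ j) (c : Fin d → F) :
    carlitzE F θ j (Polynomial.aeval θ (coeffPoly c)) = 0 := by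
  rw [aeval_coeffPoly, map_sum]
  refine Finset.sum_eq_zero fun i _ => ?_
  rw [map_smul, carlitzE_theta_pow_eq_zero hθ (by omega), smul_zero]

/-- Newton interpolation at the nodes θ^{q^i}. In the induction, multiplication by t on the b_j
matches multiplication by θ inside the E_j. -/
theorem pow_eq_sum_carlitzE
    (hθ : ∀ j, θ ^ Fintype.card F ^ (j + 1) - θ ≠ 0) (t : L) {n d : ℕ} (h : n < d) :
    t ^ n = ∑ j ∈ Finset.range d, carlitzE F θ j (θ ^ n) *
      ∏ i ∈ Finset.range j, (t - θ ^ Fintype.card F ^ i) := by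
  induction n generalizing d with
  | zero =>
    obtain ⟨d, rfl⟩ : ∃ k, d = k + 1 := ⟨d - 1, by omega⟩
    rw [Finset.sum_range_succ']
    rw [Finset.sum_eq_zero fun j _ => by rw [carlitzE_theta_pow_eq_zero hθ (by omega), zero_mul]]
    simp
  | succ n ih =>
    obtain ⟨d, rfl⟩ : ∃ k, d = k + 1 := ⟨d - 1, by omega⟩
    rw [pow_succ', ih (d := d) (by omega), Finset.sum_range_succ', Finset.mul_sum]
    simp only [pow_succ' θ n, carlitzE_mul_theta hθ, add_mul, Finset.sum_add_distrib]
    -- The shift of index is harmless because the top term j = d vanishes for n < d.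
    have h1 : ∑ j ∈ Finset.range d, θ ^ Fintype.card F ^ (j + 1) *
        carlitzE F θ (j + 1) (θ ^ n) * ∏ i ∈ Finset.range (j + 1), (t - θ ^ Fintype.card F ^ i) +
        θ * θ ^ n = ∑ j ∈ Finset.range d, θ ^ Fintype.card F ^ j *
        carlitzE F θ j (θ ^ n) * ∏ i ∈ Finset.range j, (t - θ ^ Fintype.card F ^ i) := by
      have := Finset.sum_range_succ' (fun j => θ ^ Fintype.card F ^ j *
        carlitzE F θ j (θ ^ n) * ∏ i ∈ Finset.range j, (t - θ ^ Fintype.card F ^ i)) d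
      rw [Finset.sum_range_succ, carlitzE_theta_pow_eq_zero hθ (by omega : n < d)] at this
      simpa using this.symm
    simp only [carlitzE_zero, Finset.range_zero, Finset.prod_empty, mul_one]
    rw [add_right_comm, h1, ← Finset.sum_add_distrib]
    refine Finset.sum_congr rfl fun j _ => ?_
    rw [Finset.prod_range_succ]
    ring

theorem aeval_coeffPoly_eq_sum_carlitzE
    (hθ : ∀ j, θ ^ Fintype.card F ^ (j + 1) - θ ≠ 0) (t : L) {d : ℕ} (c : Fin d → F) :
    Polynomial.aeval t (coeffPoly c) =
      ∑ j ∈ Finset.range d, carlitzE F θ j (Polynomial.aeval θ (coeffPoly c)) *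
        ∏ i ∈ Finset.range j, (t - θ ^ Fintype.card F ^ i) := by
  simp only [aeval_coeffPoly, map_sum, map_smul, Finset.sum_mul]
  rw [Finset.sum_comm]
  refine Finset.sum_congr rfl fun i _ => ?_
  rw [pow_eq_sum_carlitzE hθ t i.2, Finset.smul_sum]
  simp

end Algebra

end CarlitzTate

namespace CarlitzTate

section Interpolation

/-! ### The interpolating polynomial -/

section Defs

variable {B : Type*} [CommRing B] (q : ℕ) (θ Y t : B)

/-- `Δ_0 = 1` and `Δ_{k+1} = (Y^{q^{k+1}} - θ) Δ_k^q`. -/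
def deltaVal : ℕ → B
  | 0 => 1
  | k + 1 => (Y ^ q ^ (k + 1) - θ) * deltaVal k ^ q

/-- `M_0 = w` and `M_{k+1} = M_k^q - Δ_k^{q-1} M_k`. For `Y = θ^{q^n}` one has
`M_k(E_n(z)) = Δ_k E_{n+k}(z)`. -/
noncomputable def annPoly : ℕ → B[X]
  | 0 => Polynomial.X
  | k + 1 => annPoly k ^ q - Polynomial.C (deltaVal q θ Y k ^ (q - 1)) * annPoly k

/-- `b_k(t) = ∏_{l < k} (t - Y^{q^l})`. -/
def newtonVal (k : ℕ) : B := ∏ l ∈ Finset.range k, (t - Y ^ q ^ l)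

/-- The polynomial `∑_{k < m} b_k(t) (∏_{l ≠ k} Δ_l) M_k(w)`. -/
noncomputable def newtonPoly (m : ℕ) : B[X] :=
  ∑ k ∈ Finset.range m, Polynomial.C (newtonVal q Y t k *
    ∏ l ∈ (Finset.range m).erase k, deltaVal q θ Y l) * annPoly q θ Y k

/-- The coefficient of `w` in `∏ i, newtonPoly (t i)` modulo `M_m`. -/
noncomputable def linearCoeff {s : ℕ} (t : Fin s → B) (m : ℕ) : B :=
  ((∏ i, newtonPoly q θ Y (t i) m) %ₘ annPoly q θ Y m).coeff 1

variable {q θ Y t} {B' : Type*} [CommRing B'] (φ : B →+* B')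

/-- Compatibility with ring maps lets the same expression be read with Y an indeterminate over
A[t_1, …, t_s] and at Y = θ^{q^n}; this is what makes one polynomial serve all n. -/
theorem map_deltaVal (k : ℕ) : φ (deltaVal q θ Y k) = deltaVal q (φ θ) (φ Y) k := by
  induction k with
  | zero => simp [deltaVal]
  | succ k ih => simp [deltaVal, ih]

theorem map_annPoly (k : ℕ) : (annPoly q θ Y k).map φ = annPoly q (φ θ) (φ Y) k := by
  induction k with
  | zero => simp [annPoly]
  | succ k ih =>
    rw [annPoly, annPoly, Polynomial.map_sub, Polynomial.map_mul, Polynomial.map_pow,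
      Polynomial.map_C, map_pow, map_deltaVal φ, ih]

theorem map_newtonVal (k : ℕ) : φ (newtonVal q Y t k) = newtonVal q (φ Y) (φ t) k := by
  simp [newtonVal]

theorem map_newtonPoly (m : ℕ) :
    (newtonPoly q θ Y t m).map φ = newtonPoly q (φ θ) (φ Y) (φ t) m := by
  rw [newtonPoly, Polynomial.map_sum]
  refine Finset.sum_congr rfl fun k _ => ?_
  rw [Polynomial.map_mul, Polynomial.map_C, map_annPoly, map_mul, map_newtonVal φ, map_prod]
  simp only [map_deltaVal φ]

theorem monic_annPoly [Nontrivial B] (hq : 1 < q) (k : ℕ) :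
    (annPoly q θ Y k).Monic ∧ (annPoly q θ Y k).natDegree = q ^ k := by
  induction k with
  | zero => simp [annPoly, Polynomial.monic_X]
  | succ k ih =>
    obtain ⟨h1, h2⟩ := ih
    have h3 : (annPoly q θ Y k ^ q).natDegree = q ^ (k + 1) := by
      rw [h1.natDegree_pow, h2, pow_succ']
    have hlt : (Polynomial.C (deltaVal q θ Y k ^ (q - 1)) * annPoly q θ Y k).degree <
        (annPoly q θ Y k ^ q).degree := by
      rw [Polynomial.degree_eq_natDegree (h1.pow q).ne_zero, h3]
      refine ((Polynomial.degree_mul_le _ _).trans (add_le_add_left Polynomial.degree_C_le _)).trans_lt ?_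
      rw [zero_add, Polynomial.degree_eq_natDegree h1.ne_zero, h2]
      exact_mod_cast Nat.pow_lt_pow_right hq (Nat.lt_succ_self k)
    refine ⟨(h1.pow q).sub_of_left hlt, ?_⟩
    rw [annPoly, Polynomial.natDegree_eq_of_degree_eq (Polynomial.degree_sub_eq_left_of_degree_lt hlt),
      h3]

/-- Division by a monic polynomial commutes with base change. -/
theorem map_linearCoeff [Nontrivial B] (hq : 1 < q) {s : ℕ} (t : Fin s → B) (m : ℕ) :
    φ (linearCoeff q θ Y t m) = linearCoeff q (φ θ) (φ Y) (fun i => φ (t i)) m := by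
  rw [linearCoeff, ← Polynomial.coeff_map, Polynomial.map_modByMonic _ (monic_annPoly hq m).1,
    Polynomial.map_prod, map_annPoly]
  simp only [map_newtonPoly, linearCoeff]

theorem map_prod_mul_linearCoeff [Nontrivial B] (hq : 1 < q) {s : ℕ} (t : Fin s → B) (m : ℕ) :
    φ ((∏ j ∈ Finset.range (m - 1), (θ - Y ^ q ^ (j + 1))) * linearCoeff q θ Y t m) =
      (∏ j ∈ Finset.range (m - 1), (φ θ - φ Y ^ q ^ (j + 1))) *
        linearCoeff q (φ θ) (φ Y) (fun i => φ (t i)) m := by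
  simp [map_linearCoeff φ hq]

end Defs

variable {F L : Type*} [Field F] [Field L] [Algebra F L] [Fintype F] {θ : L}

variable (F) in
/-- `E_j(z) / z`, as a polynomial in `z`. -/
noncomputable def carlitzQuot (θ : L) : ℕ → L → L
  | 0, _ => 1
  | j + 1, z => (carlitzE F θ j z ^ (Fintype.card F - 1) - 1) * carlitzQuot θ j z /
      (θ ^ Fintype.card F ^ (j + 1) - θ)

theorem carlitzE_eq_mul_carlitzQuot (j : ℕ) (z : L) :
    carlitzE F θ j z = z * carlitzQuot F θ j z := by
  induction j with
  | zero => simp [carlitzQuot]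
  | succ j ih =>
    rw [carlitzE_succ, carlitzQuot, ← mul_div_assoc, mul_left_comm, ← ih, sub_mul, one_mul,
      pow_sub_one_mul Fintype.card_ne_zero]

/-- At z = 0 each factor of the recursion is -1/(θ^{q^{i+1}} - θ). This is the source of the
denominator l_n. -/
theorem carlitzQuot_zero_right (hθ : ∀ j, θ ^ Fintype.card F ^ (j + 1) - θ ≠ 0) (j : ℕ) :
    carlitzQuot F θ j 0 * ∏ i ∈ Finset.range j, (θ - θ ^ Fintype.card F ^ (i + 1)) = 1 := by
  have hq : Fintype.card F - 1 ≠ 0 := Nat.sub_ne_zero_of_lt Fintype.one_lt_card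
  induction j with
  | zero => simp [carlitzQuot]
  | succ j ih =>
    rw [carlitzQuot, Finset.prod_range_succ, map_zero, zero_pow hq, ← neg_sub (θ ^ _) θ]
    have := hθ j
    field_simp
    linear_combination ih

variable {d : ℕ}

theorem hasDeg_carlitzQuot (A : (Fin d → F) →ₗ[F] L) (j : ℕ) :
    HasDeg (j * (Fintype.card F - 1)) fun c => carlitzQuot F θ j (A c) := by
  induction j with
  | zero => simpa [carlitzQuot] using HasDeg.const 0 1
  | succ j ih =>
    have h1 : HasDeg (Fintype.card F - 1)
        fun c => carlitzE F θ j (A c) ^ (Fintype.card F - 1) - 1 := by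
      simpa using ((HasDeg.linear (carlitzE F θ j ∘ₗ A)).pow (Fintype.card F - 1)).sub
        (HasDeg.const _ 1)
    refine ((h1.mul ih).const_mul (θ ^ Fintype.card F ^ (j + 1) - θ)⁻¹).mono
      (by rw [Nat.succ_mul, add_comm]) |>.congr fun c => ?_
    rw [carlitzQuot, div_eq_inv_mul]

/-- The sum of `g / A` over the nonzero vectors, for `g = A h`. -/
theorem sum_div_eq_of_eq_mul {A : (Fin d → F) →ₗ[F] L} (hA : Function.Injective A)
    {g h : (Fin d → F) → L} (hg : ∀ c, g c = A c * h c) :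
    ∑ c, g c / A c = ∑ c, h c - h 0 := by
  classical
  -- The term c = 0 on the left is 0/0, which is 0 by convention; on the right it is exactly the `h
  -- 0` that is subtracted.
  rw [← Finset.add_sum_erase _ _ (Finset.mem_univ 0), ← Finset.add_sum_erase _ h (Finset.mem_univ 0),
    map_zero, div_zero, zero_add, add_sub_cancel_left]
  refine Finset.sum_congr rfl fun c hc => ?_
  have : A c ≠ 0 := by
    rw [Ne, map_eq_zero_iff A hA]; exact Finset.ne_of_mem_erase hc
  rw [hg, mul_div_cancel_left₀ _ this]


/-- Dividing the factor `i₀` by A leaves degree at most (n-1)(q-1), and the other m(q-1) linear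
forms bring the total below (n+m)(q-1). The correction at c = 0 vanishes because at least one linear
form remains. -/
theorem sum_prod_div_eq_zero {n m s : ℕ} (hm : 1 ≤ m) (hs : s = m * (Fintype.card F - 1) + 1)
    {A : (Fin (n + m) → F) →ₗ[F] L} (hA : Function.Injective A)
    (f : Fin s → (Fin (n + m) → F) →ₗ[F] L) (i₀ : Fin s) (β : ℕ → L)
    (hf : ∀ c, f i₀ c = ∑ j ∈ Finset.range n, carlitzE F θ j (A c) * β j) :
    ∑ c, (∏ i, f i c) / A c = 0 := by
  classical
  have hq : 1 < Fintype.card F := Fintype.one_lt_card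
  have hmq : 0 < m * (Fintype.card F - 1) := Nat.mul_pos hm (by omega)
  have hcard : (Finset.univ.erase i₀).card = m * (Fintype.card F - 1) := by
    rw [Finset.card_erase_of_mem (Finset.mem_univ _), Finset.card_fin, hs]; rfl
  let h : (Fin (n + m) → F) → L := fun c =>
    (∑ j ∈ Finset.range n, carlitzQuot F θ j (A c) * β j) * ∏ i ∈ Finset.univ.erase i₀, f i c
  have hg : ∀ c, ∏ i, f i c = A c * h c := fun c => by
    rw [← Finset.mul_prod_erase _ _ (Finset.mem_univ i₀), hf]
    simp only [h, carlitzE_eq_mul_carlitzQuot, Finset.mul_sum, Finset.sum_mul, mul_assoc]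
  rw [sum_div_eq_of_eq_mul hA hg]
  have h0 : h 0 = 0 := by
    simp only [h, map_zero, Finset.prod_const, hcard, zero_pow hmq.ne', mul_zero]
  rw [h0, sub_zero]
  rcases Nat.eq_zero_or_pos n with rfl | hn
  · simp [h]
  have h1 : HasDeg ((n - 1) * (Fintype.card F - 1))
      fun c => ∑ j ∈ Finset.range n, carlitzQuot F θ j (A c) * β j := by
    refine HasDeg.sum _ fun j hj => ?_
    have := Finset.mem_range.1 hj
    exact (((hasDeg_carlitzQuot A j).const_mul (β j)).congr fun c => mul_comm _ _).mono
      (Nat.mul_le_mul_right _ (by omega))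
  have h2 := h1.mul (HasDeg.prod (Finset.univ.erase i₀) fun i _ => HasDeg.linear (f i))
  refine HasDeg.sum_eq_zero h2 ?_
  rw [hcard, mul_one, ← add_mul]
  exact Nat.mul_lt_mul_of_pos_right (by omega) (by omega)

/-- The factors are exchanged one at a time. Each exchange is linear in its slot, and the previous
lemma kills the difference whatever linear forms occupy the other slots. -/
theorem sum_prod_div_congr {n m s : ℕ} (hm : 1 ≤ m) (hs : s = m * (Fintype.card F - 1) + 1)
    {A : (Fin (n + m) → F) →ₗ[F] L} (hA : Function.Injective A)
    (f g : Fin s → (Fin (n + m) → F) →ₗ[F] L) (β : Fin s → ℕ → L)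
    (hfg : ∀ i c, f i c - g i c = ∑ j ∈ Finset.range n, carlitzE F θ j (A c) * β i j) :
    ∑ c, (∏ i, f i c) / A c = ∑ c, (∏ i, g i c) / A c := by
  classical
  suffices H : ∀ T : Finset (Fin s), ∑ c, (∏ i, f i c) / A c =
      ∑ c, (∏ i, (if i ∈ T then g i else f i) c) / A c by simpa using H Finset.univ
  intro T
  induction T using Finset.induction_on with
  | empty => simp
  | insert i₀ T hi₀ ih =>
    rw [ih, ← sub_eq_zero, ← Finset.sum_sub_distrib]
    rw [← sum_prod_div_eq_zero (θ := θ) hm hs hA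
      (Function.update (fun i => if i ∈ T then g i else f i) i₀ (f i₀ - g i₀)) i₀ (β i₀)
      (fun c => by simp [hfg])]
    refine Finset.sum_congr rfl fun c _ => ?_
    rw [← sub_div]
    congr 1
    rw [← Finset.mul_prod_erase _ _ (Finset.mem_univ i₀),
      ← Finset.mul_prod_erase _ (fun i => (if i ∈ insert i₀ T then g i else f i) c)
        (Finset.mem_univ i₀),
      ← Finset.mul_prod_erase _ (fun i => Function.update (fun i => if i ∈ T then g i else f i) i₀
        (f i₀ - g i₀) i c) (Finset.mem_univ i₀)]
    have h1 : ∏ i ∈ Finset.univ.erase i₀, (if i ∈ insert i₀ T then g i else f i) c =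
        ∏ i ∈ Finset.univ.erase i₀, (if i ∈ T then g i else f i) c :=
      Finset.prod_congr rfl fun i hi => by
        simp [Finset.mem_insert, Finset.ne_of_mem_erase hi]
    have h2 : ∏ i ∈ Finset.univ.erase i₀, Function.update (fun i => if i ∈ T then g i else f i)
        i₀ (f i₀ - g i₀) i c = ∏ i ∈ Finset.univ.erase i₀, (if i ∈ T then g i else f i) c :=
      Finset.prod_congr rfl fun i hi => by
        rw [Function.update_of_ne (Finset.ne_of_mem_erase hi)]
    rw [h1, h2]
    simp [hi₀, sub_mul]

/-- At Y = θ^{q^n} the factor Y^{q^{k+1}} - θ is the denominator in the recursion from E_{n+k} to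
E_{n+k+1}, so the M_k follow the same recursion with denominators cleared. -/
theorem eval_annPoly (hθ : ∀ j, θ ^ Fintype.card F ^ (j + 1) - θ ≠ 0) (n k : ℕ) (z : L) :
    (annPoly (Fintype.card F) θ (θ ^ Fintype.card F ^ n) k).eval (carlitzE F θ n z) =
      deltaVal (Fintype.card F) θ (θ ^ Fintype.card F ^ n) k * carlitzE F θ (n + k) z := by
  induction k with
  | zero => simp [annPoly, deltaVal]
  | succ k ih =>
    rw [annPoly, Polynomial.eval_sub, Polynomial.eval_pow, Polynomial.eval_mul, Polynomial.eval_C,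
      ih, deltaVal, ← add_assoc, carlitzE_succ, ← pow_mul, ← pow_add, ← add_assoc]
    have := hθ (n + k)
    rw [mul_right_comm, mul_div_cancel₀ _ this, ← mul_assoc (_ ^ (_ - 1)),
      pow_sub_one_mul Fintype.card_ne_zero]
    ring

/-- For w = E_n(a), write w^j/a = (E_n(a)/a) w^{j-1}. Since j - 1 < q^m - 1, its degree is at most
n(q-1) + m(q-1) - 1, so the full sum vanishes and only minus the value at a = 0 is left. That value
is nonzero only for j = 1. -/
theorem sum_eval_div {n m : ℕ} (hm : 1 ≤ m) (hθ : ∀ j, θ ^ Fintype.card F ^ (j + 1) - θ ≠ 0)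
    {A : (Fin (n + m) → F) →ₗ[F] L} (hA : Function.Injective A)
    (P : L[X]) (hP : P.degree < (Fintype.card F ^ m : ℕ)) (hP0 : P.coeff 0 = 0) :
    (∑ c, P.eval (carlitzE F θ n (A c)) / A c) *
      ∏ i ∈ Finset.range n, (θ - θ ^ Fintype.card F ^ (i + 1)) = -P.coeff 1 := by
  have hq : 1 < Fintype.card F := Fintype.one_lt_card
  have hmq : 0 < m * (Fintype.card F - 1) := Nat.mul_pos hm (by omega)
  have hqm : 1 < Fintype.card F ^ m := Nat.one_lt_pow (by omega) hq
  have key : ∀ j ∈ Finset.range (Fintype.card F ^ m),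
      ∑ c, P.coeff j * carlitzE F θ n (A c) ^ j / A c =
        if j = 1 then -P.coeff 1 * carlitzQuot F θ n 0 else 0 := by
    intro j hj
    rw [Finset.mem_range] at hj
    rcases Nat.eq_zero_or_pos j with rfl | hj0
    · simp [hP0]
    have hg : ∀ c, P.coeff j * carlitzE F θ n (A c) ^ j = A c *
        (P.coeff j * (carlitzQuot F θ n (A c) * carlitzE F θ n (A c) ^ (j - 1))) := fun c => by
      rw [← pow_sub_one_mul hj0.ne' (carlitzE F θ n (A c)), carlitzE_eq_mul_carlitzQuot]
      ring
    rw [sum_div_eq_of_eq_mul hA hg]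
    have h1 := ((hasDeg_carlitzQuot (θ := θ) A n).mul
      ((hasDeg_pow_of_linear m (j - 1) (carlitzE F θ n ∘ₗ A) (by omega)).2 (by omega))).const_mul
        (P.coeff j)
    have h2 := h1.sum_eq_zero (by rw [add_mul]; omega)
    simp only [LinearMap.comp_apply] at h2
    rw [h2, zero_sub, map_zero, map_zero]
    split_ifs with h
    · subst h; simp
    · rw [zero_pow (by omega)]; simp
  have hP' : ∀ x, P.eval x = ∑ j ∈ Finset.range (Fintype.card F ^ m), P.coeff j * x ^ j :=
    fun x => Polynomial.eval_eq_sum_range' (by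
      rcases eq_or_ne P 0 with rfl | h
      · simp; positivity
      · exact (Polynomial.natDegree_lt_iff_degree_lt h).2 hP) x
  simp only [hP', Finset.sum_div]
  rw [Finset.sum_comm, Finset.sum_congr rfl key, Finset.sum_ite_eq' , if_pos (by simpa using hqm),
    mul_assoc, carlitzQuot_zero_right hθ, mul_one]

/-- The twisted harmonic sum over the polynomials of degree `< n + m`, in terms of the
interpolating polynomial at `Y = θ^{q^n}`. -/
theorem harmonic_eq_linearCoeff {n m s : ℕ} (hm : 1 ≤ m)
    (hs : s = m * (Fintype.card F - 1) + 1)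
    (hθ : Function.Injective (Polynomial.aeval θ : F[X] →ₐ[F] L)) (t : Fin s → L) :
    (∏ l ∈ Finset.range m, deltaVal (Fintype.card F) θ (θ ^ Fintype.card F ^ n) l) ^ s *
      (-∑ c : Fin (n + m) → F, (∏ i, Polynomial.aeval (t i) (coeffPoly c)) /
        Polynomial.aeval θ (coeffPoly c)) *
      ∏ i ∈ Finset.range n, (θ - θ ^ Fintype.card F ^ (i + 1)) =
    (∏ i, ∏ j ∈ Finset.range n, (t i - θ ^ Fintype.card F ^ j)) *
      linearCoeff (Fintype.card F) θ (θ ^ Fintype.card F ^ n) t m := by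
  classical
  have hq : 1 < Fintype.card F := Fintype.one_lt_card
  have hs0 : s ≠ 0 := by omega
  have hθ' : ∀ j, θ ^ Fintype.card F ^ (j + 1) - θ ≠ 0 := fun j h => by
    have : Polynomial.aeval θ (Polynomial.X ^ Fintype.card F ^ (j + 1) - Polynomial.X : F[X]) = 0 := by
      simpa using h
    rw [map_eq_zero_iff _ hθ] at this
    exact FiniteField.X_pow_card_pow_sub_X_ne_zero F (Nat.succ_ne_zero j) hq this
  let A : (Fin (n + m) → F) →ₗ[F] L := (Polynomial.aeval θ).toLinearMap ∘ₗ coeffPoly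
  have hA : Function.Injective A := hθ.comp coeffPoly_injective
  let E : ℕ → (Fin (n + m) → F) →ₗ[F] L := fun j => carlitzE F θ j ∘ₗ A
  set Y := θ ^ Fintype.card F ^ n with hY
  set Δ := ∏ l ∈ Finset.range m, deltaVal (Fintype.card F) θ Y l with hΔ
  let f : Fin s → (Fin (n + m) → F) →ₗ[F] L := fun i =>
    (Polynomial.aeval (t i)).toLinearMap ∘ₗ coeffPoly
  let b : Fin s → ℕ → L := fun i j => ∏ l ∈ Finset.range j, (t i - θ ^ Fintype.card F ^ l)
  -- The tail n ≤ j < n + m of the Newton expansion of a(t_i), all of whose terms are divisible by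
  -- b_n(t_i).
  let g : Fin s → (Fin (n + m) → F) →ₗ[F] L := fun i =>
    ∑ k ∈ Finset.range m, b i (n + k) • E (n + k)
  have hfg : ∀ i c, f i c - g i c = ∑ j ∈ Finset.range n, carlitzE F θ j (A c) * b i j := by
    intro i c
    have h1 : f i c = ∑ j ∈ Finset.range (n + m), carlitzE F θ j (A c) * b i j :=
      aeval_coeffPoly_eq_sum_carlitzE hθ' (t i) c
    rw [h1, Finset.sum_range_add]
    simp [g, E, mul_comm]
  have h1 := sum_prod_div_congr hm hs hA f g b hfg
  have hg : ∀ i c, Δ * g i c = b i n *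
      (newtonPoly (Fintype.card F) θ Y (t i) m).eval (carlitzE F θ n (A c)) := by
    intro i c
    simp only [g, newtonPoly, LinearMap.sum_apply, Polynomial.eval_finsetSum, Finset.mul_sum]
    refine Finset.sum_congr rfl fun k hk => ?_
    rw [Polynomial.eval_mul, Polynomial.eval_C, eval_annPoly hθ', hΔ,
      ← Finset.mul_prod_erase _ _ hk]
    have : b i (n + k) = b i n * newtonVal (Fintype.card F) Y (t i) k := by
      simp only [b, newtonVal, Finset.prod_range_add, hY, ← pow_mul, ← pow_add]
    simp only [LinearMap.smul_apply, smul_eq_mul, this, E, LinearMap.comp_apply]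
    ring
  set N := ∏ i, newtonPoly (Fintype.card F) θ Y (t i) m with hN
  obtain ⟨hmonic, hdeg⟩ := monic_annPoly (θ := θ) (Y := Y) hq m
  have hEz : ∀ k, (annPoly (Fintype.card F) θ Y k).eval 0 = 0 := fun k => by
    have := eval_annPoly hθ' n k 0
    simpa using this
  -- E_{n+m} kills all polynomials of degree < n + m, so M_m vanishes at w = E_n(a) and reduction
  -- modulo M_m preserves these values.
  have hNeval : ∀ c, N.eval (carlitzE F θ n (A c)) =
      (N %ₘ annPoly (Fintype.card F) θ Y m).eval (carlitzE F θ n (A c)) := fun c => by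
    conv_lhs => rw [← Polynomial.modByMonic_add_div N (annPoly (Fintype.card F) θ Y m)]
    rw [Polynomial.eval_add, Polynomial.eval_mul, eval_annPoly hθ',
      show carlitzE F θ (n + m) (A c) = 0 from carlitzE_aeval_eq_zero hθ' le_rfl c]
    ring
  have hN0 : (N %ₘ annPoly (Fintype.card F) θ Y m).coeff 0 = 0 := by
    have h2 := hNeval 0
    rw [map_zero, map_zero] at h2
    rw [Polynomial.coeff_zero_eq_eval_zero, ← h2, hN, Polynomial.eval_prod]
    refine Finset.prod_eq_zero (Finset.mem_univ ⟨0, Nat.pos_of_ne_zero hs0⟩) ?_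
    simp [newtonPoly, Polynomial.eval_finsetSum, hEz]
  have h3 := sum_eval_div hm hθ' hA (N %ₘ annPoly (Fintype.card F) θ Y m)
    (by
      have := Polynomial.degree_modByMonic_lt N hmonic
      rwa [Polynomial.degree_eq_natDegree hmonic.ne_zero, hdeg] at this) hN0
  have h4 : Δ ^ s * ∑ c, (∏ i, g i c) / A c = (∏ i, b i n) *
      ∑ c, (N %ₘ annPoly (Fintype.card F) θ Y m).eval (carlitzE F θ n (A c)) / A c := by
    rw [Finset.mul_sum, Finset.mul_sum]
    refine Finset.sum_congr rfl fun c _ => ?_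
    rw [← mul_div_assoc, ← mul_div_assoc, ← hNeval, hN, Polynomial.eval_prod,
      ← Finset.prod_mul_distrib]
    congr 1
    have : Δ ^ s = ∏ _i : Fin s, Δ := by simp
    rw [this, ← Finset.prod_mul_distrib]
    exact Finset.prod_congr rfl fun i _ => hg i c
  change Δ ^ s * (-∑ c, (∏ i, f i c) / A c) * _ = (∏ i, b i n) * _
  rw [h1, mul_neg, h4, linearCoeff]
  linear_combination -(∏ i, b i n) * h3

end Interpolation

end CarlitzTate

namespace CarlitzTate

section Integrality

/-! ### Divisibility in `F[X]` and `F[X][t]` -/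

variable {F : Type*} [Field F] [Fintype F]

/-- `∏_{1 ≤ j ≤ N} (θ^{q^j} - θ)` is a multiple of every nonzero polynomial of degree `≤ N`. -/
theorem dvd_prod_X_pow_card_pow_sub_X (a : F[X]) (ha : a ≠ 0) (N : ℕ) (hN : a.natDegree ≤ N) :
    a ∣ ∏ j ∈ Finset.range N, (Polynomial.X ^ Fintype.card F ^ (j + 1) - Polynomial.X : F[X]) := by
  classical
  induction a using UniqueFactorizationMonoid.induction_on_coprime generalizing N with
  | h0 => exact absurd rfl ha
  | h1 hu => exact hu.dvd
  | hpr i hp =>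
    rename_i p
    have hpos : 0 < p.natDegree := hp.irreducible.natDegree_pos
    rw [Polynomial.natDegree_pow] at hN
    let f : ℕ → F[X] := fun j => Polynomial.X ^ Fintype.card F ^ (j + 1) - Polynomial.X
    have hinj : Function.Injective fun r => p.natDegree * (r + 1) - 1 := fun r r' h => by
      have h1 : p.natDegree ≤ p.natDegree * (r + 1) := Nat.le_mul_of_pos_right _ (by omega)
      have h2 : p.natDegree ≤ p.natDegree * (r' + 1) := Nat.le_mul_of_pos_right _ (by omega)
      have h3 : p.natDegree * (r + 1) = p.natDegree * (r' + 1) := by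
        simp only at h; omega
      simpa using Nat.eq_of_mul_eq_mul_left hpos h3
    -- An irreducible p divides X^{q^k} - X exactly when deg p ∣ k. The exponents deg p · 1, …, deg
    -- p · i are distinct and at most N, each giving one factor p; the -1 undoes the shift in `f`.
    have h1 : p ^ i ∣ ∏ r ∈ Finset.range i, f (p.natDegree * (r + 1) - 1) := by
      rw [← Finset.card_range i, ← Finset.prod_const, Finset.card_range]
      refine Finset.prod_dvd_prod_of_dvd _ _ fun r _ => ?_
      have h2 : p.natDegree * (r + 1) - 1 + 1 = p.natDegree * (r + 1) :=
        Nat.sub_add_cancel (Nat.mul_pos hpos (by omega))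
      simp only [f, h2]
      rw [← Nat.card_eq_fintype_card,
        ← hp.irreducible.natDegree_dvd_iff_dvd_X_pow_card_pow_sub_X]
      exact dvd_mul_right _ _
    refine h1.trans ?_
    rw [← Finset.prod_image (g := fun r => p.natDegree * (r + 1) - 1) (f := f) hinj.injOn]
    refine Finset.prod_dvd_prod_of_subset _ _ _ fun j hj => ?_
    obtain ⟨r, hr, rfl⟩ := Finset.mem_image.1 hj
    rw [Finset.mem_range] at hr ⊢
    have : p.natDegree * (r + 1) ≤ i * p.natDegree := by
      rw [mul_comm]; exact Nat.mul_le_mul_right _ (by omega)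
    have := Nat.mul_pos hpos (Nat.succ_pos r)
    simp only [Nat.succ_eq_add_one] at this
    omega
  | hcp hxy hx hy =>
    have hx0 := left_ne_zero_of_mul ha
    have hy0 := right_ne_zero_of_mul ha
    rw [Polynomial.natDegree_mul hx0 hy0] at hN
    exact hxy.isCoprime.mul_dvd (hx hx0 N (by omega)) (hy hy0 N (by omega))

/-- Comparing coefficients, f_μ ≡ c f_{μ+e_i} mod a. Iterating, f_μ ≡ c^k f_{μ+k e_i}, which is 0
once k exceeds the total degree. -/
theorem C_dvd_of_dvd_X_sub_C_mul {R σ : Type*} [CommRing R] (a c : R) (i : σ)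
    (f : MvPolynomial σ R)
    (h : MvPolynomial.C a ∣ (MvPolynomial.X i - MvPolynomial.C c) * f) : MvPolynomial.C a ∣ f := by
  classical
  rw [MvPolynomial.C_dvd_iff_dvd_coeff] at h ⊢
  have h1 : ∀ (k : ℕ) (μ : σ →₀ ℕ),
      a ∣ f.coeff μ - c ^ k * f.coeff (Finsupp.single i k + μ) := by
    intro k
    induction k with
    | zero => intro μ; simp
    | succ k ih =>
      intro μ
      have h2 := h (Finsupp.single i 1 + (Finsupp.single i k + μ))
      rw [sub_mul, MvPolynomial.coeff_sub, MvPolynomial.coeff_X_mul, MvPolynomial.coeff_C_mul,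
        ← add_assoc, ← Finsupp.single_add, add_comm 1 k] at h2
      have h3 := dvd_add (ih μ) (h2.mul_left (c ^ k))
      convert h3 using 1
      ring
  intro μ
  have h2 := h1 (f.totalDegree + 1) μ
  rwa [MvPolynomial.coeff_eq_zero_of_totalDegree_lt (d := _ + μ), mul_zero, sub_zero] at h2
  calc f.totalDegree < (Finsupp.single i (f.totalDegree + 1) + μ) i := by simp; omega
    _ ≤ _ := by
      refine Finset.single_le_sum (f := fun j => (Finsupp.single i (f.totalDegree + 1) + μ) j)
        (fun _ _ => Nat.zero_le _) ?_
      simp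

theorem C_dvd_of_dvd_prod_mul {R σ ι : Type*} [CommRing R] (a : R) (t : Finset ι) (i : ι → σ)
    (c : ι → R) (f : MvPolynomial σ R)
    (h : MvPolynomial.C a ∣ (∏ k ∈ t, (MvPolynomial.X (i k) - MvPolynomial.C (c k))) * f) :
    MvPolynomial.C a ∣ f := by
  classical
  induction t using Finset.induction_on with
  | empty => simpa using h
  | insert k t hk ih =>
    rw [Finset.prod_insert hk, mul_assoc] at h
    exact ih (C_dvd_of_dvd_X_sub_C_mul _ _ _ _ h)

variable {k : Type*} [Field k]

theorem natDegree_sum_mul_X_pow_le (δ D e : ℕ) (f : ℕ → k[X]) (hf : ∀ j < δ + 1, (f j).natDegree ≤ D) :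
    (∑ j ∈ Finset.range (δ + 1), f j * (Polynomial.X ^ e) ^ j).natDegree ≤ D + δ * e := by
  refine Polynomial.natDegree_sum_le_of_forall_le _ _ fun j hj => ?_
  have hj := Finset.mem_range.1 hj
  refine Polynomial.natDegree_mul_le.trans (add_le_add (hf j hj) ?_)
  rw [← pow_mul, Polynomial.natDegree_X_pow, mul_comm]
  exact Nat.mul_le_mul_right _ (by omega)

/-- Substituting X^e with e larger than every coefficient degree lets the monic top term dominate,
so nothing cancels it. -/
theorem natDegree_eval_X_pow_of_monic {Q : k[X][X]} (hQ : Q.Monic) {e : ℕ}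
    (he : ∀ j, (Q.coeff j).natDegree < e) :
    (Q.eval (Polynomial.X ^ e)).natDegree = Q.natDegree * e := by
  rw [Polynomial.eval_eq_sum_range, Finset.sum_range_succ, hQ.coeff_natDegree, one_mul, ← pow_mul]
  rcases Nat.eq_zero_or_pos Q.natDegree with h0 | h0
  · simp [h0]
  obtain ⟨δ, hδ⟩ : ∃ δ, Q.natDegree = δ + 1 := ⟨Q.natDegree - 1, by omega⟩
  rw [hδ]
  have he0 : 0 < e := (Nat.zero_le _).trans_lt (he 0)
  have h1 := natDegree_sum_mul_X_pow_le δ (e - 1) e Q.coeff fun j _ => Nat.le_sub_one_of_lt (he j)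
  rw [Polynomial.natDegree_add_eq_right_of_natDegree_lt, Polynomial.natDegree_X_pow, mul_comm]
  rw [Polynomial.natDegree_X_pow]
  refine h1.trans_lt ?_
  rw [mul_add, mul_one, mul_comm e]
  omega

/-- A polynomial `P` over `k[X][t]` is divisible by a monic `Q` over `k[X]` as soon as its values
at `X ^ e` are divisible by those of `Q` for infinitely many `e`. -/
theorem map_C_dvd_of_forall_eval_dvd {σ : Type*} {Q : k[X][X]} (hQ : Q.Monic)
    (P : (MvPolynomial σ k[X])[X]) {S : Set ℕ} (hS : S.Infinite)
    (h : ∀ e ∈ S, MvPolynomial.C (Q.eval (Polynomial.X ^ e)) ∣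
      P.eval (MvPolynomial.C (Polynomial.X ^ e))) :
    Q.map MvPolynomial.C ∣ P := by
  classical
  set Q' : (MvPolynomial σ k[X])[X] := Q.map MvPolynomial.C with hQ'
  have hmQ' : Q'.Monic := hQ.map _
  have hQ'deg : Q'.natDegree = Q.natDegree := hQ.natDegree_map _
  rw [← Polynomial.modByMonic_eq_zero_iff_dvd hmQ']
  set R := P %ₘ Q' with hR
  have heval : ∀ e, Q'.eval (MvPolynomial.C (Polynomial.X ^ e)) =
      MvPolynomial.C (Q.eval (Polynomial.X ^ e)) := fun e => by
    rw [hQ', Polynomial.eval_map, Polynomial.eval₂_at_apply]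
  have hdvd : ∀ e ∈ S, MvPolynomial.C (Q.eval (Polynomial.X ^ e)) ∣
      R.eval (MvPolynomial.C (Polynomial.X ^ e)) := fun e he => by
    have h1 : R = P - Q' * (P /ₘ Q') := by
      rw [hR, Polynomial.modByMonic_eq_sub_mul_div]
    rw [h1, Polynomial.eval_sub, Polynomial.eval_mul, heval]
    exact dvd_sub (h e he) (dvd_mul_right _ _)
  by_contra hR0
  have hlt : R.natDegree < Q.natDegree := by
    rw [← hQ'deg]
    have h1 : R.degree < Q'.degree := Polynomial.degree_modByMonic_lt P hmQ'
    exact Polynomial.natDegree_lt_natDegree hR0 h1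
  obtain ⟨δ, hδ⟩ : ∃ δ, Q.natDegree = δ + 1 := ⟨Q.natDegree - 1, by omega⟩
  let D₁ := (Finset.range (δ + 1)).sup fun j =>
    (R.coeff j).support.sup fun μ => ((R.coeff j).coeff μ).natDegree
  let D₂ := Q.support.sup fun j => (Q.coeff j).natDegree
  have hD₁ : ∀ j < δ + 1, ∀ μ, ((R.coeff j).coeff μ).natDegree ≤ D₁ := fun j hj μ => by
    by_cases hμ : μ ∈ (R.coeff j).support
    · exact (Finset.le_sup (f := fun μ => ((R.coeff j).coeff μ).natDegree) hμ).trans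
        (Finset.le_sup (f := fun j => (R.coeff j).support.sup fun μ =>
          ((R.coeff j).coeff μ).natDegree) (Finset.mem_range.2 hj))
    · rw [MvPolynomial.notMem_support_iff.1 hμ]; simp
  have hD₂ : ∀ j, (Q.coeff j).natDegree ≤ D₂ := fun j => by
    by_cases hj : j ∈ Q.support
    · exact Finset.le_sup (f := fun j => (Q.coeff j).natDegree) hj
    · rw [Polynomial.notMem_support_iff.1 hj]; simp
  -- For large e, Q(X^e) has degree (δ+1)e, while each coefficient of R(X^e) has degree at most D₁ +
  -- δe. Divisibility then forces zero.
  have hzero : ∀ e ∈ S, max D₁ D₂ < e → R.eval (MvPolynomial.C (Polynomial.X ^ e)) = 0 := by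
    intro e he hmax
    ext1 μ
    rw [MvPolynomial.coeff_zero]
    have h1 := (MvPolynomial.C_dvd_iff_dvd_coeff _ _).1 (hdvd e he) μ
    refine Polynomial.eq_zero_of_dvd_of_natDegree_lt h1 ?_
    rw [natDegree_eval_X_pow_of_monic hQ fun j => (hD₂ j).trans_lt ((le_max_right _ _).trans_lt hmax),
      hδ]
    have h2 : (R.eval (MvPolynomial.C (Polynomial.X ^ e))).coeff μ =
        ∑ j ∈ Finset.range (δ + 1), (R.coeff j).coeff μ * (Polynomial.X ^ e) ^ j := by
      rw [Polynomial.eval_eq_sum_range' (n := δ + 1) (by omega), MvPolynomial.coeff_sum]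
      refine Finset.sum_congr rfl fun j _ => ?_
      rw [← map_pow, mul_comm, MvPolynomial.coeff_C_mul, mul_comm]
    rw [h2]
    refine (natDegree_sum_mul_X_pow_le δ D₁ e _ fun j hj => hD₁ j hj μ).trans_lt ?_
    have := (le_max_left D₁ D₂).trans_lt hmax
    rw [Nat.succ_mul]
    omega
  refine hR0 (Polynomial.eq_zero_of_infinite_isRoot R ?_)
  have hS' : (S \ Set.Iic (max D₁ D₂)).Infinite := hS.sdiff (Set.finite_Iic _)
  have hinj : Function.Injective fun e : ℕ => (MvPolynomial.C (Polynomial.X ^ e) :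
      MvPolynomial σ k[X]) := fun e e' h => by
    have := MvPolynomial.C_injective σ _ h
    simpa using congrArg Polynomial.natDegree this
  refine (hS'.image hinj.injOn).mono ?_
  rintro _ ⟨e, ⟨he, hlt⟩, rfl⟩
  exact hzero e he (not_le.1 hlt)

end Integrality

/-! ### The embedding of A[t_1, …, t_s] in K(t_1, …, t_s) and the denominators of the harmonic sums
-/

section HFraction

variable (F : Type*) [Field F] (s : ℕ)

/-- The inclusion `A[t_1, …, t_s] → K(t_1, …, t_s)`. -/
noncomputable def intToRatT : MvPolynomial (Fin s) F[X] →+* RatT F s :=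
  (algebraMap (MvPolynomial (Fin s) (RatFunc F)) (RatT F s)).comp (intToPoly F s)

theorem intToPoly_injective : Function.Injective (intToPoly F s) :=
  MvPolynomial.map_injective _ (RatFunc.algebraMap_injective F)

theorem intToRatT_injective : Function.Injective (intToRatT F s) :=
  (IsFractionRing.injective _ _).comp (intToPoly_injective F s)

/-- The variable `t_i` in `K(t_1, …, t_s)`. -/
noncomputable def tRatT (i : Fin s) : RatT F s :=
  algebraMap (MvPolynomial (Fin s) (RatFunc F)) (RatT F s) (MvPolynomial.X i)

@[simp]
theorem intToRatT_X (i : Fin s) : intToRatT F s (MvPolynomial.X i) = tRatT F s i := by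
  simp [intToRatT, intToPoly, tRatT]

theorem intToRatT_C (a : F[X]) :
    intToRatT F s (MvPolynomial.C a) = Polynomial.aeval (theta F s) a := by
  rw [intToRatT, RingHom.comp_apply, intToPoly, MvPolynomial.map_C]
  change ratToRatT F s (algebraMap F[X] (RatFunc F) a) = _
  rw [← RatFunc.aeval_X_left_eq_algebraMap, Polynomial.aeval_def, Polynomial.aeval_def,
    Polynomial.hom_eval₂]
  rfl

theorem aeval_theta_injective :
    Function.Injective (Polynomial.aeval (theta F s) : F[X] →ₐ[F] RatT F s) := fun a b h => by
  rw [← intToRatT_C, ← intToRatT_C] at h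
  exact MvPolynomial.C_injective _ _ (intToRatT_injective F s h)

variable [Fintype F]

theorem theta_pow_sub_ne_zero (j : ℕ) : theta F s ^ Fintype.card F ^ (j + 1) - theta F s ≠ 0 := by
  intro h
  have : Polynomial.aeval (theta F s)
      (Polynomial.X ^ Fintype.card F ^ (j + 1) - Polynomial.X : F[X]) = 0 := by simpa using h
  rw [map_eq_zero_iff _ (aeval_theta_injective F s)] at this
  exact FiniteField.X_pow_card_pow_sub_X_ne_zero F (Nat.succ_ne_zero j) Fintype.one_lt_card this

theorem lval_ne_zero (n : ℕ) : lval F s n ≠ 0 :=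
  Finset.prod_ne_zero_iff.2 fun j _ => by
    rw [← neg_sub, neg_ne_zero]; exact theta_pow_sub_ne_zero F s j

theorem algebraMap_harmonicSum (d : ℕ) :
    algebraMap (MvPolynomial (Fin s) (RatFunc F)) (RatT F s) (harmonicSum F s 1 d) =
      ∑ i ∈ Finset.range d, ∑ a ∈ monics F i,
        (∏ i, Polynomial.aeval (tRatT F s i) a) / Polynomial.aeval (theta F s) a := by
  simp only [harmonicSum, powerSum, map_sum, map_mul, map_prod, zpow_one]
  refine Finset.sum_congr rfl fun i _ => Finset.sum_congr rfl fun a _ => ?_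
  rw [← intToRatT_C, div_eq_inv_mul]
  congr 1
  · rw [intToRatT, RingHom.comp_apply, intToPoly, MvPolynomial.map_C]
    exact map_inv₀ (ratToRatT F s) _
  · refine Finset.prod_congr rfl fun i _ => ?_
    rw [tRatT, Polynomial.aeval_algebraMap_apply]

/-- Up to sign, l_N is the image of the product ∏ (θ^{q^j} - θ), j ≤ N, a common multiple of all the
denominators a that occur. -/
theorem exists_intToRatT_eq_lval_mul (N : ℕ) : ∃ G : MvPolynomial (Fin s) F[X],
    intToRatT F s G = lval F s N *
      algebraMap (MvPolynomial (Fin s) (RatFunc F)) (RatT F s) (harmonicSum F s 1 (N + 1)) := by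
  rw [algebraMap_harmonicSum, Finset.mul_sum]
  suffices H : ∀ i ∈ Finset.range (N + 1), ∀ a ∈ monics F i, ∃ G : MvPolynomial (Fin s) F[X],
      intToRatT F s G = lval F s N *
        ((∏ i, Polynomial.aeval (tRatT F s i) a) / Polynomial.aeval (theta F s) a) by
    simp only [Finset.mul_sum]
    choose! G hG using H
    refine ⟨∑ i ∈ Finset.range (N + 1), ∑ a ∈ monics F i, G i a, ?_⟩
    rw [map_sum]
    refine Finset.sum_congr rfl fun i hi => ?_
    rw [map_sum]
    exact Finset.sum_congr rfl fun a ha => hG i hi a ha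
  intro i hi a ha
  obtain ⟨hmon, hdeg⟩ := (mem_monics F).1 ha
  rw [Finset.mem_range] at hi
  obtain ⟨b, hb⟩ := dvd_prod_X_pow_card_pow_sub_X a hmon.ne_zero N (by omega)
  have hl : lval F s N = Polynomial.aeval (theta F s) a * Polynomial.aeval (theta F s) ((-1) ^ N * b) := by
    rw [← map_mul, mul_left_comm, ← hb]
    simp only [map_mul, map_prod, map_pow, map_neg, map_one, map_sub, Polynomial.aeval_X]
    rw [← Finset.card_range N, ← Finset.prod_const, Finset.card_range, ← Finset.prod_mul_distrib]
    exact Finset.prod_congr rfl fun j _ => by ring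
  have ha0 : Polynomial.aeval (theta F s) a ≠ 0 := by
    rw [Ne, map_eq_zero_iff _ (aeval_theta_injective F s)]; exact hmon.ne_zero
  refine ⟨MvPolynomial.C ((-1) ^ N * b) * ∏ i, Polynomial.aeval (MvPolynomial.X i) a, ?_⟩
  rw [map_mul, intToRatT_C, map_prod, hl]
  have : ∀ i, intToRatT F s (Polynomial.aeval (MvPolynomial.X i) a) =
      Polynomial.aeval (tRatT F s i) a := fun i => by
    rw [Polynomial.aeval_def, Polynomial.aeval_def, Polynomial.hom_eval₂, intToRatT_X]
    congr 1
    ext x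
    simp only [RingHom.comp_apply, MvPolynomial.algebraMap_apply, Polynomial.algebraMap_eq]
    rw [intToRatT_C, Polynomial.aeval_C]
  simp only [this]
  field_simp

end HFraction

end CarlitzTate

namespace CarlitzTate

/-! ### Existence, integrality and uniqueness of the interpolating fraction -/

section HFraction

variable (F : Type*) [Field F] [Fintype F] (s : ℕ)

theorem theta_pow_card_pow_injective :
    Function.Injective fun n : ℕ => theta F s ^ Fintype.card F ^ n := fun n n' h => by
  have h1 : Polynomial.aeval (theta F s) (Polynomial.X ^ Fintype.card F ^ n : F[X]) =
      Polynomial.aeval (theta F s) (Polynomial.X ^ Fintype.card F ^ n' : F[X]) := by simpa using h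
  have h2 := congrArg Polynomial.natDegree (aeval_theta_injective F s h1)
  simp only [Polynomial.natDegree_X_pow] at h2
  exact Nat.pow_right_injective Fintype.one_lt_card h2

theorem deltaVal_theta_ne_zero (n k : ℕ) :
    deltaVal (Fintype.card F) (theta F s) (theta F s ^ Fintype.card F ^ n) k ≠ 0 := by
  induction k with
  | zero => simp [deltaVal]
  | succ k ih =>
    rw [deltaVal, ← pow_mul, ← pow_add, ← add_assoc]
    exact mul_ne_zero (theta_pow_sub_ne_zero F s (n + k)) (pow_ne_zero _ ih)

theorem monic_deltaVal (k : ℕ) :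
    (deltaVal (Fintype.card F) (Polynomial.C Polynomial.X) Polynomial.X k : F[X][X]).Monic := by
  induction k with
  | zero => exact Polynomial.monic_one
  | succ k ih =>
    exact (Polynomial.monic_X_pow_sub_C _ (pow_ne_zero _ Fintype.card_ne_zero)).mul (ih.pow _)

theorem bval_tRatT (n : ℕ) (i : Fin s) : bval n (tRatT F s i) = intToRatT F s
    (∏ j ∈ Finset.range n, (MvPolynomial.X i -
      MvPolynomial.C (Polynomial.X ^ Fintype.card F ^ j))) := by
  simp [bval, intToRatT_C]

theorem bval_tRatT_ne_zero (n : ℕ) (i : Fin s) : bval n (tRatT F s i) ≠ 0 := by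
  rw [bval_tRatT, Ne, map_eq_zero_iff _ (intToRatT_injective F s), Finset.prod_eq_zero_iff]
  rintro ⟨j, _, h⟩
  have h1 := congrArg (MvPolynomial.coeff (Finsupp.single i 1)) h
  rw [MvPolynomial.coeff_sub, MvPolynomial.coeff_X, MvPolynomial.coeff_C,
    if_neg (Finsupp.single_ne_zero.2 one_ne_zero).symm] at h1
  simp at h1

/-- The interpolating polynomial of the twisted harmonic sums. -/
theorem exists_interpolating_polynomial {m : ℕ} (hm : 1 ≤ m)
    (hs : s = m * (Fintype.card F - 1) + 1) :
    ∃ H : (MvPolynomial (Fin s) F[X])[X], ∀ n : ℕ,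
      lval F s (n + m - 1) * algebraMap (MvPolynomial (Fin s) (RatFunc F)) (RatT F s)
        (harmonicSum F s 1 (n + m)) =
      (∏ i, bval n (tRatT F s i)) * intToRatT F s
        (H.eval (MvPolynomial.C (Polynomial.X ^ Fintype.card F ^ n))) := by
  classical
  have hq : 1 < Fintype.card F := Fintype.one_lt_card
  -- Denominator and numerator of the fraction, with Y an indeterminate. The extra product in `P`
  -- accounts for passing from l_n to l_{n+m-1}.
  let Q : F[X][X] := (∏ l ∈ Finset.range m,
    deltaVal (Fintype.card F) (Polynomial.C (Polynomial.X : F[X])) (Polynomial.X : F[X][X]) l) ^ s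
  let P : (MvPolynomial (Fin s) F[X])[X] := (∏ j ∈ Finset.range (m - 1),
      (Polynomial.C (MvPolynomial.C Polynomial.X) - Polynomial.X ^ Fintype.card F ^ (j + 1))) *
    linearCoeff (Fintype.card F) (Polynomial.C (MvPolynomial.C Polynomial.X : MvPolynomial (Fin s) F[X]))
      (Polynomial.X : (MvPolynomial (Fin s) F[X])[X]) (fun i : Fin s => Polynomial.C (MvPolynomial.X i : MvPolynomial (Fin s) F[X])) m
  have hQ : Q.Monic := (Polynomial.monic_prod_of_monic _ _ fun l _ => monic_deltaVal F l).pow s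
  let y : ℕ → F[X] := fun n => Polynomial.X ^ Fintype.card F ^ n
  have hQn : ∀ n, intToRatT F s (MvPolynomial.C (Q.eval (y n))) =
      (∏ l ∈ Finset.range m, deltaVal (Fintype.card F) (theta F s)
        (theta F s ^ Fintype.card F ^ n) l) ^ s := fun n => by
    rw [intToRatT_C]
    change ((Polynomial.aeval (theta F s) : F[X] →ₐ[F] RatT F s) : F[X] →+* RatT F s)
      (Polynomial.evalRingHom (y n) Q) = _
    simp only [Q, map_pow, map_prod, map_deltaVal]
    simp [y]
  have hPn : ∀ n, intToRatT F s (P.eval (MvPolynomial.C (y n))) =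
      (∏ j ∈ Finset.range (m - 1),
        (theta F s - (theta F s ^ Fintype.card F ^ n) ^ Fintype.card F ^ (j + 1))) *
      linearCoeff (Fintype.card F) (theta F s) (theta F s ^ Fintype.card F ^ n) (tRatT F s) m := by
    intro n
    let φ : (MvPolynomial (Fin s) F[X])[X] →+* RatT F s :=
      (intToRatT F s).comp (Polynomial.evalRingHom (MvPolynomial.C (y n)))
    have h1 : φ Polynomial.X = theta F s ^ Fintype.card F ^ n := by simp [φ, y, intToRatT_C]
    have h2 : φ (Polynomial.C (MvPolynomial.C Polynomial.X)) = theta F s := by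
      simp [φ, intToRatT_C]
    have h3 : ∀ i, φ (Polynomial.C (MvPolynomial.X i)) = tRatT F s i := fun i => by simp [φ]
    refine (map_prod_mul_linearCoeff (B := (MvPolynomial (Fin s) F[X])[X]) (B' := RatT F s) φ hq _ m).trans ?_
    rw [h1, h2, funext h3]
  have hl : ∀ n, lval F s (n + m - 1) = (∏ i ∈ Finset.range n,
      (theta F s - theta F s ^ Fintype.card F ^ (i + 1))) * ∏ j ∈ Finset.range (m - 1),
        (theta F s - (theta F s ^ Fintype.card F ^ n) ^ Fintype.card F ^ (j + 1)) := fun n => by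
    rw [Nat.add_sub_assoc hm, lval, Finset.prod_range_add]
    simp only [← pow_mul, ← pow_add, add_assoc]
  have key : ∀ n, intToRatT F s (MvPolynomial.C (Q.eval (y n))) * (lval F s (n + m - 1) *
      algebraMap (MvPolynomial (Fin s) (RatFunc F)) (RatT F s) (harmonicSum F s 1 (n + m))) =
      (∏ i, bval n (tRatT F s i)) * intToRatT F s (P.eval (MvPolynomial.C (y n))) := by
    intro n
    have h1 := harmonic_eq_linearCoeff (n := n) hm hs (aeval_theta_injective F s) (tRatT F s)
    have h2 : algebraMap (MvPolynomial (Fin s) (RatFunc F)) (RatT F s) (harmonicSum F s 1 (n + m)) =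
        -∑ c : Fin (n + m) → F, (∏ i, Polynomial.aeval (tRatT F s i) (coeffPoly c)) /
          Polynomial.aeval (theta F s) (coeffPoly c) := by
      rw [algebraMap_harmonicSum]
      refine sum_monics_lt_eq_neg_sum _ (by simp) (fun x a hx => ?_) _
      have hx' : algebraMap F (RatT F s) x ≠ 0 := by simpa using hx
      -- The congruence s ≡ 1 mod q-1 enters here: scaling a by x multiplies ∏ a(t_i) and a by the
      -- same factor.
      have hxs : algebraMap F (RatT F s) x ^ s = algebraMap F (RatT F s) x := by
        rw [hs, pow_succ, mul_comm m, pow_mul, ← map_pow, FiniteField.pow_card_sub_one_eq_one x hx]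
        simp
      simp only [map_mul, Polynomial.aeval_C, Finset.prod_mul_distrib, Finset.prod_const,
        Finset.card_univ, Fintype.card_fin, hxs]
      rw [mul_div_mul_left _ _ hx']
    rw [hQn, hPn, h2, hl]
    simp only [bval]
    linear_combination (∏ j ∈ Finset.range (m - 1),
        (theta F s - (theta F s ^ Fintype.card F ^ n) ^ Fintype.card F ^ (j + 1))) * h1
  -- In `key` the product l·F_{n+m} is integral, so the value of Q divides ∏ b_n(t_i) times the
  -- value of P. The factors t_i - θ^{q^j} can be cancelled from such a divisibility by a constant.
  have hdvd : ∀ e ∈ Set.range fun n => Fintype.card F ^ n,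
      MvPolynomial.C (Q.eval (Polynomial.X ^ e)) ∣
        P.eval (MvPolynomial.C (Polynomial.X ^ e)) := by
    rintro _ ⟨n, rfl⟩
    obtain ⟨G, hG⟩ := exists_intToRatT_eq_lval_mul F s (n + m - 1)
    rw [Nat.sub_add_cancel (by omega)] at hG
    have h1 := key n
    rw [← hG, ← map_mul] at h1
    simp only [bval_tRatT] at h1
    rw [← map_prod, ← map_mul] at h1
    have h2 := intToRatT_injective F s h1
    rw [← Finset.prod_product' Finset.univ (Finset.range n) fun i j =>
      (MvPolynomial.X i - MvPolynomial.C (Polynomial.X ^ Fintype.card F ^ j))] at h2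
    exact C_dvd_of_dvd_prod_mul _ _ (fun k : Fin s × ℕ => k.1)
      (fun k => Polynomial.X ^ Fintype.card F ^ k.2) _ ⟨G, h2.symm⟩
  obtain ⟨H, hH⟩ := map_C_dvd_of_forall_eval_dvd hQ P
    (Set.infinite_range_of_injective (Nat.pow_right_injective hq)) hdvd
  refine ⟨H, fun n => ?_⟩
  have h1 := key n
  have h0 : intToRatT F s (MvPolynomial.C (Q.eval (y n))) ≠ 0 := by
    rw [hQn]
    exact pow_ne_zero _ (Finset.prod_ne_zero_iff.2 fun l _ => deltaVal_theta_ne_zero F s n l)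
  rw [hH, Polynomial.eval_mul, map_mul, Polynomial.eval_map, Polynomial.eval₂_at_apply,
    mul_left_comm (∏ i, _)] at h1
  exact mul_left_cancel₀ h0 h1

/-- The factors Π_{s,d} are nonzero, so two candidates agree at every Y = θ^{q^n}; the numerator of
their difference has infinitely many roots. -/
theorem isHFraction_iff {m : ℕ} (hm : 1 ≤ m) (hms : mval F s = m)
    {H : (MvPolynomial (Fin s) F[X])[X]}
    (hH : ∀ n : ℕ, lval F s (n + m - 1) * algebraMap (MvPolynomial (Fin s) (RatFunc F)) (RatT F s)
        (harmonicSum F s 1 (n + m)) =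
      (∏ i, bval n (tRatT F s i)) * intToRatT F s
        (H.eval (MvPolynomial.C (Polynomial.X ^ Fintype.card F ^ n))))
    (R : RatFunc (RatT F s)) : IsHFraction R ↔ R = polyYToFraction F s H := by
  let p : (RatT F s)[X] := H.map (intToRatT F s)
  have hp : polyYToFraction F s H = algebraMap (RatT F s)[X] (RatFunc (RatT F s)) p := rfl
  have hpe : ∀ n, p.eval (theta F s ^ Fintype.card F ^ n) = intToRatT F s
        (H.eval (MvPolynomial.C (Polynomial.X ^ Fintype.card F ^ n))) := fun n => by
    have : theta F s ^ Fintype.card F ^ n =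
        intToRatT F s (MvPolynomial.C (Polynomial.X ^ Fintype.card F ^ n)) := by
      simp [intToRatT_C]
    rw [this, Polynomial.eval_map, Polynomial.eval₂_at_apply]
  have hPi : ∀ n, PiVal F s (n + m) = (∏ i, bval n (tRatT F s i)) / lval F s (n + m - 1) :=
    fun n => by rw [PiVal, hms, Nat.add_sub_cancel]; rfl
  have hPi0 : ∀ n, PiVal F s (n + m) ≠ 0 := fun n => by
    rw [hPi]
    exact div_ne_zero (Finset.prod_ne_zero_iff.2 fun i _ => bval_tRatT_ne_zero F s n i)
      (lval_ne_zero F s _)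
  have hF : ∀ n, algebraMap (MvPolynomial (Fin s) (RatFunc F)) (RatT F s)
      (harmonicSum F s 1 (n + m)) =
        PiVal F s (n + m) * p.eval (theta F s ^ Fintype.card F ^ n) := fun n => by
    rw [hPi, hpe, div_mul_eq_mul_div, eq_div_iff (lval_ne_zero F s _), ← hH, mul_comm]
  constructor
  · intro hR
    have h1 : R.num - p * R.denom = 0 := by
      refine Polynomial.eq_zero_of_infinite_isRoot _ ((Set.infinite_range_of_injective
        (theta_pow_card_pow_injective F s)).mono ?_)
      rintro _ ⟨n, rfl⟩
      obtain ⟨h2, h3⟩ := hR (n + m) (by omega) (by omega)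
      rw [hms, Nat.add_sub_cancel] at h2 h3
      have h4 := mul_left_cancel₀ (hPi0 n) ((hF n).symm.trans h3)
      rw [RatFunc.eval, Polynomial.eval₂_id, Polynomial.eval₂_id, eq_div_iff h2] at h4
      simp only [Set.mem_ofPred_eq, Polynomial.IsRoot, Polynomial.eval_sub, Polynomial.eval_mul]
      rw [← h4, sub_self]
    rw [hp, ← RatFunc.num_div_denom R, sub_eq_zero.1 h1, map_mul, mul_div_cancel_right₀]
    exact (map_ne_zero_iff _ (RatFunc.algebraMap_injective _)).2 R.denom_ne_zero
  · rintro rfl d hd1 hdm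
    obtain ⟨n, rfl⟩ : ∃ n, d = n + m := ⟨d - m, by omega⟩
    rw [hp, hms, Nat.add_sub_cancel, RatFunc.denom_algebraMap, Polynomial.eval_one, hF]
    refine ⟨one_ne_zero, ?_⟩
    rw [RatFunc.eval_algebraMap]
    rfl

end HFraction

end CarlitzTate

namespace CarlitzTate

/-! ### Absolute values of elements of K in ℂ_∞ -/

section Norms

variable (F : Type*) [Field F] [Fintype F]

theorem norm_ratToC (x : RatFunc F) : ‖ratToC F x‖ = ‖ratToKInfty F x‖ := by
  rw [ratToC, RingHom.comp_apply, RingHom.comp_apply]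
  exact (norm_algebraMap' (CInfty F) (algebraMap (KInfty F) (KInftyAc F) (ratToKInfty F x))).trans
    (norm_algebraMap' (KInftyAc F) _)

theorem norm_ratToC_le_one_iff {x : RatFunc F} : ‖ratToC F x‖ ≤ 1 ↔
    Valued.v (ratToKInfty F x) ≤ 1 := by
  rw [norm_ratToC]
  exact Valued.toNormedField.norm_le_one_iff

theorem one_lt_norm_thetaC : 1 < ‖thetaC F‖ := by
  classical
  rw [← not_le, thetaC, norm_ratToC_le_one_iff, valued_ratToKInfty, RatFunc.inftyValuation.X,
    not_le, ← WithZero.exp_zero, WithZero.exp_lt_exp]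
  exact zero_lt_one

theorem norm_ratToC_algebraMap {a : F[X]} (ha : a ≠ 0) :
    ‖ratToC F (algebraMap F[X] (RatFunc F) a)‖ = ‖thetaC F‖ ^ a.natDegree := by
  classical
  have hv : ∀ b : F[X], b ≠ 0 → RatFunc.inftyValuation F (algebraMap F[X] (RatFunc F) b) =
      WithZero.exp (b.natDegree : ℤ) := fun b hb => RatFunc.inftyValuation.polynomial F hb
  -- The norm is compared with the valuation only through the condition ≤ 1, so a is compared with
  -- X^{deg a} in both directions.
  have h1 : ∀ b c : F[X], b ≠ 0 → c ≠ 0 → b.natDegree = c.natDegree →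
      ‖ratToC F (algebraMap F[X] (RatFunc F) b)‖ ≤ ‖ratToC F (algebraMap F[X] (RatFunc F) c)‖ := by
    intro b c hb hc hbc
    have hc' : 0 < ‖ratToC F (algebraMap F[X] (RatFunc F) c)‖ := by simpa using hc
    rw [← div_le_one hc', ← norm_div, ← map_div₀, norm_ratToC_le_one_iff, valued_ratToKInfty,
      map_div₀, hv b hb, hv c hc, hbc, div_self WithZero.coe_ne_zero]
  have h2 : (Polynomial.X ^ a.natDegree : F[X]) ≠ 0 := pow_ne_zero _ Polynomial.X_ne_zero
  have h3 := le_antisymm (h1 a _ ha h2 (by simp)) (h1 _ a h2 ha (by simp))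
  rw [h3, map_pow, map_pow, norm_pow, RatFunc.algebraMap_X, thetaC]

theorem norm_ratToC_C_le_one (c : F) : ‖ratToC F (RatFunc.C c)‖ ≤ 1 := by
  rcases eq_or_ne c 0 with rfl | hc
  · simp
  · have := norm_ratToC_algebraMap F (Polynomial.C_ne_zero.2 hc)
    rw [RatFunc.algebraMap_C] at this
    simp [this]

theorem thetaC_ne_zero : thetaC F ≠ 0 :=
  norm_pos_iff.1 (zero_lt_one.trans (one_lt_norm_thetaC F))

end Norms

/-! ### Coefficients, completeness and Frobenius on the Tate algebra -/

section Tate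

variable {F : Type*} [Field F] [Fintype F] {s : ℕ}

/-- The coefficients of an element of `𝕋_s`. -/
noncomputable def tateCoeff (μ : Fin s →₀ ℕ) : Tate F s →+ CInfty F where
  toFun f := MvPowerSeries.coeff μ f.1
  map_zero' := by simp
  map_add' f g := by simp

theorem tate_ext {f g : Tate F s} (h : ∀ μ, tateCoeff μ f = tateCoeff μ g) : f = g :=
  Subtype.ext (MvPowerSeries.ext h)

theorem norm_tateCoeff_le (μ : Fin s →₀ ℕ) (f : Tate F s) : ‖tateCoeff μ f‖ ≤ ‖f‖ := by
  have := MvPowerSeries.le_gaussNorm (fun c : CInfty F => ‖c‖) (fun _ => (1 : ℝ)) f.1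
    (hasGaussNorm f) μ
  simp only [one_pow, Finsupp.prod, Finset.prod_const_one, mul_one] at this
  exact this

theorem tateNorm_le_of_coeff {f : Tate F s} {r : ℝ} (h : ∀ μ, ‖tateCoeff μ f‖ ≤ r) : ‖f‖ ≤ r := by
  change MvPowerSeries.gaussNorm _ _ _ ≤ r
  refine ciSup_le fun μ => ?_
  simp only [one_pow, Finsupp.prod, Finset.prod_const_one, mul_one]
  exact h μ

theorem continuous_tateCoeff (μ : Fin s →₀ ℕ) : Continuous (tateCoeff (F := F) μ) :=
  AddMonoidHomClass.continuous_of_bound (tateCoeff μ) 1 fun f => by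
    simpa using norm_tateCoeff_le μ f

theorem tendsto_norm_tateCoeff (f : Tate F s) :
    Tendsto (fun μ => ‖tateCoeff μ f‖) cofinite (𝓝 0) := by
  have h : Tendsto _ cofinite (𝓝 (0 : ℝ)) := f.2
  simp only [one_pow, Finsupp.prod, Finset.prod_const_one, mul_one] at h
  exact h

instance : IsUltrametricDist (Tate F s) :=
  IsUltrametricDist.isUltrametricDist_of_forall_norm_add_le_max_norm tateNorm_add_le

theorem tateCoeff_const (c : CInfty F) (μ : Fin s →₀ ℕ) :
    tateCoeff μ (const F s c) = if μ = 0 then c else 0 := by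
  classical
  change MvPowerSeries.coeff μ (MvPowerSeries.C c) = _
  rw [MvPowerSeries.coeff_C]

theorem tateCoeff_const_mul (c : CInfty F) (f : Tate F s) (μ : Fin s →₀ ℕ) :
    tateCoeff μ (const F s c * f) = c * tateCoeff μ f :=
  MvPowerSeries.coeff_C_mul μ f.1 c

theorem norm_const (c : CInfty F) : ‖const F s c‖ = ‖c‖ := by
  refine le_antisymm (tateNorm_le_of_coeff fun μ => ?_) ?_
  · rw [tateCoeff_const]; split_ifs <;> simp
  · simpa [tateCoeff_const] using norm_tateCoeff_le 0 (const F s c)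

theorem norm_const_mul (c : CInfty F) (f : Tate F s) : ‖const F s c * f‖ = ‖c‖ * ‖f‖ := by
  refine le_antisymm ((norm_mul_le _ _).trans (by rw [norm_const])) ?_
  rcases eq_or_ne c 0 with rfl | hc
  · simp
  · have h1 : f = const F s c⁻¹ * (const F s c * f) := by
      rw [← mul_assoc, ← map_mul, inv_mul_cancel₀ hc, map_one, one_mul]
    have h2 : ‖f‖ ≤ ‖c‖⁻¹ * ‖const F s c * f‖ := by
      conv_lhs => rw [h1]
      exact (norm_mul_le _ _).trans (by rw [norm_const, norm_inv])
    have hc' : 0 < ‖c‖ := norm_pos_iff.2 hc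
    rwa [le_inv_mul_iff₀ hc'] at h2

instance : NormOneClass (Tate F s) :=
  ⟨by rw [← map_one (const F s), norm_const, norm_one]⟩

theorem norm_tvar_le (i : Fin s) : ‖tvar F i‖ ≤ 1 := by
  classical
  refine tateNorm_le_of_coeff fun μ => ?_
  change ‖MvPowerSeries.coeff μ (MvPowerSeries.X i)‖ ≤ 1
  rw [MvPowerSeries.coeff_X]
  split_ifs <;> simp

theorem continuous_const : Continuous (const F s) :=
  AddMonoidHomClass.continuous_of_bound (const F s) 1 fun c => by simp [norm_const]

/-- A Cauchy sequence converges coefficientwise, uniformly in the index; uniformity makes the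
coefficients of the limit tend to 0. -/
instance : CompleteSpace (Tate F s) := by
  refine Metric.complete_of_cauchySeq_tendsto fun u hu => ?_
  have hc : ∀ μ, CauchySeq fun n => tateCoeff μ (u n) := fun μ =>
    hu.map (uniformContinuous_addMonoidHom_of_continuous (continuous_tateCoeff μ))
  choose a ha using fun μ => cauchySeq_tendsto_of_complete (hc μ)
  have key : ∀ ε > 0, ∃ N, ∀ n ≥ N, ∀ μ, ‖tateCoeff μ (u n) - a μ‖ ≤ ε := by
    intro ε hε
    obtain ⟨N, hN⟩ := Metric.cauchySeq_iff.1 hu ε hε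
    refine ⟨N, fun n hn μ => ?_⟩
    have h1 : Tendsto (fun k => ‖tateCoeff μ (u n) - tateCoeff μ (u k)‖) atTop
        (𝓝 ‖tateCoeff μ (u n) - a μ‖) := (tendsto_const_nhds.sub (ha μ)).norm
    refine le_of_tendsto h1 (eventually_atTop.2 ⟨N, fun k hk => ?_⟩)
    rw [← map_sub]
    refine (norm_tateCoeff_le μ _).trans ?_
    rw [← dist_eq_norm]
    exact (hN n hn k hk).le
  have hres : MvPowerSeries.IsRestricted (fun _ => (1 : ℝ)) (a : MvPowerSeries (Fin s) (CInfty F)) := by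
    have : Tendsto (fun μ => ‖a μ‖) cofinite (𝓝 0) := by
      rw [Metric.tendsto_nhds]
      intro ε hε
      obtain ⟨N, hN⟩ := key (ε / 2) (half_pos hε)
      filter_upwards [(Metric.tendsto_nhds.1 (tendsto_norm_tateCoeff (u N))) (ε / 2) (half_pos hε)]
        with μ hμ
      have h1 := hN N le_rfl μ
      rw [dist_zero_right, norm_norm] at hμ ⊢
      have h2 : ‖a μ‖ ≤ ‖tateCoeff μ (u N)‖ + ‖tateCoeff μ (u N) - a μ‖ := by
        rw [norm_sub_rev]; exact norm_le_norm_add_norm_sub' _ _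
      linarith
    refine this.congr fun μ => ?_
    simp only [one_pow, Finsupp.prod, Finset.prod_const_one, mul_one]
    rfl
  refine ⟨⟨a, hres⟩, Metric.tendsto_atTop.2 fun ε hε => ?_⟩
  obtain ⟨N, hN⟩ := key (ε / 2) (half_pos hε)
  refine ⟨N, fun n hn => ?_⟩
  rw [dist_eq_norm]
  refine (tateNorm_le_of_coeff (r := ε / 2) fun μ => ?_).trans_lt (half_lt_self hε)
  rw [map_sub]
  exact hN n hn μ

theorem tateCoeff_polyToTate (p : MvPolynomial (Fin s) (RatFunc F)) (μ : Fin s →₀ ℕ) :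
    tateCoeff μ (polyToTate F s p) = ratToC F (p.coeff μ) := by
  have h : (Subring.subtype _).comp (polyToTate F s) =
      MvPolynomial.coeToMvPowerSeries.ringHom.comp (MvPolynomial.map (ratToC F)) := by
    refine MvPolynomial.ringHom_ext (fun c => ?_) fun i => ?_
    · simp only [RingHom.comp_apply, polyToTate, MvPolynomial.coe_eval₂Hom, MvPolynomial.eval₂_C,
        MvPolynomial.map_C, MvPolynomial.coeToMvPowerSeries.ringHom_apply, MvPolynomial.coe_C]
      rfl
    · simp [polyToTate, tvar]
  have h1 := congrArg (MvPowerSeries.coeff μ) (RingHom.congr_fun h p)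
  simp only [RingHom.comp_apply, MvPolynomial.coeToMvPowerSeries.ringHom_apply,
    MvPolynomial.coeff_coe, MvPolynomial.coeff_map] at h1
  exact h1

theorem polyToTate_injective : Function.Injective (polyToTate F s) := fun p r h => by
  ext1 μ
  refine (ratToC F).injective ?_
  rw [← tateCoeff_polyToTate, h, tateCoeff_polyToTate]

@[simp]
theorem polyToTate_X (i : Fin s) : polyToTate F s (MvPolynomial.X i) = tvar F i := by
  simp [polyToTate]

@[simp]
theorem polyToTate_C (x : RatFunc F) : polyToTate F s (MvPolynomial.C x) = const F s (ratToC F x) := by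
  simp [polyToTate]

/-- `tau` as a ring homomorphism. -/
noncomputable def tauHom : Tate F s →+* Tate F s where
  toFun := tau
  map_one' := Subtype.ext (map_one (MvPowerSeries.map (frobC F)))
  map_zero' := Subtype.ext (map_zero (MvPowerSeries.map (frobC F)))
  map_mul' f g := Subtype.ext (map_mul (MvPowerSeries.map (frobC F)) f.1 g.1)
  map_add' f g := Subtype.ext (map_add (MvPowerSeries.map (frobC F)) f.1 g.1)

theorem tau_iterate_eq (j : ℕ) (f : Tate F s) : tau^[j] f = (tauHom ^ j : Tate F s →+* Tate F s) f := by
  rw [RingHom.coe_pow]; rfl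

theorem tateCoeff_tau_iterate (j : ℕ) (f : Tate F s) (μ : Fin s →₀ ℕ) :
    tateCoeff μ (tau^[j] f) = tateCoeff μ f ^ Fintype.card F ^ j := by
  induction j generalizing f with
  | zero => simp
  | succ j ih =>
    rw [Function.iterate_succ_apply, ih, pow_succ' (Fintype.card F), pow_mul]
    rfl

theorem tau_iterate_const (j : ℕ) (c : CInfty F) :
    tau^[j] (const F s c) = const F s (c ^ Fintype.card F ^ j) := by
  refine tate_ext fun μ => ?_
  rw [tateCoeff_tau_iterate, tateCoeff_const, tateCoeff_const, ite_pow,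
    zero_pow (pow_ne_zero _ Fintype.card_ne_zero)]

theorem tau_iterate_tvar (j : ℕ) (i : Fin s) : tau^[j] (tvar F i) = tvar F i := by
  classical
  refine tate_ext fun μ => ?_
  rw [tateCoeff_tau_iterate]
  change MvPowerSeries.coeff μ (MvPowerSeries.X i) ^ _ = MvPowerSeries.coeff μ (MvPowerSeries.X i)
  rw [MvPowerSeries.coeff_X, ite_pow, one_pow, zero_pow (pow_ne_zero _ Fintype.card_ne_zero)]

theorem norm_tau_iterate_le (j : ℕ) (f : Tate F s) : ‖tau^[j] f‖ ≤ ‖f‖ ^ Fintype.card F ^ j :=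
  tateNorm_le_of_coeff fun μ => by
    rw [tateCoeff_tau_iterate, norm_pow]
    exact pow_le_pow_left₀ (norm_nonneg _) (norm_tateCoeff_le μ f) _

end Tate

end CarlitzTate

namespace CarlitzTate

/-! ### Infinite products of units 1 - x in ultrametric rings -/

section UltrametricRing

variable {R : Type*} [NormedCommRing R] [CompleteSpace R]

theorem one_sub_mul_inverse {x : R} (hx : ‖x‖ < 1) : (1 - x) * Ring.inverse (1 - x) = 1 :=
  Ring.mul_inverse_cancel _ (isUnit_one_sub_of_norm_lt_one hx)

variable [NormOneClass R]

/-- The inverse y satisfies y = 1 + xy; if ‖y‖ > 1, the ultrametric inequality would give ‖y‖ ≤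
‖x‖‖y‖ < ‖y‖. -/
theorem norm_inverse_one_sub_le [IsUltrametricDist R] {x : R} (hx : ‖x‖ < 1) : ‖Ring.inverse (1 - x)‖ ≤ 1 := by
  have h := one_sub_mul_inverse hx
  set y := Ring.inverse (1 - x)
  have hy : y = 1 + x * y := by linear_combination h
  by_contra! hlt
  have h1 : ‖y‖ ≤ max ‖(1 : R)‖ ‖x * y‖ := by
    conv_lhs => rw [hy]
    exact IsUltrametricDist.norm_add_le_max _ _
  rw [norm_one] at h1
  rcases le_max_iff.1 h1 with h2 | h2
  · exact hlt.not_ge h2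
  · have h3 : ‖x * y‖ ≤ ‖x‖ * ‖y‖ := norm_mul_le _ _
    nlinarith

theorem norm_inverse_one_sub_sub_one_le [IsUltrametricDist R] {x : R} (hx : ‖x‖ < 1) :
    ‖Ring.inverse (1 - x) - 1‖ ≤ ‖x‖ := by
  have h := one_sub_mul_inverse hx
  have hy : Ring.inverse (1 - x) - 1 = x * Ring.inverse (1 - x) := by linear_combination h
  rw [hy]
  exact (norm_mul_le _ _).trans
    (mul_le_of_le_one_right (norm_nonneg _) (norm_inverse_one_sub_le hx))

theorem multipliable_one_sub {x : ℕ → R} (hx : Summable fun j => ‖x j‖) :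
    Multipliable fun j => 1 - x j := by
  simp only [sub_eq_add_neg]
  exact multipliable_one_add_of_summable (by simpa using hx)

theorem multipliable_inverse_one_sub [IsUltrametricDist R] {x : ℕ → R} (hx : Summable fun j => ‖x j‖)
    (hx1 : ∀ j, ‖x j‖ < 1) : Multipliable fun j => Ring.inverse (1 - x j) := by
  have h : Multipliable fun j => 1 + (Ring.inverse (1 - x j) - 1) :=
    multipliable_one_add_of_summable
      (hx.of_nonneg_of_le (fun _ => norm_nonneg _) fun j => norm_inverse_one_sub_sub_one_le (hx1 j))
  simpa using h

theorem tprod_inverse_mul_tprod [IsUltrametricDist R] {x : ℕ → R} (hx : Summable fun j => ‖x j‖)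
    (hx1 : ∀ j, ‖x j‖ < 1) :
    (∏' j, Ring.inverse (1 - x j)) * ∏' j, (1 - x j) = 1 := by
  rw [← (multipliable_inverse_one_sub hx hx1).tprod_mul (multipliable_one_sub hx)]
  simp [mul_comm _ (1 - x _), one_sub_mul_inverse (hx1 _)]

end UltrametricRing

/-! ### Frobenius on ℂ_∞ and the sequence θ^{q^j} -/

section Frobenius

variable {F : Type*} [Field F] [Fintype F]

theorem pow_card_pow_eq (j : ℕ) (x : CInfty F) :
    (frobC F ^ j : CInfty F →+* CInfty F) x = x ^ Fintype.card F ^ j := by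
  induction j with
  | zero => simp
  | succ j ih =>
    rw [pow_succ', RingHom.mul_def, RingHom.comp_apply, ih, frobC_apply, ← pow_mul, ← pow_succ]

theorem sub_pow_card_pow (j : ℕ) (x y : CInfty F) :
    (x - y) ^ Fintype.card F ^ j = x ^ Fintype.card F ^ j - y ^ Fintype.card F ^ j := by
  simp only [← pow_card_pow_eq, map_sub]

theorem add_pow_card_pow (j : ℕ) (x y : CInfty F) :
    (x + y) ^ Fintype.card F ^ j = x ^ Fintype.card F ^ j + y ^ Fintype.card F ^ j := by
  simp only [← pow_card_pow_eq, map_add]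

theorem neg_pow_card_pow (j : ℕ) (x : CInfty F) :
    (-x) ^ Fintype.card F ^ j = -x ^ Fintype.card F ^ j := by
  simp only [← pow_card_pow_eq, map_neg]

theorem ratToC_C_pow_card_pow (j : ℕ) (c : F) :
    ratToC F (RatFunc.C c) ^ Fintype.card F ^ j = ratToC F (RatFunc.C c) := by
  rw [← map_pow, ← map_pow, FiniteField.pow_card_pow]

variable (F) in
/-- `θ^{q^j}`. -/
noncomputable def thetaPow (j : ℕ) : CInfty F := thetaC F ^ Fintype.card F ^ j

@[simp]
theorem thetaPow_zero : thetaPow F 0 = thetaC F := by simp [thetaPow]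

theorem thetaPow_ne_zero (j : ℕ) : thetaPow F j ≠ 0 := pow_ne_zero _ (thetaC_ne_zero F)

theorem norm_thetaPow (j : ℕ) : ‖thetaPow F j‖ = ‖thetaC F‖ ^ Fintype.card F ^ j := norm_pow _ _

theorem thetaPow_pow (i j : ℕ) : thetaPow F i ^ Fintype.card F ^ j = thetaPow F (i + j) := by
  rw [thetaPow, thetaPow, ← pow_mul, ← pow_add]

theorem norm_thetaPow_lt {i j : ℕ} (h : i < j) :
    ‖thetaC F‖ * ‖thetaPow F i‖ ≤ ‖thetaPow F j‖ := by
  rw [norm_thetaPow, norm_thetaPow, ← pow_succ']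
  exact pow_le_pow_right₀ (one_lt_norm_thetaC F).le (Nat.pow_lt_pow_right Fintype.one_lt_card h)

theorem norm_thetaPow_lt' {i j : ℕ} (h : i < j) : ‖thetaPow F i‖ < ‖thetaPow F j‖ :=
  (lt_mul_left (norm_pos_iff.2 (thetaPow_ne_zero i)) (one_lt_norm_thetaC F)).trans_le
    (norm_thetaPow_lt h)

theorem thetaPow_injective : Function.Injective (thetaPow F) := by
  have : StrictMono fun j => ‖thetaPow F j‖ := fun i j h => norm_thetaPow_lt' h
  exact fun i j h => this.injective (congrArg norm h)

theorem norm_thetaPow_sub {i j : ℕ} (h : i ≠ j) :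
    ‖thetaPow F i - thetaPow F j‖ = max ‖thetaPow F i‖ ‖thetaPow F j‖ := by
  have h1 : ‖thetaPow F i‖ ≠ ‖-thetaPow F j‖ := by
    rw [norm_neg]
    rcases lt_or_gt_of_ne h with h | h
    · exact (norm_thetaPow_lt' h).ne
    · exact (norm_thetaPow_lt' h).ne'
  rw [sub_eq_add_neg, IsUltrametricDist.norm_add_eq_max_of_norm_ne_norm h1, norm_neg]

theorem norm_div_thetaPow_le {i j : ℕ} (h : i < j) :
    ‖thetaPow F i / thetaPow F j‖ ≤ ‖thetaC F‖⁻¹ := by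
  have h1 := norm_thetaPow_lt (F := F) h
  have h2 : 0 < ‖thetaPow F j‖ := norm_pos_iff.2 (thetaPow_ne_zero j)
  have h3 := zero_lt_one.trans (one_lt_norm_thetaC F)
  rw [norm_div, div_le_iff₀ h2, le_inv_mul_iff₀ h3]
  exact h1

theorem summable_inv_norm_pow : Summable fun j : ℕ => ‖thetaC F‖⁻¹ ^ j :=
  summable_geometric_of_lt_one (inv_nonneg.2 (norm_nonneg _))
    (inv_lt_one_of_one_lt₀ (one_lt_norm_thetaC F))

theorem norm_inv_thetaPow_le (j : ℕ) : ‖(thetaPow F j)⁻¹‖ ≤ ‖thetaC F‖⁻¹ ^ (j + 1) := by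
  rw [norm_inv, norm_thetaPow, ← inv_pow]
  exact pow_le_pow_of_le_one (inv_nonneg.2 (norm_nonneg _))
    (inv_lt_one_of_one_lt₀ (one_lt_norm_thetaC F)).le (Nat.lt_pow_self Fintype.one_lt_card)

end Frobenius

/-! ### The Anderson–Thakur function as an infinite product -/

section Omega

variable {F : Type*} [Field F] [Fintype F] {s : ℕ}

/-- `t_i / θ^{q^j}` as an element of `𝕋_s`. -/
noncomputable def tvarDiv (i : Fin s) (j : ℕ) : Tate F s := const F s (thetaPow F j)⁻¹ * tvar F i

theorem norm_tvarDiv_le (i : Fin s) (j : ℕ) : ‖tvarDiv (F := F) i j‖ ≤ ‖thetaC F‖⁻¹ ^ (j + 1) := by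
  rw [tvarDiv, norm_const_mul]
  exact (mul_le_of_le_one_right (norm_nonneg _) (norm_tvar_le i)).trans (norm_inv_thetaPow_le j)

theorem norm_tvarDiv_lt_one (i : Fin s) (j : ℕ) : ‖tvarDiv (F := F) i j‖ < 1 :=
  (norm_tvarDiv_le i j).trans_lt (pow_lt_one₀ (inv_nonneg.2 (norm_nonneg _))
    (inv_lt_one_of_one_lt₀ (one_lt_norm_thetaC F)) (Nat.succ_ne_zero j))

theorem summable_norm_tvarDiv (i : Fin s) : Summable fun j => ‖tvarDiv (F := F) i j‖ :=
  ((summable_nat_add_iff 1).2 (summable_inv_norm_pow (F := F))).of_nonneg_of_le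
    (fun _ => norm_nonneg _) (norm_tvarDiv_le i)

theorem omega_eq (ϖ : CInfty F) (i : Fin s) :
    omega ϖ i = const F s ϖ * ∏' j, Ring.inverse (1 - tvarDiv (F := F) i j) := rfl

/-- The entire function `∏ j, (1 - t_i / θ^{q^j})`. -/
noncomputable def omegaInv (i : Fin s) : Tate F s := ∏' j, (1 - tvarDiv (F := F) i j)

theorem omega_mul_omegaInv (ϖ : CInfty F) (i : Fin s) :
    omega ϖ i * omegaInv i = const F s ϖ := by
  rw [omega_eq, mul_assoc, omegaInv,
    tprod_inverse_mul_tprod (summable_norm_tvarDiv i) (norm_tvarDiv_lt_one i), mul_one]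

theorem tendsto_omegaInv (i : Fin s) :
    Tendsto (fun n => ∏ j ∈ Finset.range n, (1 - tvarDiv (F := F) i j)) atTop
      (𝓝 (omegaInv (F := F) i)) :=
  (multipliable_one_sub (summable_norm_tvarDiv (F := F) i)).hasProd.tendsto_prod_nat

theorem isUnit_omegaInv (i : Fin s) : IsUnit (omegaInv (F := F) i) :=
  isUnit_iff_exists_inv'.2 ⟨_, tprod_inverse_mul_tprod (summable_norm_tvarDiv (F := F) i)
    (norm_tvarDiv_lt_one i)⟩

theorem isUnit_const {c : CInfty F} (hc : c ≠ 0) : IsUnit (const F s c) :=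
  (IsUnit.mk0 c hc).map (const F s)

theorem isUnit_omega {ϖ : CInfty F} (hϖ : ϖ ≠ 0) (i : Fin s) : IsUnit (omega ϖ i) := by
  have h : IsUnit (omega ϖ i * omegaInv i) := by
    rw [omega_mul_omegaInv]; exact isUnit_const hϖ
  exact isUnit_of_mul_isUnit_left h

/-! ### The partial fraction expansion of `ω` -/

variable (F) in
/-- The partial products of `∏_{k ≥ 1} (1 - θ^{1 - q^k})`. -/
noncomputable def lamPartial (n : ℕ) : CInfty F :=
  ∏ k ∈ Finset.range n, (1 - thetaC F / thetaPow F (k + 1))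

variable (F) in
/-- The product `∏_{k ≥ 1} (1 - θ^{1 - q^k})`. -/
noncomputable def lamC : CInfty F := ∏' k, (1 - thetaC F / thetaPow F (k + 1))

theorem norm_one_sub_theta_div (i : ℕ) : ‖1 - thetaC F / thetaPow F (i + 1)‖ = 1 := by
  have h := norm_div_thetaPow_le (F := F) (Nat.succ_pos i)
  rw [thetaPow_zero] at h
  have h1 : ‖-(thetaC F / thetaPow F (i + 1))‖ < 1 := by
    rw [norm_neg]
    exact h.trans_lt (inv_lt_one_of_one_lt₀ (one_lt_norm_thetaC F))
  rw [sub_eq_add_neg, IsUltrametricDist.norm_add_eq_max_of_norm_ne_norm (by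
    rw [norm_one]; exact h1.ne'), norm_one, max_eq_left h1.le]

theorem norm_lamPartial (n : ℕ) : ‖lamPartial F n‖ = 1 := by
  rw [lamPartial, norm_prod]
  exact Finset.prod_eq_one fun i _ => norm_one_sub_theta_div i

theorem tendsto_lamPartial : Tendsto (lamPartial F) atTop (𝓝 (lamC F)) := by
  refine (multipliable_one_sub ?_).hasProd.tendsto_prod_nat
  refine Summable.of_nonneg_of_le (fun _ => norm_nonneg _) (fun k => ?_)
    (((summable_nat_add_iff 2).2 (summable_inv_norm_pow (F := F))).mul_left ‖thetaC F‖)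
  rw [div_eq_mul_inv, norm_mul]
  exact mul_le_mul_of_nonneg_left (norm_inv_thetaPow_le (k + 1)) (norm_nonneg _)

theorem norm_lamC : ‖lamC F‖ = 1 :=
  tendsto_nhds_unique tendsto_lamPartial.norm (by simp [norm_lamPartial])

theorem lamC_ne_zero : lamC F ≠ 0 := norm_pos_iff.1 (by rw [norm_lamC]; exact one_pos)

variable (F) in
/-- The coefficients in the partial fraction expansion of a finite product. -/
noncomputable def pfCoeff (N j : ℕ) : CInfty F :=
  ∏ i ∈ (Finset.range N).erase j, thetaPow F i / (thetaPow F i - thetaPow F j)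

theorem tvar_sub_const (i : Fin s) (j : ℕ) :
    tvar F i - const F s (thetaPow F j) = const F s (-thetaPow F j) * (1 - tvarDiv i j) := by
  have h : const F s (thetaPow F j) * const F s (thetaPow F j)⁻¹ = 1 := by
    rw [← map_mul, mul_inv_cancel₀ (thetaPow_ne_zero j), map_one]
  rw [tvarDiv, map_neg]
  linear_combination (-tvar F i) * h

/-- The Lagrange basis polynomials at the nodes θ^{q^j} sum to 1. Evaluating at t_i and dividing by
the full product gives the partial fractions. -/
theorem prod_inverse_eq_sum (i : Fin s) {N : ℕ} (hN : N ≠ 0) :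
    ∏ j ∈ Finset.range N, Ring.inverse (1 - tvarDiv (F := F) i j) =
      ∑ j ∈ Finset.range N, const F s (pfCoeff F N j) * Ring.inverse (1 - tvarDiv (F := F) i j) := by
  classical
  have h1 := congrArg (Polynomial.eval₂RingHom (const F s) (tvar F i))
    (Lagrange.sum_basis (s := Finset.range N) (v := thetaPow F) thetaPow_injective.injOn
      (Finset.nonempty_range_iff.2 hN))
  rw [map_one, map_sum] at h1
  have h2 : ∀ j ∈ Finset.range N, Polynomial.eval₂RingHom (const F s) (tvar F i)
      (Lagrange.basis (Finset.range N) (thetaPow F) j) =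
      const F s (pfCoeff F N j) * ∏ k ∈ (Finset.range N).erase j, (1 - tvarDiv i k) := by
    intro j _
    rw [Lagrange.basis, map_prod, pfCoeff, map_prod, ← Finset.prod_mul_distrib]
    refine Finset.prod_congr rfl fun k _ => ?_
    rw [Lagrange.basisDivisor, map_mul, Polynomial.coe_eval₂RingHom, Polynomial.eval₂_C,
      Polynomial.eval₂_sub, Polynomial.eval₂_X, Polynomial.eval₂_C, tvar_sub_const, ← mul_assoc,
      ← map_mul]
    congr 2
    rw [← neg_sub (thetaPow F k), inv_neg, neg_mul_neg, div_eq_inv_mul]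
  rw [Finset.sum_congr rfl h2] at h1
  refine ((mul_one _).symm.trans (congrArg _ h1.symm)).trans ?_
  rw [Finset.mul_sum]
  refine Finset.sum_congr rfl fun j hj => ?_
  rw [← Finset.mul_prod_erase _ _ hj]
  have h3 : (∏ k ∈ (Finset.range N).erase j, Ring.inverse (1 - tvarDiv (F := F) i k)) *
      ∏ k ∈ (Finset.range N).erase j, (1 - tvarDiv i k) = 1 := by
    rw [← Finset.prod_mul_distrib]
    exact Finset.prod_eq_one fun k _ => by
      rw [mul_comm, one_sub_mul_inverse (norm_tvarDiv_lt_one i k)]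
  linear_combination (const F s (pfCoeff F N j) * Ring.inverse (1 - tvarDiv i j)) * h3

/-- The factors with index i > j form the q^j-th power of an inverse partial product of ∏ (1 -
θ^{1-q^k}). Only this part depends on the length of the product, so both the limit and a uniform
bound are visible. -/
theorem pfCoeff_add (n j : ℕ) : pfCoeff F (j + 1 + n) j =
    (∏ i ∈ Finset.range j, thetaPow F i / (thetaPow F i - thetaPow F j)) *
      (lamPartial F n)⁻¹ ^ Fintype.card F ^ j := by
  classical
  have h1 : (Finset.range (j + 1 + n)).erase j =
      (Finset.range (j + 1 + n)) \ {j} := Finset.erase_eq _ _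
  have h2 : pfCoeff F (j + 1 + n) j = (∏ i ∈ Finset.range j, thetaPow F i / (thetaPow F i - thetaPow F j)) *
      ∏ k ∈ Finset.range n, thetaPow F (j + 1 + k) / (thetaPow F (j + 1 + k) - thetaPow F j) := by
    let g : ℕ → CInfty F := fun i => if i = j then 1 else thetaPow F i / (thetaPow F i - thetaPow F j)
    have e1 : pfCoeff F (j + 1 + n) j = ∏ i ∈ Finset.range (j + 1 + n), g i := by
      rw [pfCoeff, ← Finset.mul_prod_erase (Finset.range (j + 1 + n)) g (a := j)
        (Finset.mem_range.2 (by omega))]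
      simp only [g, if_true, one_mul]
      exact Finset.prod_congr rfl fun i hi => by rw [if_neg (Finset.ne_of_mem_erase hi)]
    rw [e1, Finset.prod_range_add, Finset.prod_range_succ]
    simp only [g, if_true, mul_one]
    congr 1
    · exact Finset.prod_congr rfl fun i hi => by rw [if_neg (Finset.mem_range.1 hi).ne]
    · exact Finset.prod_congr rfl fun i hi => by rw [if_neg (by omega)]
  rw [h2]
  congr 1
  rw [lamPartial, ← Finset.prod_inv_distrib, ← Finset.prod_pow]
  refine Finset.prod_congr rfl fun k _ => ?_
  have h0 := thetaPow_ne_zero (F := F) (j + 1 + k)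
  rw [inv_pow, sub_pow_card_pow, one_pow, div_pow, thetaPow_pow,
    show k + 1 + j = j + 1 + k by ring, one_sub_div h0, inv_div]
  rfl

theorem norm_pfCoeff_le {N j : ℕ} (h : j < N) : ‖pfCoeff F N j‖ ≤ ‖thetaC F‖⁻¹ ^ j := by
  obtain ⟨n, rfl⟩ : ∃ n, N = j + 1 + n := ⟨N - (j + 1), by omega⟩
  rw [pfCoeff_add, norm_mul, norm_pow, norm_inv, norm_lamPartial, inv_one, one_pow, mul_one,
    norm_prod, ← Finset.card_range j, ← Finset.prod_const, Finset.card_range]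
  refine Finset.prod_le_prod (fun _ _ => norm_nonneg _) fun i hi => ?_
  have hi := Finset.mem_range.1 hi
  rw [norm_div, norm_thetaPow_sub hi.ne, max_eq_right (norm_thetaPow_lt' hi).le, ← norm_div]
  exact norm_div_thetaPow_le hi

variable (F) in
/-- The limits of the coefficients `pfCoeff`. -/
noncomputable def pfLimit (j : ℕ) : CInfty F :=
  (∏ i ∈ Finset.range j, thetaPow F i / (thetaPow F i - thetaPow F j)) *
      (lamC F)⁻¹ ^ Fintype.card F ^ j

theorem tendsto_pfCoeff (j : ℕ) : Tendsto (fun N => pfCoeff F N j) atTop (𝓝 (pfLimit F j)) := by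
  rw [← tendsto_add_atTop_iff_nat (j + 1)]
  simp only [add_comm _ (j + 1), pfCoeff_add]
  exact ((tendsto_lamPartial.inv₀ lamC_ne_zero).pow _).const_mul _

theorem norm_pfLimit_le (j : ℕ) : ‖pfLimit F j‖ ≤ ‖thetaC F‖⁻¹ ^ j :=
  le_of_tendsto (tendsto_pfCoeff j).norm
    (eventually_atTop.2 ⟨j + 1, fun _ hN => norm_pfCoeff_le hN⟩)

theorem norm_const_mul_inverse_le (c : CInfty F) (i : Fin s) (j : ℕ) :
    ‖const F s c * Ring.inverse (1 - tvarDiv (F := F) i j)‖ ≤ ‖c‖ := by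
  rw [norm_const_mul]
  exact mul_le_of_le_one_right (norm_nonneg _) (norm_inverse_one_sub_le (norm_tvarDiv_lt_one i j))

/-- Passage to the limit in the finite expansions by dominated convergence, with the bound
`norm_pfCoeff_le` uniform in N. -/
theorem omega_eq_tsum (ϖ : CInfty F) (i : Fin s) :
    omega ϖ i = ∑' j, const F s (ϖ * pfLimit F j) * Ring.inverse (1 - tvarDiv (F := F) i j) := by
  classical
  have h1 := (multipliable_inverse_one_sub (summable_norm_tvarDiv (F := F) i)
    (norm_tvarDiv_lt_one i)).hasProd.tendsto_prod_nat
  let g : ℕ → ℕ → Tate F s := fun N j =>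
    if j < N then const F s (pfCoeff F N j) * Ring.inverse (1 - tvarDiv (F := F) i j) else 0
  have h2 : Tendsto (fun N => ∑' j, g N j) atTop
      (𝓝 (∑' j, const F s (pfLimit F j) * Ring.inverse (1 - tvarDiv (F := F) i j))) := by
    refine tendsto_tsum_of_dominated_convergence (bound := fun j => ‖thetaC F‖⁻¹ ^ j)
      summable_inv_norm_pow (fun j => ?_) (Eventually.of_forall fun N j => ?_)
    · have h3 : Tendsto (fun N => const F s (pfCoeff F N j) *
          Ring.inverse (1 - tvarDiv (F := F) i j)) atTop
          (𝓝 (const F s (pfLimit F j) * Ring.inverse (1 - tvarDiv (F := F) i j))) :=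
        ((continuous_const.tendsto _).comp (tendsto_pfCoeff j)).mul_const _
      refine h3.congr' (eventually_atTop.2 ⟨j + 1, fun N hN => ?_⟩)
      simp only [g, if_pos (show j < N from hN)]
    · simp only [g]
      split_ifs with h
      · exact (norm_const_mul_inverse_le _ i j).trans (norm_pfCoeff_le h)
      · simp
  have h3 : (fun N => ∑' j, g N j) =ᶠ[atTop]
      fun N => ∏ j ∈ Finset.range N, Ring.inverse (1 - tvarDiv (F := F) i j) := by
    refine eventually_atTop.2 ⟨1, fun N hN => ?_⟩
    simp only
    rw [prod_inverse_eq_sum i (by omega), tsum_eq_sum (s := Finset.range N)]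
    · exact Finset.sum_congr rfl fun j hj => by simp only [g, if_pos (Finset.mem_range.1 hj)]
    · intro j hj
      simp only [g, if_neg (Finset.mem_range.not.1 hj)]
  have h4 := tendsto_nhds_unique h1 (h2.congr' h3)
  have h5 : Summable fun j => const F s (pfLimit F j) * Ring.inverse (1 - tvarDiv (F := F) i j) :=
    Summable.of_norm_bounded summable_inv_norm_pow fun j =>
      (norm_const_mul_inverse_le _ i j).trans (norm_pfLimit_le j)
  rw [omega_eq, h4, ← h5.tsum_mul_left]
  simp only [map_mul, mul_assoc]

end Omega

end CarlitzTate

namespace CarlitzTate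

/-! ### The Carlitz exponential on ℂ_∞ and on 𝕋_s -/

section Exponential

variable {F : Type*} [Field F] [Fintype F] {s : ℕ}

variable (F) in
/-- The image of `D_j` in `ℂ_∞`. -/
noncomputable def carlitzDC (j : ℕ) : CInfty F := ratToC F (algebraMap F[X] (RatFunc F) (carlitzD F j))

@[simp]
theorem carlitzDC_zero : carlitzDC F 0 = 1 := by simp [carlitzDC, carlitzD]

theorem carlitzDC_succ (j : ℕ) : carlitzDC F (j + 1) =
    (thetaPow F (j + 1) - thetaC F) * carlitzDC F j ^ Fintype.card F := by
  simp [carlitzDC, carlitzD, thetaPow, thetaC]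

theorem thetaPow_succ_sub_ne_zero (j : ℕ) : thetaPow F (j + 1) - thetaC F ≠ 0 := by
  rw [← thetaPow_zero, sub_ne_zero]
  exact thetaPow_injective.ne (Nat.succ_ne_zero j)

theorem norm_thetaPow_succ_sub (j : ℕ) : ‖thetaPow F (j + 1) - thetaC F‖ = ‖thetaPow F (j + 1)‖ := by
  rw [← thetaPow_zero, norm_thetaPow_sub (Nat.succ_ne_zero j),
    max_eq_left (norm_thetaPow_lt' (Nat.succ_pos j)).le]

theorem carlitzDC_ne_zero (j : ℕ) : carlitzDC F j ≠ 0 := by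
  induction j with
  | zero => simp
  | succ j ih =>
    rw [carlitzDC_succ]
    exact mul_ne_zero (thetaPow_succ_sub_ne_zero j) (pow_ne_zero _ ih)

theorem norm_carlitzDC (j : ℕ) : ‖carlitzDC F j‖ = (‖thetaC F‖ ^ j) ^ Fintype.card F ^ j := by
  induction j with
  | zero => simp
  | succ j ih =>
    rw [carlitzDC_succ, norm_mul, norm_thetaPow_succ_sub, norm_pow, ih, norm_thetaPow]
    ring

theorem carlitzDC_eq_prod (j : ℕ) :
    carlitzDC F j = ∏ i ∈ Finset.range j, (thetaPow F j - thetaPow F i) := by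
  induction j with
  | zero => simp
  | succ j ih =>
    rw [carlitzDC_succ, ih, Finset.prod_range_succ', thetaPow_zero, mul_comm, ← Finset.prod_pow]
    congr 1
    refine Finset.prod_congr rfl fun i _ => ?_
    have := sub_pow_card_pow 1 (thetaPow F j) (thetaPow F i)
    rwa [thetaPow_pow, thetaPow_pow, pow_one] at this

/-- Since |D_j| = |θ|^{j q^j}, the term equals (r |θ|^{-j})^{q^j}, whose base is eventually at most
1/2. -/
theorem summable_expTerm (r : ℝ) (hr : 0 ≤ r) :
    Summable fun j => r ^ Fintype.card F ^ j / ‖carlitzDC F j‖ := by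
  have h1 : Tendsto (fun j : ℕ => r * ‖thetaC F‖⁻¹ ^ j) atTop (𝓝 0) := by
    simpa using (tendsto_pow_atTop_nhds_zero_of_lt_one (inv_nonneg.2 (norm_nonneg (thetaC F)))
      (inv_lt_one_of_one_lt₀ (one_lt_norm_thetaC F))).const_mul r
  refine Summable.of_norm_bounded_eventually_nat summable_geometric_two ?_
  filter_upwards [h1.eventually (ge_mem_nhds (by norm_num : (0 : ℝ) < 1 / 2))] with j hj
  have h0 : 0 ≤ r * ‖thetaC F‖⁻¹ ^ j := by positivity
  have h2 : r ^ Fintype.card F ^ j / ‖carlitzDC F j‖ =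
      (r * ‖thetaC F‖⁻¹ ^ j) ^ Fintype.card F ^ j := by
    rw [norm_carlitzDC, mul_pow, inv_pow, inv_pow, div_eq_mul_inv]
  rw [h2, Real.norm_of_nonneg (by positivity)]
  exact (pow_le_pow_left₀ h0 hj _).trans (pow_le_pow_of_le_one (by norm_num) (by norm_num)
    (Nat.lt_pow_self Fintype.one_lt_card).le)

/-- The Carlitz exponential on `ℂ_∞`. -/
noncomputable def expC (z : CInfty F) : CInfty F := ∑' j, z ^ Fintype.card F ^ j / carlitzDC F j

theorem summable_expC (z : CInfty F) : Summable fun j => z ^ Fintype.card F ^ j / carlitzDC F j :=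
  Summable.of_norm_bounded (summable_expTerm (F := F) ‖z‖ (norm_nonneg z)) fun j => by simp

theorem summable_carlitzExp (f : Tate F s) :
    Summable fun j => const F s (carlitzDC F j)⁻¹ * tau^[j] f :=
  Summable.of_norm_bounded (summable_expTerm (F := F) ‖f‖ (norm_nonneg f)) fun j => by
    rw [norm_const_mul, norm_inv, div_eq_inv_mul]
    exact mul_le_mul_of_nonneg_left (norm_tau_iterate_le j f) (inv_nonneg.2 (norm_nonneg _))

theorem tateCoeff_carlitzExp (f : Tate F s) (μ : Fin s →₀ ℕ) :
    tateCoeff μ (carlitzExp f) = expC (tateCoeff μ f) := by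
  have h := (summable_carlitzExp f).map_tsum (tateCoeff μ) (continuous_tateCoeff μ)
  refine h.trans ?_
  simp only [tateCoeff_const_mul, tateCoeff_tau_iterate, expC, div_eq_inv_mul]

theorem expC_add (x y : CInfty F) : expC (x + y) = expC x + expC y := by
  simp only [expC, add_pow_card_pow, add_div]
  exact (summable_expC x).tsum_add (summable_expC y)

theorem expC_C_mul (c : F) (x : CInfty F) :
    expC (ratToC F (RatFunc.C c) * x) = ratToC F (RatFunc.C c) * expC x := by
  simp only [expC, mul_pow, ratToC_C_pow_card_pow, mul_div_assoc]
  exact (summable_expC x).tsum_mul_left _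

/-- Write θ^{q^{j+1}} = θ + (θ^{q^{j+1}} - θ). The bracket cancels against D_{j+1} = (θ^{q^{j+1}} -
θ) D_j^q and leaves the q-th power of the preceding term. -/
theorem expC_theta_mul (z : CInfty F) :
    expC (thetaC F * z) = thetaC F * expC z + expC z ^ Fintype.card F := by
  have h1 : expC z ^ Fintype.card F =
      ∑' j, (z ^ Fintype.card F ^ j / carlitzDC F j) ^ Fintype.card F := by
    have h := (summable_expC z).map_tsum (frobC F) (by
      simpa only [funext (frobC_apply F)] using continuous_pow (Fintype.card F))
    simp only [frobC_apply] at h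
    exact h
  have h2 : Summable fun j => (z ^ Fintype.card F ^ j / carlitzDC F j) ^ Fintype.card F := by
    have h := (summable_expC z).map (frobC F) (by
      simpa only [funext (frobC_apply F)] using continuous_pow (Fintype.card F))
    simpa only [Function.comp_def, frobC_apply] using h
  have h3 := (summable_expC (thetaC F * z)).tsum_eq_zero_add
  have h4 := (summable_expC z).tsum_eq_zero_add
  rw [h1]
  rw [← expC] at h3 h4
  rw [h3, h4, mul_add, add_assoc, ← (((summable_nat_add_iff 1).2 (summable_expC z))).tsum_mul_left,
    ← (((summable_nat_add_iff 1).2 (summable_expC z)).mul_left _).tsum_add h2]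
  congr 1
  · simp
  · refine tsum_congr fun j => ?_
    have ha := carlitzDC_ne_zero (F := F) j
    have hb := thetaPow_succ_sub_ne_zero (F := F) j
    rw [carlitzDC_succ, mul_pow, div_pow, ← pow_mul z, ← pow_succ]
    have hc : thetaC F ^ Fintype.card F ^ (j + 1) = thetaPow F (j + 1) := rfl
    rw [hc]
    field_simp
    ring

/-! ### The fundamental period -/

variable {ϖ : CInfty F}

/-- The fundamental period `θ ϖ ∏_{k ≥ 1} (1 - θ^{1 - q^k})⁻¹`. -/
noncomputable def period (ϖ : CInfty F) : CInfty F := thetaC F * ϖ * (lamC F)⁻¹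

theorem root_ne_zero (hϖ : ϖ ^ (Fintype.card F - 1) = -thetaC F) : ϖ ≠ 0 := by
  rintro rfl
  rw [zero_pow (Nat.sub_ne_zero_of_lt Fintype.one_lt_card), zero_eq_neg] at hϖ
  exact thetaC_ne_zero F hϖ

theorem root_pow_card (hϖ : ϖ ^ (Fintype.card F - 1) = -thetaC F) :
    ϖ ^ Fintype.card F = -thetaC F * ϖ := by
  rw [← hϖ, pow_sub_one_mul Fintype.card_ne_zero]

theorem period_ne_zero (hϖ : ϖ ^ (Fintype.card F - 1) = -thetaC F) : period ϖ ≠ 0 :=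
  mul_ne_zero (mul_ne_zero (thetaC_ne_zero F) (root_ne_zero hϖ)) (inv_ne_zero lamC_ne_zero)

theorem norm_period_pow (hϖ : ϖ ^ (Fintype.card F - 1) = -thetaC F) :
    ‖period ϖ‖ ^ (Fintype.card F - 1) = ‖thetaC F‖ ^ Fintype.card F := by
  rw [period, norm_mul, norm_inv, norm_lamC, inv_one, mul_one, norm_mul, mul_pow, ← norm_pow ϖ, hϖ,
    norm_neg, pow_sub_one_mul Fintype.card_ne_zero]

theorem root_pow_card_pow (hϖ : ϖ ^ (Fintype.card F - 1) = -thetaC F) (j : ℕ) :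
    ϖ ^ Fintype.card F ^ j = ϖ * ∏ i ∈ Finset.range j, (-thetaPow F i) := by
  induction j with
  | zero => simp
  | succ j ih =>
    rw [pow_succ', pow_mul, root_pow_card hϖ, mul_pow, ih, Finset.prod_range_succ, neg_pow_card_pow,
      thetaPow]
    ring

/-- Matches the j-th partial fraction coefficient of ω with the j-th term of the exponential series;
the sign and the powers of θ come from ϖ^{q^j} = ϖ ∏_{i<j} (-θ^{q^i}). -/
theorem root_mul_pfLimit (hϖ : ϖ ^ (Fintype.card F - 1) = -thetaC F) (j : ℕ) :
    ϖ * pfLimit F j = (carlitzDC F j)⁻¹ * (period ϖ ^ Fintype.card F ^ j * (thetaPow F j)⁻¹) := by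
  have h1 : ∀ i ∈ Finset.range j, thetaPow F i / (thetaPow F i - thetaPow F j) =
      -thetaPow F i / (thetaPow F j - thetaPow F i) := fun i _ => by
    rw [← neg_sub (thetaPow F j), div_neg, neg_div]
  rw [pfLimit, Finset.prod_congr rfl h1, Finset.prod_div_distrib, ← carlitzDC_eq_prod, period, mul_pow,
    mul_pow, root_pow_card_pow hϖ]
  have h2 := thetaPow_ne_zero (F := F) j
  have h3 : thetaC F ^ Fintype.card F ^ j = thetaPow F j := rfl
  rw [h3]
  field_simp

theorem inverse_theta_sub (i : Fin s) (j : ℕ) :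
    (const F s (thetaPow F j) - tvar F i) *
      (const F s (thetaPow F j)⁻¹ * Ring.inverse (1 - tvarDiv i j)) = 1 := by
  have h : const F s (thetaPow F j) * const F s (thetaPow F j)⁻¹ = 1 := by
    rw [← map_mul, mul_inv_cancel₀ (thetaPow_ne_zero j), map_one]
  have h1 := tvar_sub_const (F := F) i j
  have h2 := one_sub_mul_inverse (norm_tvarDiv_lt_one (F := F) i j)
  rw [map_neg] at h1
  linear_combination (-const F s (thetaPow F j)⁻¹ * Ring.inverse (1 - tvarDiv i j)) * h1 +
    (const F s (thetaPow F j) * const F s (thetaPow F j)⁻¹) * h2 + h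

theorem inverse_theta_sub_eq (i : Fin s) (j : ℕ) :
    Ring.inverse (const F s (thetaPow F j) - tvar F i) =
      const F s (thetaPow F j)⁻¹ * Ring.inverse (1 - tvarDiv i j) := by
  have h := inverse_theta_sub (F := F) i j
  have hu : IsUnit (const F s (thetaPow F j) - tvar F i) := .of_mul_eq_one _ h
  refine hu.mul_left_cancel ?_
  rw [Ring.mul_inverse_cancel _ hu, h]

theorem tau_iterate_inverse (i : Fin s) (j : ℕ) :
    tau^[j] (Ring.inverse (const F s (thetaC F) - tvar F i)) =
      Ring.inverse (const F s (thetaPow F j) - tvar F i) := by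
  have h0 : IsUnit (const F s (thetaC F) - tvar F i) := by
    have := inverse_theta_sub (F := F) i 0
    rw [thetaPow_zero] at this
    exact .of_mul_eq_one _ this
  have hu : IsUnit (const F s (thetaPow F j) - tvar F i) :=
    .of_mul_eq_one _ (inverse_theta_sub (F := F) i j)
  refine hu.mul_left_cancel ?_
  rw [Ring.mul_inverse_cancel _ hu]
  have h1 : tau^[j] (const F s (thetaC F) - tvar F i) = const F s (thetaPow F j) - tvar F i := by
    rw [tau_iterate_eq, map_sub, ← tau_iterate_eq, ← tau_iterate_eq, tau_iterate_const,
      tau_iterate_tvar]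
    rfl
  rw [← h1, tau_iterate_eq, tau_iterate_eq, ← map_mul, Ring.mul_inverse_cancel _ h0, map_one]

/-- As τ^j sends 1/(θ - t) to 1/(θ^{q^j} - t), the exponential series is the partial fraction
expansion of ω. -/
theorem carlitzExp_period (hϖ : ϖ ^ (Fintype.card F - 1) = -thetaC F) (i : Fin s) :
    carlitzExp (const F s (period ϖ) * Ring.inverse (const F s (thetaC F) - tvar F i)) =
      omega ϖ i := by
  rw [omega_eq_tsum]
  refine tsum_congr fun j => ?_
  rw [tau_iterate_eq, map_mul, ← tau_iterate_eq, ← tau_iterate_eq, tau_iterate_const,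
    tau_iterate_inverse, inverse_theta_sub_eq, root_mul_pfLimit hϖ]
  simp only [map_mul, mul_assoc]
  rfl

/-- The constant coefficient as a ring homomorphism. -/
noncomputable def tateConstCoeff : Tate F s →+* CInfty F :=
  MvPowerSeries.constantCoeff.comp (Subring.subtype _)

theorem tateConstCoeff_apply (f : Tate F s) : tateConstCoeff f = tateCoeff 0 f := by
  change MvPowerSeries.constantCoeff f.1 = MvPowerSeries.coeff 0 f.1
  rw [MvPowerSeries.coeff_zero_eq_constantCoeff_apply]

@[simp]
theorem tateConstCoeff_const (c : CInfty F) : tateConstCoeff (const F s c) = c := by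
  rw [tateConstCoeff_apply, tateCoeff_const, if_pos rfl]

@[simp]
theorem tateConstCoeff_tvar (i : Fin s) : tateConstCoeff (tvar F i) = 0 :=
  MvPowerSeries.constantCoeff_X i

theorem tateConstCoeff_omega (i : Fin s) : tateConstCoeff (omega ϖ i) = ϖ := by
  have h1 : tateConstCoeff (omegaInv (F := F) i) = 1 := by
    have h2 := ((continuous_tateCoeff (F := F) (s := s) 0).tendsto _).comp (tendsto_omegaInv (F := F) i)
    rw [tateConstCoeff_apply]
    refine tendsto_nhds_unique h2 (tendsto_const_nhds.congr fun n => ?_)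
    rw [Function.comp_apply, ← tateConstCoeff_apply, map_prod]
    exact (Finset.prod_eq_one fun j _ => by simp [tvarDiv]).symm
  have h3 := congrArg tateConstCoeff (omega_mul_omegaInv ϖ i)
  rwa [map_mul, h1, mul_one, tateConstCoeff_const] at h3

/-- The constant term in t of the identity exp_C(π/(θ - t)) = ω(t). -/
theorem expC_period_div (hϖ : ϖ ^ (Fintype.card F - 1) = -thetaC F) :
    expC (period ϖ / thetaC F) = ϖ := by
  have h1 := congrArg (tateCoeff 0) (carlitzExp_period (s := 1) hϖ 0)
  rw [tateCoeff_carlitzExp, ← tateConstCoeff_apply, ← tateConstCoeff_apply, tateConstCoeff_omega,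
    map_mul, tateConstCoeff_const] at h1
  have h2 := congrArg tateConstCoeff (inverse_theta_sub (F := F) (0 : Fin 1) 0)
  rw [← inverse_theta_sub_eq, map_mul, map_sub, map_one, tateConstCoeff_const, tateConstCoeff_tvar,
    sub_zero, thetaPow_zero] at h2
  rwa [eq_inv_of_mul_eq_one_right h2, ← div_eq_mul_inv] at h1

theorem expC_period (hϖ : ϖ ^ (Fintype.card F - 1) = -thetaC F) : expC (period ϖ) = 0 := by
  have h := expC_theta_mul (period ϖ / thetaC F)
  rw [mul_div_cancel₀ _ (thetaC_ne_zero F), expC_period_div hϖ, root_pow_card hϖ] at h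
  rw [h]; ring

/-- The embedding `A → ℂ_∞`. -/
noncomputable def polyToC : F[X] →+* CInfty F := (ratToC F).comp (algebraMap F[X] (RatFunc F))

theorem polyToC_X : polyToC (Polynomial.X : F[X]) = thetaC F := by simp [polyToC, thetaC]

theorem polyToC_C (c : F) : polyToC (Polynomial.C c) = ratToC F (RatFunc.C c) := by
  simp [polyToC]

theorem polyToC_injective : Function.Injective (polyToC (F := F)) :=
  (ratToC F).injective.comp (RatFunc.algebraMap_injective F)

theorem one_le_norm_polyToC {a : F[X]} (ha : a ≠ 0) : 1 ≤ ‖polyToC a‖ := by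
  rw [polyToC, RingHom.comp_apply, norm_ratToC_algebraMap F ha]
  exact one_le_pow₀ (one_lt_norm_thetaC F).le

theorem expC_period_mul (hϖ : ϖ ^ (Fintype.card F - 1) = -thetaC F) (a : F[X]) :
    expC (period ϖ * polyToC a) = 0 := by
  induction a using Polynomial.induction_on with
  | C c => rw [polyToC_C, mul_comm, expC_C_mul, expC_period hϖ, mul_zero]
  | add a b ha hb => rw [map_add, mul_add, expC_add, ha, hb, add_zero]
  | monomial n c h =>
    rw [pow_succ', mul_left_comm, map_mul, polyToC_X, mul_left_comm, expC_theta_mul, h, mul_zero,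
      zero_pow Fintype.card_ne_zero, add_zero]

/-- Because |π|^{q-1} = |θ|^q, for |z| < |π| every later term is at most ρ|z| with ρ < 1. The
leading term z therefore cannot be cancelled unless it is 0. -/
theorem eq_zero_of_expC_eq_zero_of_norm_lt (hϖ : ϖ ^ (Fintype.card F - 1) = -thetaC F)
    {z : CInfty F} (hz : ‖z‖ < ‖period ϖ‖) (h : expC z = 0) : z = 0 := by
  have hθ0 : 0 < ‖thetaC F‖ := zero_lt_one.trans (one_lt_norm_thetaC F)
  have hθq : 0 < ‖thetaC F‖ ^ Fintype.card F := pow_pos hθ0 _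
  set ρ := ‖z‖ ^ (Fintype.card F - 1) / ‖thetaC F‖ ^ Fintype.card F with hρ
  have hρ0 : 0 ≤ ρ := by positivity
  have hρ1 : ρ < 1 := by
    rw [hρ, div_lt_one hθq, ← norm_period_pow hϖ]
    exact pow_lt_pow_left₀ hz (norm_nonneg _) (Nat.sub_ne_zero_of_lt Fintype.one_lt_card)
  have hstep : ∀ j, ‖z ^ Fintype.card F ^ j / carlitzDC F j‖ ≤ ‖z‖ →
      ‖z ^ Fintype.card F ^ (j + 1) / carlitzDC F (j + 1)‖ ≤ ρ * ‖z‖ := by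
    intro j hj
    have h1 : z ^ Fintype.card F ^ (j + 1) / carlitzDC F (j + 1) =
        (z ^ Fintype.card F ^ j / carlitzDC F j) ^ Fintype.card F / (thetaPow F (j + 1) - thetaC F) := by
      rw [carlitzDC_succ, div_pow, ← pow_mul, ← pow_succ, div_div, mul_comm (_ - _)]
    have h2 : ‖thetaC F‖ ^ Fintype.card F ≤ ‖thetaPow F (j + 1) - thetaC F‖ := by
      rw [norm_thetaPow_succ_sub, norm_thetaPow]
      exact pow_le_pow_right₀ (one_lt_norm_thetaC F).le
        (Nat.le_self_pow (Nat.succ_ne_zero j) _)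
    rw [h1, norm_div, norm_pow]
    have h3 : ρ * ‖z‖ = ‖z‖ ^ Fintype.card F / ‖thetaC F‖ ^ Fintype.card F := by
      rw [hρ, div_mul_eq_mul_div, pow_sub_one_mul Fintype.card_ne_zero]
    rw [h3]
    exact div_le_div₀ (by positivity) (pow_le_pow_left₀ (norm_nonneg _) hj _) hθq h2
  have hle : ∀ j, ‖z ^ Fintype.card F ^ j / carlitzDC F j‖ ≤ ‖z‖ := by
    intro j
    induction j with
    | zero => simp
    | succ j ih => exact (hstep j ih).trans (mul_le_of_le_one_left (norm_nonneg _) hρ1.le)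
  have h4 := (summable_expC z).tsum_eq_zero_add
  rw [← expC, h] at h4
  have h5 : ‖∑' j, z ^ Fintype.card F ^ (j + 1) / carlitzDC F (j + 1)‖ ≤ ρ * ‖z‖ :=
    (IsUltrametricDist.norm_tsum_le _).trans (ciSup_le fun j => hstep j (hle j))
  have h6 : ‖z‖ ≤ ρ * ‖z‖ := by
    have h7 : z = -∑' j, z ^ Fintype.card F ^ (j + 1) / carlitzDC F (j + 1) := by
      rw [eq_neg_iff_add_eq_zero]
      simpa using h4.symm
    conv_lhs => rw [h7, norm_neg]
    exact h5
  by_contra hz0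
  have : 0 < ‖z‖ := norm_pos_iff.2 hz0
  nlinarith

theorem exists_C_eq_of_pow_card_eq {x : CInfty F} (hx : x ^ Fintype.card F = x) :
    ∃ c : F, x = ratToC F (RatFunc.C c) := by
  have hm : (Polynomial.X ^ Fintype.card F - Polynomial.X : F[X]).Monic :=
    Polynomial.monic_X_pow_sub (by
      rw [Polynomial.degree_X]; exact_mod_cast Fintype.one_lt_card)
  have h1 := Polynomial.prod_multiset_X_sub_C_of_monic_of_roots_card_eq hm (by
    rw [FiniteField.roots_X_pow_card_sub_X, FiniteField.X_pow_card_sub_X_natDegree_eq F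
      Fintype.one_lt_card]; rfl)
  rw [FiniteField.roots_X_pow_card_sub_X] at h1
  have h2 := congrArg (Polynomial.eval₂RingHom ((ratToC F).comp RatFunc.C) x) h1
  change Polynomial.eval₂RingHom _ x (∏ c : F, (Polynomial.X - Polynomial.C c)) = _ at h2
  rw [map_prod] at h2
  simp only [Polynomial.coe_eval₂RingHom, Polynomial.eval₂_sub, Polynomial.eval₂_pow,
    Polynomial.eval₂_X, Polynomial.eval₂_C, hx, sub_self] at h2
  obtain ⟨c, _, hc⟩ := Finset.prod_eq_zero_iff.1 h2
  exact ⟨c, sub_eq_zero.1 hc⟩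

/-- Descent on |z|. If exp(z) = 0, the functional equation shows that x = exp(z/θ) satisfies x^q =
-θx, so x = cϖ with c ∈ F. Subtracting cπ/θ from z/θ gives another zero, with norm bound smaller by
|θ|, until the previous case applies. -/
theorem expC_eq_zero_iff (hϖ : ϖ ^ (Fintype.card F - 1) = -thetaC F) (z : CInfty F) :
    expC z = 0 ↔ ∃ a : F[X], z = period ϖ * polyToC a := by
  constructor
  · have key : ∀ (N : ℕ) (z : CInfty F), ‖z‖ < ‖period ϖ‖ * ‖thetaC F‖ ^ N → expC z = 0 →
        ∃ a : F[X], z = period ϖ * polyToC a := by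
      intro N
      induction N with
      | zero =>
        intro z hz h
        exact ⟨0, by
          rw [eq_zero_of_expC_eq_zero_of_norm_lt hϖ (by simpa using hz) h, map_zero, mul_zero]⟩
      | succ N ih =>
        intro z hz h
        have hθ := thetaC_ne_zero F
        have hθ1 := one_lt_norm_thetaC F
        have hϖ0 := root_ne_zero hϖ
        have h1 := expC_theta_mul (z / thetaC F)
        rw [mul_div_cancel₀ _ hθ, h] at h1
        obtain ⟨c, hc⟩ : ∃ c : F, expC (z / thetaC F) / ϖ = ratToC F (RatFunc.C c) := by
          refine exists_C_eq_of_pow_card_eq ?_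
          rw [div_pow, root_pow_card hϖ]
          field_simp
          linear_combination h1
        have h2 : expC (z / thetaC F + ratToC F (RatFunc.C (-c)) * (period ϖ / thetaC F)) = 0 := by
          rw [expC_add, expC_C_mul, expC_period_div hϖ, map_neg, map_neg, ← hc]
          field_simp
          ring
        have h3 : ‖z / thetaC F + ratToC F (RatFunc.C (-c)) * (period ϖ / thetaC F)‖ <
            ‖period ϖ‖ * ‖thetaC F‖ ^ N := by
          have hpos : 0 < ‖thetaC F‖ := norm_pos_iff.2 hθ
          have hper : 0 < ‖period ϖ‖ := norm_pos_iff.2 (period_ne_zero hϖ)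
          refine (IsUltrametricDist.norm_add_le_max _ _).trans_lt (max_lt ?_ ?_)
          · rw [norm_div, div_lt_iff₀ hpos, mul_assoc, ← pow_succ]
            exact hz
          · rw [norm_mul]
            refine (mul_le_of_le_one_left (norm_nonneg _) (norm_ratToC_C_le_one F _)).trans_lt ?_
            rw [norm_div, div_lt_iff₀ hpos, mul_assoc, ← pow_succ]
            exact lt_mul_of_one_lt_right hper (one_lt_pow₀ hθ1 (Nat.succ_ne_zero N))
        obtain ⟨a, ha⟩ := ih _ h3 h2
        refine ⟨Polynomial.X * a + Polynomial.C c, ?_⟩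
        rw [map_add, map_mul, polyToC_X, polyToC_C, mul_add, mul_left_comm, ← ha, map_neg, map_neg]
        field_simp
        ring
    intro h
    have hper : 0 < ‖period ϖ‖ := norm_pos_iff.2 (period_ne_zero hϖ)
    obtain ⟨N, hN⟩ := pow_unbounded_of_one_lt (‖z‖ / ‖period ϖ‖) (one_lt_norm_thetaC F)
    exact key N z (by rwa [div_lt_iff₀' hper] at hN) h
  · rintro ⟨a, rfl⟩
    exact expC_period_mul hϖ a

theorem tateCoeff_intToPoly (a : MvPolynomial (Fin s) F[X]) (μ : Fin s →₀ ℕ) :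
    tateCoeff μ (polyToTate F s (intToPoly F s a)) = polyToC (a.coeff μ) := by
  rw [tateCoeff_polyToTate, intToPoly, MvPolynomial.coeff_map]
  rfl

/-- The exponential acts coefficientwise, so each coefficient lies in πA. Nonzero elements of πA
have norm at least |π|, while the coefficients tend to 0, so only finitely many are nonzero. -/
theorem carlitzExp_eq_zero_iff (hϖ : ϖ ^ (Fintype.card F - 1) = -thetaC F) (f : Tate F s) :
    carlitzExp f = 0 ↔ ∃ a : MvPolynomial (Fin s) F[X],
      f = const F s (period ϖ) * polyToTate F s (intToPoly F s a) := by
  classical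
  have hper : 0 < ‖period ϖ‖ := norm_pos_iff.2 (period_ne_zero hϖ)
  constructor
  · intro h
    have h1 : ∀ μ, ∃ a : F[X], tateCoeff μ f = period ϖ * polyToC a := fun μ => by
      rw [← expC_eq_zero_iff hϖ, ← tateCoeff_carlitzExp, h, map_zero]
    choose a ha using h1
    have hfin : {μ | a μ ≠ 0}.Finite := by
      have h2 := (tendsto_norm_tateCoeff f).eventually (gt_mem_nhds hper)
      refine Set.Finite.subset h2 fun μ hμ => ?_
      simp only [Set.mem_compl_iff, Set.mem_ofPred_eq, not_lt, ha, norm_mul]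
      exact le_mul_of_one_le_right hper.le (one_le_norm_polyToC hμ)
    refine ⟨∑ μ ∈ hfin.toFinset, MvPolynomial.monomial μ (a μ), tate_ext fun μ => ?_⟩
    rw [tateCoeff_const_mul, tateCoeff_intToPoly, ha, MvPolynomial.coeff_sum]
    simp only [MvPolynomial.coeff_monomial, Finset.sum_ite_eq', Set.Finite.mem_toFinset,
      Set.mem_ofPred_eq, ne_eq, ite_not]
    split_ifs with h0
    · rw [h0]
    · rfl
  · rintro ⟨a, rfl⟩
    refine tate_ext fun μ => ?_
    rw [tateCoeff_carlitzExp, tateCoeff_const_mul, tateCoeff_intToPoly, expC_period_mul hϖ, map_zero]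

/-- Two generators of the kernel differ by a unit of A, a constant c ∈ F^*. It multiplies the value
at 1/(θ - t) by c, so the normalisation to ω, with constant term ϖ ≠ 0, forces c = 1. -/
theorem isFundamentalPeriod_iff (hϖ : ϖ ^ (Fintype.card F - 1) = -thetaC F) (x : CInfty F) :
    IsFundamentalPeriod ϖ x ↔ x = period ϖ := by
  have hper := period_ne_zero hϖ
  constructor
  · rintro ⟨hker, hx⟩
    have h1 : carlitzExp (const F 1 x) = 0 := (hker _).2 ⟨1, by simp⟩
    have h2 : carlitzExp (const F 1 (period ϖ)) = 0 :=
      (carlitzExp_eq_zero_iff hϖ _).2 ⟨1, by simp⟩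
    obtain ⟨a, ha⟩ := (carlitzExp_eq_zero_iff hϖ _).1 h1
    obtain ⟨b, hb⟩ := (hker _).1 h2
    have ha := congrArg (tateCoeff 0) ha
    have hb := congrArg (tateCoeff 0) hb
    rw [tateCoeff_const_mul, tateCoeff_intToPoly, tateCoeff_const, if_pos rfl] at ha hb
    have h3 : polyToC (a.coeff 0 * b.coeff 0) = 1 := by
      rw [map_mul]
      refine mul_left_cancel₀ hper ?_
      rw [← mul_assoc, ← ha, ← hb, mul_one]
    have h4 : a.coeff 0 * b.coeff 0 = 1 := polyToC_injective (by rw [h3, map_one])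
    obtain ⟨c, hc, hca⟩ := Polynomial.isUnit_iff.1 (IsUnit.of_mul_eq_one _ h4)
    rw [← hca, polyToC_C] at ha
    have h5 : omega ϖ (0 : Fin 1) = const F 1 (ratToC F (RatFunc.C c)) * omega ϖ 0 := by
      rw [← carlitzExp_period hϖ (0 : Fin 1)]
      conv_lhs => rw [carlitzExp_period hϖ (0 : Fin 1), ← hx]
      refine tate_ext fun μ => ?_
      rw [tateCoeff_const_mul, tateCoeff_carlitzExp, tateCoeff_carlitzExp, tateCoeff_const_mul,
        tateCoeff_const_mul, ha, ← expC_C_mul]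
      congr 1
      ring
    have h6 := congrArg (tateCoeff 0) h5
    rw [tateCoeff_const_mul, ← tateConstCoeff_apply, tateConstCoeff_omega] at h6
    rw [ha, ← mul_right_cancel₀ (root_ne_zero hϖ) ((one_mul ϖ).trans h6), mul_one]
  · rintro rfl
    exact ⟨fun f => carlitzExp_eq_zero_iff hϖ f, carlitzExp_period hϖ 0⟩

end Exponential

end CarlitzTate

namespace CarlitzTate

section Limit

variable {F : Type*} [Field F] [Fintype F] {s : ℕ}

/-! ### The norm of the twisted harmonic sums -/

theorem norm_polyToTate_aeval_le (i : Fin s) (a : F[X]) :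
    ‖polyToTate F s (Polynomial.aeval (MvPolynomial.X i) a)‖ ≤ 1 := by
  induction a using Polynomial.induction_on with
  | C c =>
    rw [Polynomial.aeval_C]
    have : algebraMap F (MvPolynomial (Fin s) (RatFunc F)) c = MvPolynomial.C (RatFunc.C c) := rfl
    rw [this, polyToTate_C, norm_const]
    exact norm_ratToC_C_le_one F c
  | add a b ha hb =>
    rw [map_add, map_add]
    exact (IsUltrametricDist.norm_add_le_max _ _).trans (max_le ha hb)
  | monomial n c h =>
    rw [pow_succ, ← mul_assoc, map_mul, map_mul, Polynomial.aeval_X, polyToTate_X]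
    exact (norm_mul_le _ _).trans (mul_le_one₀ h (norm_nonneg _) (norm_tvar_le i))

theorem norm_prod_le_one {ι : Type*} (t : Finset ι) (f : ι → Tate F s) (h : ∀ i ∈ t, ‖f i‖ ≤ 1) :
    ‖∏ i ∈ t, f i‖ ≤ 1 :=
  (Finset.norm_prod_le t f).trans (Finset.prod_le_one (fun _ _ => norm_nonneg _) h)

theorem norm_polyToTate_powerSum_le {d : ℕ} (hd : d ≠ 0) :
    ‖polyToTate F s (powerSum F s 1 d)‖ ≤ ‖thetaC F‖⁻¹ := by
  have hθ := one_lt_norm_thetaC F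
  rw [powerSum, map_sum]
  refine IsUltrametricDist.norm_sum_le_of_forall_le_of_nonneg (inv_nonneg.2 (norm_nonneg _))
    fun a ha => ?_
  obtain ⟨hmon, hdeg⟩ := (mem_monics F).1 ha
  rw [map_mul, polyToTate_C, norm_const_mul, zpow_one, map_inv₀, norm_inv,
    norm_ratToC_algebraMap F hmon.ne_zero, hdeg, map_prod]
  refine (mul_le_of_le_one_right (by positivity)
    (norm_prod_le_one _ _ fun i _ => norm_polyToTate_aeval_le i a)).trans ?_
  exact inv_anti₀ (zero_lt_one.trans hθ) (le_self_pow₀ hθ.le hd)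

theorem powerSum_zero : powerSum F s 1 0 = 1 := by
  simp [powerSum, sum_monics_eq, coeffPoly_apply]

/-- The term a = 1 is 1, and every other term has norm at most 1/|θ|. -/
theorem norm_polyToTate_harmonicSum (d : ℕ) :
    ‖polyToTate F s (harmonicSum F s 1 (d + 1))‖ = 1 := by
  have hθ := inv_lt_one_of_one_lt₀ (one_lt_norm_thetaC F)
  rw [harmonicSum, Finset.sum_range_succ', powerSum_zero, map_add, map_one]
  have h : ‖polyToTate F s (∑ i ∈ Finset.range d, powerSum F s 1 (i + 1))‖ < 1 := by
    rw [map_sum]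
    exact (IsUltrametricDist.norm_sum_le_of_forall_le_of_nonneg (inv_nonneg.2 (norm_nonneg _))
      fun i _ => norm_polyToTate_powerSum_le (Nat.succ_ne_zero i)).trans_lt hθ
  rw [IsUltrametricDist.norm_add_eq_max_of_norm_ne_norm (by rw [norm_one]; exact h.ne), norm_one,
    max_eq_right h.le]

/-! ### The limit formula -/

variable (F s) in
/-- The inclusion `A[t_1, …, t_s] → 𝕋_s`. -/
noncomputable def intToTate : MvPolynomial (Fin s) F[X] →+* Tate F s :=
  (polyToTate F s).comp (intToPoly F s)

theorem intToTate_apply (p : MvPolynomial (Fin s) F[X]) :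
    intToTate F s p = polyToTate F s (intToPoly F s p) := rfl

theorem intToTate_injective : Function.Injective (intToTate F s) :=
  polyToTate_injective.comp (intToPoly_injective F s)

theorem intToTate_X (i : Fin s) : intToTate F s (MvPolynomial.X i) = tvar F i := by
  simp [intToTate, intToPoly]

theorem intToTate_C (a : F[X]) : intToTate F s (MvPolynomial.C a) = const F s (polyToC a) := by
  simp [intToTate, intToPoly, polyToC]

variable (F) in
/-- The product `∏_{j < n} (-θ^{q^j})`. -/
noncomputable def thetaProd (n : ℕ) : CInfty F := ∏ j ∈ Finset.range n, (-thetaPow F j)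

theorem thetaProd_ne_zero (n : ℕ) : thetaProd F n ≠ 0 :=
  Finset.prod_ne_zero_iff.2 fun j _ => neg_ne_zero.2 (thetaPow_ne_zero j)

theorem thetaProd_succ (n : ℕ) : thetaProd F (n + 1) = thetaProd F n * -thetaPow F n :=
  Finset.prod_range_succ _ _

/-- The extra factor -θ supplies the missing index 0 in ∏ (-θ^{q^j}). -/
theorem polyToC_prod_X_sub (N : ℕ) :
    -thetaC F * polyToC (∏ j ∈ Finset.range N,
      (Polynomial.X - Polynomial.X ^ Fintype.card F ^ (j + 1) : F[X])) =
      thetaProd F (N + 1) * lamPartial F N := by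
  rw [thetaProd, Finset.prod_range_succ', lamPartial, map_prod, thetaPow_zero, mul_right_comm,
    ← Finset.prod_mul_distrib, mul_comm]
  congr 1
  refine Finset.prod_congr rfl fun j _ => ?_
  rw [map_sub, map_pow, polyToC_X]
  have := thetaPow_ne_zero (F := F) (j + 1)
  have h : thetaC F ^ Fintype.card F ^ (j + 1) = thetaPow F (j + 1) := rfl
  rw [h]
  field_simp
  ring

/-- The values `H(θ^{q^n}) / θ^{q^n δ}`, where `δ` is the degree of `H`. -/
noncomputable def scaledEval (H : (MvPolynomial (Fin s) F[X])[X]) (n : ℕ) : Tate F s :=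
  ∑ k ∈ Finset.range (H.natDegree + 1),
    intToTate F s (H.coeff k) * const F s ((thetaPow F n)⁻¹ ^ (H.natDegree - k))

theorem intToTate_eval (H : (MvPolynomial (Fin s) F[X])[X]) (n : ℕ) :
    intToTate F s (H.eval (MvPolynomial.C (Polynomial.X ^ Fintype.card F ^ n))) =
      const F s (thetaPow F n ^ H.natDegree) * scaledEval H n := by
  rw [Polynomial.eval_eq_sum_range, map_sum, scaledEval, Finset.mul_sum]
  refine Finset.sum_congr rfl fun k hk => ?_
  have hk : k ≤ H.natDegree := Nat.lt_succ_iff.1 (Finset.mem_range.1 hk)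
  rw [map_mul, map_pow, intToTate_C, map_pow, polyToC_X, mul_left_comm, ← map_mul, ← map_pow]
  congr 2
  change thetaPow F n ^ k = _
  rw [← Nat.sub_add_cancel hk, Nat.add_sub_cancel, pow_add, mul_right_comm, ← mul_pow,
    mul_inv_cancel₀ (thetaPow_ne_zero n), one_pow, one_mul]

theorem tendsto_inv_thetaPow : Tendsto (fun n => (thetaPow F n)⁻¹) atTop (𝓝 0) := by
  refine squeeze_zero_norm norm_inv_thetaPow_le ?_
  exact ((tendsto_pow_atTop_nhds_zero_of_lt_one (inv_nonneg.2 (norm_nonneg (thetaC F)))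
      (inv_lt_one_of_one_lt₀ (one_lt_norm_thetaC F))).comp (tendsto_add_atTop_nat 1))

theorem tendsto_scaledEval (H : (MvPolynomial (Fin s) F[X])[X]) :
    Tendsto (scaledEval H) atTop (𝓝 (intToTate F s H.leadingCoeff)) := by
  have h : ∀ k ∈ Finset.range (H.natDegree + 1), Tendsto
      (fun n => intToTate F s (H.coeff k) * const F s ((thetaPow F n)⁻¹ ^ (H.natDegree - k))) atTop
      (𝓝 (if k = H.natDegree then intToTate F s H.leadingCoeff else 0)) := by
    intro k hk
    have hk : k ≤ H.natDegree := Nat.lt_succ_iff.1 (Finset.mem_range.1 hk)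
    split_ifs with hkn
    · subst hkn
      simp
    · have h1 : Tendsto (fun n => (thetaPow F n)⁻¹ ^ (H.natDegree - k)) atTop (𝓝 0) := by
        have := (tendsto_inv_thetaPow (F := F)).pow (H.natDegree - k)
        rwa [zero_pow (by omega)] at this
      have h2 := (((continuous_const (F := F) (s := s)).tendsto 0).comp h1).const_mul
        (intToTate F s (H.coeff k))
      rwa [map_zero, mul_zero] at h2
  have h3 := tendsto_finsetSum _ h
  rw [Finset.sum_ite_eq', if_pos (Finset.self_mem_range_succ _)] at h3
  exact h3

/-- The scalar factor of `F_{n+m}`. -/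
noncomputable def scaleC (F : Type*) [Field F] [Fintype F] (s m δ n : ℕ) : CInfty F :=
  -thetaC F * thetaProd F n ^ s * thetaPow F n ^ δ / thetaProd F (n + m)

/-- The convergent factor of `F_{n+m}`. -/
noncomputable def convFactor (m : ℕ) (H : (MvPolynomial (Fin s) F[X])[X]) (n : ℕ) : Tate F s :=
  const F s (lamPartial F (n + m - 1))⁻¹ *
    (∏ i : Fin s, ∏ j ∈ Finset.range n, (1 - tvarDiv (F := F) i j)) * scaledEval H n

/-- Each t_i - θ^{q^j}, each factor of l and the top power of Y is normalised by its power of θ;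
these powers are collected in `scaleC`, the rest in `convFactor`. -/
theorem polyToTate_harmonicSum_eq {m : ℕ} (hm : 1 ≤ m) {H : (MvPolynomial (Fin s) F[X])[X]}
    (n : ℕ) (hH : lval F s (n + m - 1) * algebraMap (MvPolynomial (Fin s) (RatFunc F)) (RatT F s)
        (harmonicSum F s 1 (n + m)) =
      (∏ i, bval n (tRatT F s i)) * intToRatT F s
        (H.eval (MvPolynomial.C (Polynomial.X ^ Fintype.card F ^ n)))) :
    polyToTate F s (harmonicSum F s 1 (n + m)) =
      const F s (scaleC F s m H.natDegree n) * convFactor m H n := by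
  set N := n + m - 1 with hN
  let lp : F[X] := ∏ j ∈ Finset.range N, (Polynomial.X - Polynomial.X ^ Fintype.card F ^ (j + 1))
  have hl : lval F s N = intToRatT F s (MvPolynomial.C lp) := by
    simp [lval, intToRatT_C, lp]
  simp only [bval_tRatT] at hH
  rw [hl, ← map_prod, ← map_mul] at hH
  have h1 : intToPoly F s (MvPolynomial.C lp) * harmonicSum F s 1 (n + m) = intToPoly F s
      ((∏ i, ∏ j ∈ Finset.range n, (MvPolynomial.X i -
        MvPolynomial.C (Polynomial.X ^ Fintype.card F ^ j))) *
        H.eval (MvPolynomial.C (Polynomial.X ^ Fintype.card F ^ n))) := by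
    refine IsFractionRing.injective (MvPolynomial (Fin s) (RatFunc F)) (RatT F s) ?_
    rw [map_mul]
    exact hH
  have h2 := congrArg (polyToTate F s) h1
  rw [map_mul] at h2
  change intToTate F s _ * _ = intToTate F s _ at h2
  rw [intToTate_C, map_mul, intToTate_eval] at h2
  have h3 : ∀ i : Fin s, intToTate F s (∏ j ∈ Finset.range n, (MvPolynomial.X i -
        MvPolynomial.C (Polynomial.X ^ Fintype.card F ^ j))) =
      const F s (thetaProd F n) * ∏ j ∈ Finset.range n, (1 - tvarDiv (F := F) i j) := fun i => by
    rw [map_prod, thetaProd, map_prod, ← Finset.prod_mul_distrib]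
    refine Finset.prod_congr rfl fun j _ => ?_
    rw [← tvar_sub_const, map_sub, intToTate_X, intToTate_C, map_pow, polyToC_X]
    rfl
  have h3' := (map_prod (intToTate F s) _ Finset.univ).trans
    (Finset.prod_congr rfl fun i _ => h3 i)
  rw [Finset.prod_mul_distrib, Finset.prod_const, Finset.card_univ, Fintype.card_fin] at h3'
  rw [h3'] at h2
  have hlam : lamPartial F N ≠ 0 := norm_pos_iff.1 (by rw [norm_lamPartial]; exact one_pos)
  have hlp := polyToC_prod_X_sub (F := F) N
  have hθ := thetaC_ne_zero F
  have hB := thetaProd_ne_zero (F := F) (N + 1)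
  have hlp0 : polyToC lp ≠ 0 := by
    intro h
    rw [show polyToC (∏ j ∈ Finset.range N,
      (Polynomial.X - Polynomial.X ^ Fintype.card F ^ (j + 1) : F[X])) = 0 from h, mul_zero] at hlp
    exact mul_ne_zero hB hlam hlp.symm
  refine (isUnit_const (s := s) hlp0).mul_left_cancel ?_
  rw [h2, convFactor, scaleC, ← hN]
  have h4 : polyToC lp * (-thetaC F * thetaProd F n ^ s * thetaPow F n ^ H.natDegree /
      thetaProd F (n + m) * (lamPartial F N)⁻¹) = thetaProd F n ^ s * thetaPow F n ^ H.natDegree := by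
    have h5 : n + m = N + 1 := by omega
    rw [h5]
    field_simp
    linear_combination (thetaProd F n ^ s * thetaPow F n ^ H.natDegree) * hlp
  have h6 := congrArg (const F s) h4
  simp only [map_mul, map_pow] at h6 ⊢
  linear_combination (-(∏ i : Fin s, ∏ j ∈ Finset.range n, (1 - tvarDiv (F := F) i j)) * scaledEval H n) * h6

/-- The limit of `convFactor`. -/
noncomputable def convLimit (H : (MvPolynomial (Fin s) F[X])[X]) : Tate F s :=
  const F s (lamC F)⁻¹ * (∏ i : Fin s, omegaInv (F := F) i) * intToTate F s H.leadingCoeff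

theorem tendsto_convFactor {m : ℕ} (hm : 1 ≤ m) (H : (MvPolynomial (Fin s) F[X])[X]) :
    Tendsto (convFactor m H) atTop (𝓝 (convLimit H)) := by
  refine Tendsto.mul (Tendsto.mul ?_ ?_) (tendsto_scaledEval H)
  · refine ((continuous_const (F := F) (s := s)).tendsto _).comp ?_
    have : Tendsto (fun n => n + m - 1) atTop atTop := by
      simp only [Nat.add_sub_assoc hm]
      exact tendsto_add_atTop_nat _
    exact (tendsto_lamPartial.comp this).inv₀ lamC_ne_zero
  · exact tendsto_finsetProd _ fun i _ => tendsto_omegaInv i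

theorem convLimit_ne_zero {H : (MvPolynomial (Fin s) F[X])[X]} (hH : H ≠ 0) : convLimit H ≠ 0 := by
  have h1 : IsUnit (const F s (lamC F)⁻¹ * ∏ i : Fin s, omegaInv (F := F) i) :=
    (isUnit_const (inv_ne_zero lamC_ne_zero)).mul
      (Finset.prod_induction _ IsUnit (fun _ _ => IsUnit.mul) isUnit_one
        fun i _ => isUnit_omegaInv i)
  rw [convLimit, Ne, h1.mul_right_eq_zero, map_eq_zero_iff _ (intToTate_injective (F := F) (s := s))]
  exact Polynomial.leadingCoeff_ne_zero.2 hH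

/-- The new factor -θ^{q^{n+m}} in the denominator is, up to sign, the q^m-th power of θ^{q^n}, so
the whole ratio is a power of θ^{q^n}. -/
theorem norm_scaleC_succ (m δ n : ℕ) : ‖scaleC F s m δ (n + 1)‖ / ‖scaleC F s m δ n‖ =
    ‖thetaPow F n‖ ^ (s + (Fintype.card F - 1) * δ) / ‖thetaPow F n‖ ^ (Fintype.card F ^ m) := by
  have h1 : scaleC F s m δ (n + 1) / scaleC F s m δ n =
      (-1) ^ (s + 1) * (thetaPow F n ^ (s + (Fintype.card F - 1) * δ) /
        thetaPow F n ^ (Fintype.card F ^ m)) := by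
    have hθ := thetaC_ne_zero F
    have hB := thetaProd_ne_zero (F := F) n
    have hB' := thetaProd_ne_zero (F := F) (n + m)
    have hv := thetaPow_ne_zero (F := F) n
    have hq : thetaPow F (n + 1) ^ δ = thetaPow F n ^ ((Fintype.card F - 1) * δ) * thetaPow F n ^ δ := by
      have := thetaPow_pow (F := F) n 1
      rw [pow_one] at this
      rw [← this, ← pow_mul, ← pow_add, ← Nat.succ_mul, Nat.succ_eq_add_one,
        Nat.sub_add_cancel Fintype.card_pos]
    rw [thetaPow_pow, scaleC, scaleC, show n + 1 + m = n + m + 1 by ring, thetaProd_succ,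
      thetaProd_succ, hq]
    have hv' := thetaPow_ne_zero (F := F) (n + m)
    rw [mul_pow, neg_pow (thetaPow F n), pow_add (thetaPow F n) s]
    field_simp
    ring
  rw [← norm_div, h1, norm_mul, norm_pow, norm_neg, norm_one, one_pow, one_mul, norm_div, norm_pow,
    norm_pow]

/-- The norms of the scalars converge to a positive limit, so their successive ratios tend to 1.
These ratios are |θ^{q^n}| to a fixed integer exponent, and they stay at most 1/|θ| or at least |θ|
unless that exponent is 0. -/
theorem natDegree_eq_of_norm_eq_one {m δ : ℕ} {U : ℕ → Tate F s} {U₀ : Tate F s}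
    (hU : Tendsto U atTop (𝓝 U₀)) (hU₀ : U₀ ≠ 0)
    (h1 : ∀ n, ‖const F s (scaleC F s m δ n) * U n‖ = 1) :
    s + (Fintype.card F - 1) * δ = Fintype.card F ^ m := by
  have hpos : 0 < ‖U₀‖ := norm_pos_iff.2 hU₀
  have h2 : ∀ n, ‖scaleC F s m δ n‖ = ‖U n‖⁻¹ := fun n =>
    eq_inv_of_mul_eq_one_left (by rw [← norm_const_mul, h1])
  have h3 : Tendsto (fun n => ‖scaleC F s m δ n‖) atTop (𝓝 ‖U₀‖⁻¹) := by
    simpa only [h2] using hU.norm.inv₀ hpos.ne'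
  have h4 := (h3.comp (tendsto_add_atTop_nat 1)).div h3 (inv_ne_zero hpos.ne')
  rw [div_self (inv_ne_zero hpos.ne')] at h4
  have hθ := one_lt_norm_thetaC F
  have hv : ∀ n, ‖thetaC F‖ ≤ ‖thetaPow F n‖ := fun n => by
    rw [norm_thetaPow]
    exact le_self_pow₀ hθ.le (pow_ne_zero _ Fintype.card_ne_zero)
  have hv1 : ∀ n, 1 < ‖thetaPow F n‖ := fun n => hθ.trans_le (hv n)
  have h5 : Tendsto (fun n => ‖thetaPow F n‖ ^ (s + (Fintype.card F - 1) * δ) /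
      ‖thetaPow F n‖ ^ (Fintype.card F ^ m)) atTop (𝓝 1) := by
    refine h4.congr fun n => ?_
    rw [← norm_scaleC_succ]
    rfl
  rcases lt_trichotomy (s + (Fintype.card F - 1) * δ) (Fintype.card F ^ m) with h | h | h
  · exfalso
    refine absurd (le_of_tendsto' h5 (b := ‖thetaC F‖⁻¹) fun n => ?_)
      (not_le.2 (inv_lt_one_of_one_lt₀ hθ))
    have hp : 0 < ‖thetaPow F n‖ := zero_lt_one.trans (hv1 n)
    rw [div_le_iff₀ (pow_pos hp _), le_inv_mul_iff₀ (zero_lt_one.trans hθ)]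
    calc ‖thetaC F‖ * ‖thetaPow F n‖ ^ (s + (Fintype.card F - 1) * δ)
        ≤ ‖thetaPow F n‖ * ‖thetaPow F n‖ ^ (s + (Fintype.card F - 1) * δ) := by
          gcongr; exact hv n
      _ = ‖thetaPow F n‖ ^ (s + (Fintype.card F - 1) * δ + 1) := (pow_succ' _ _).symm
      _ ≤ _ := pow_le_pow_right₀ (hv1 n).le h
  · exact h
  · exfalso
    refine absurd (ge_of_tendsto' h5 (b := ‖thetaC F‖) fun n => ?_) (not_le.2 hθ)
    have hp : 0 < ‖thetaPow F n‖ := zero_lt_one.trans (hv1 n)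
    rw [le_div_iff₀ (pow_pos hp _)]
    calc ‖thetaC F‖ * ‖thetaPow F n‖ ^ (Fintype.card F ^ m)
        ≤ ‖thetaPow F n‖ * ‖thetaPow F n‖ ^ (Fintype.card F ^ m) := by
          gcongr; exact hv n
      _ = ‖thetaPow F n‖ ^ (Fintype.card F ^ m + 1) := (pow_succ' _ _).symm
      _ ≤ _ := pow_le_pow_right₀ (hv1 n).le h

theorem neg_one_pow_card_pow (j : ℕ) : (-1 : CInfty F) ^ Fintype.card F ^ j = -1 := by
  rw [neg_pow_card_pow, one_pow]

theorem neg_one_pow_eq {m : ℕ} (hs : s = m * (Fintype.card F - 1) + 1) :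
    (-1 : CInfty F) ^ s = -1 := by
  have h1 : (-1 : CInfty F) ^ (Fintype.card F - 1) = 1 := by
    have := neg_one_pow_card_pow (F := F) 1
    rw [pow_one, ← pow_sub_one_mul Fintype.card_ne_zero] at this
    simpa using this
  rw [hs, pow_succ, mul_comm m, pow_mul, h1, one_pow, one_mul]

/-- With the degree determined, the successive ratio is the sign (-1)^{s+1}, equal to 1 because
(-1)^{q-1} = 1 in characteristic p. -/
theorem scaleC_eq {m δ : ℕ} (hs : s = m * (Fintype.card F - 1) + 1)
    (hδ : s + (Fintype.card F - 1) * δ = Fintype.card F ^ m) (n : ℕ) :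
    scaleC F s m δ n = scaleC F s m δ 0 := by
  induction n with
  | zero => rfl
  | succ n ih =>
    rw [← ih]
    have hB' := thetaProd_ne_zero (F := F) (n + m)
    have hv' := thetaPow_ne_zero (F := F) (n + m)
    have hq : thetaPow F (n + 1) ^ δ = thetaPow F n ^ ((Fintype.card F - 1) * δ) * thetaPow F n ^ δ := by
      have := thetaPow_pow (F := F) n 1
      rw [pow_one] at this
      rw [← this, ← pow_mul, ← pow_add, ← Nat.succ_mul, Nat.succ_eq_add_one,
        Nat.sub_add_cancel Fintype.card_pos]
    have hnm : thetaPow F (n + m) = thetaPow F n ^ s * thetaPow F n ^ ((Fintype.card F - 1) * δ) := by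
      rw [← thetaPow_pow, ← hδ, pow_add]
    rw [scaleC, scaleC, show n + 1 + m = n + m + 1 by ring, thetaProd_succ, thetaProd_succ, hq,
      mul_pow, neg_pow (thetaPow F n), neg_one_pow_eq hs, div_eq_div_iff
        (mul_ne_zero hB' (neg_ne_zero.2 hv')) hB', hnm]
    ring

theorem scaleC_zero_mul {m δ : ℕ} (hs : s = m * (Fintype.card F - 1) + 1)
    (hδ : s + (Fintype.card F - 1) * δ = Fintype.card F ^ m) {ϖ : CInfty F}
    (hϖ : ϖ ^ (Fintype.card F - 1) = -thetaC F) :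
    scaleC F s m δ 0 * ϖ ^ s = -thetaC F * ϖ := by
  -- The degree relation reads (q-1)(δ + m) = q^m - 1, so the powers of θ in the scalar and in ϖ^s
  -- cancel.
  have hgeom : ∑ j ∈ Finset.range m, Fintype.card F ^ j = δ + m := by
    have h1 : 0 < Fintype.card F - 1 := Nat.sub_pos_of_lt Fintype.one_lt_card
    have h2 := Nat.geomSum_eq (m := Fintype.card F) Fintype.one_lt_card m
    rw [h2]
    refine Nat.div_eq_of_eq_mul_left h1 ?_
    rw [← hδ, hs, add_mul, mul_comm δ]
    omega
  have hB : thetaProd F m = (-1) ^ m * thetaC F ^ (δ + m) := by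
    rw [← hgeom, ← Finset.prod_pow_eq_pow_sum, thetaProd, Finset.prod_congr rfl fun j _ =>
      neg_eq_neg_one_mul (thetaPow F j), Finset.prod_mul_distrib, Finset.prod_const,
      Finset.card_range]
    rfl
  have hϖs : ϖ ^ s = (-1) ^ m * thetaC F ^ m * ϖ := by
    rw [hs, pow_succ, mul_comm m, pow_mul, hϖ, neg_pow]
  have hB0 := thetaProd_ne_zero (F := F) m
  rw [scaleC, zero_add, div_mul_eq_mul_div, div_eq_iff hB0, hϖs, hB, thetaPow_zero, thetaProd,
    Finset.prod_range_zero, one_pow]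
  ring

theorem inverse_prod_omega {ϖ : CInfty F} (hϖ : ϖ ≠ 0) :
    Ring.inverse (∏ i : Fin s, omega ϖ i) = const F s (ϖ ^ s)⁻¹ * ∏ i : Fin s, omegaInv (F := F) i := by
  have hu : IsUnit (∏ i : Fin s, omega ϖ i) :=
    Finset.prod_induction _ IsUnit (fun _ _ => IsUnit.mul) isUnit_one fun i _ => isUnit_omega hϖ i
  refine hu.mul_left_cancel ?_
  rw [Ring.mul_inverse_cancel _ hu, mul_left_comm, ← Finset.prod_mul_distrib]
  simp only [omega_mul_omegaInv]
  rw [Finset.prod_const, Finset.card_univ, Fintype.card_fin, ← map_pow, ← map_mul,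
    inv_mul_cancel₀ (pow_ne_zero _ hϖ), map_one]

end Limit

end CarlitzTate

open CarlitzTate in
theorem theorem1p3 (F : Type*) [Field F] [Fintype F] (s : ℕ) (hs : Fintype.card F ≤ s)
    (hs1 : s ≡ 1 [MOD Fintype.card F - 1]) (ϖ : CInfty F)
    (hϖ : ϖ ^ (Fintype.card F - 1) = -thetaC F) :
    ∃ (pi : CInfty F) (zeta : Tate F s) (H : Polynomial (MvPolynomial (Fin s) (Polynomial F)))
      (lam : MvPolynomial (Fin s) (Polynomial F)),
      (∀ x : CInfty F, IsFundamentalPeriod ϖ x ↔ x = pi) ∧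
      IsZetaValue F s 1 zeta ∧
      (∀ R : RatFunc (RatT F s), IsHFraction R ↔ R = polyYToFraction F s H) ∧
      (∀ l : MvPolynomial (Fin s) (Polynomial F),
        zeta = const F s pi * polyToTate F s (intToPoly F s l) *
          Ring.inverse (∏ i : Fin s, omega ϖ i) ↔ l = lam) ∧
      H.leadingCoeff = -lam := by
  have hq : 1 < Fintype.card F := Fintype.one_lt_card
  have hq1 : 0 < Fintype.card F - 1 := Nat.sub_pos_of_lt hq
  set m := mval F s with hmdef
  have hsm : s = m * (Fintype.card F - 1) + 1 := by
    have h1 : Fintype.card F - 1 ∣ s - 1 := (Nat.modEq_iff_dvd' (by omega)).1 hs1.symm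
    rw [hmdef, mval, Nat.div_mul_cancel h1]
    omega
  have hm : 1 ≤ m := by
    rw [hmdef, mval, Nat.one_le_div_iff hq1]
    omega
  obtain ⟨H, hH⟩ := exists_interpolating_polynomial F s hm hsm
  have hF : ∀ n, polyToTate F s (harmonicSum F s 1 (n + m)) =
      const F s (scaleC F s m H.natDegree n) * convFactor m H n :=
    fun n => polyToTate_harmonicSum_eq hm n (hH n)
  have hnorm : ∀ n, ‖const F s (scaleC F s m H.natDegree n) * convFactor m H n‖ = 1 := fun n => by
    rw [← hF, show n + m = n + m - 1 + 1 by omega, norm_polyToTate_harmonicSum]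
  -- If H were 0, the sums would vanish, contradicting norm 1.
  have hH0 : H ≠ 0 := by
    rintro rfl
    have := hnorm 0
    simp [convFactor, scaledEval] at this
  have hδ := natDegree_eq_of_norm_eq_one (tendsto_convFactor hm H) (convLimit_ne_zero hH0) hnorm
  have hϖ0 := root_ne_zero hϖ
  refine ⟨period ϖ, const F s (scaleC F s m H.natDegree 0) * convLimit H, H, -H.leadingCoeff,
    isFundamentalPeriod_iff hϖ, ?_, isHFraction_iff F s hm hmdef.symm hH, fun l => ?_,
    (neg_neg _).symm⟩
  · rw [IsZetaValue, ← tendsto_add_atTop_iff_nat m]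
    simp only [hF, scaleC_eq hsm hδ]
    exact (tendsto_convFactor hm H).const_mul _
  · have hu : IsUnit (const F s (period ϖ) * Ring.inverse (∏ i : Fin s, omega ϖ i)) := by
      rw [inverse_prod_omega hϖ0]
      exact (isUnit_const (period_ne_zero hϖ)).mul
        ((isUnit_const (inv_ne_zero (pow_ne_zero _ hϖ0))).mul
          (Finset.prod_induction _ IsUnit (fun _ _ => IsUnit.mul) isUnit_one
            fun i _ => isUnit_omegaInv i))
    -- Matches the constant scalar with π/ϖ^s; the sign here is the one relating λ to the leading
    -- coefficient.
    have hc : scaleC F s m H.natDegree 0 * (lamC F)⁻¹ = -(period ϖ * (ϖ ^ s)⁻¹) := by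
      have h1 := scaleC_zero_mul hsm hδ hϖ
      have h2 := lamC_ne_zero (F := F)
      rw [period]
      field_simp
      linear_combination h1
    have hz : const F s (scaleC F s m H.natDegree 0) * convLimit H =
        const F s (period ϖ) * Ring.inverse (∏ i : Fin s, omega ϖ i) *
          intToTate F s (-H.leadingCoeff) := by
      have h1 := congrArg (const F s) hc
      rw [inverse_prod_omega hϖ0, convLimit, map_neg]
      simp only [map_mul, map_neg] at h1
      linear_combination ((∏ i : Fin s, omegaInv (F := F) i) * intToTate F s H.leadingCoeff) * h1
    rw [hz, mul_right_comm _ (polyToTate F s (intToPoly F s l)), ← intToTate_apply,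
      hu.mul_right_inj, intToTate_injective.eq_iff, eq_comm]
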